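/- Let $\mathcal P$ be a finite set of predicate symbols of arbitrary finite arities, containing two distinct binary symbols $\le$ and $Pred$, and let $\psi$ be a constant-free sentence of $\mathbf C^2$ over $\mathcal P$, that is, a first-order sentence with equality using at most two variables (which may be requantified), in which, besides $\forall$ and $\exists$, counting quantifiers $\exists^{\bowtie k}$ with $\bowtie\;\in\{\le,=,\ge\}$ and $k\in\mathbb N$ are allowed. For $n\in\mathbb N$ let $\mathsf{HB}_n$ be the set of all ground atoms $P(a_1,\dots,a_k)$ with $P\in\mathcal P$ of arity $k$ and $a_1,\dots,a_k\in\{1,\dots,n\}$. A possible world $\omega\subseteq\mathsf{HB}_n$ is a model of $\psi\wedge Linear(\le,Pred)$ if it is a model of $\psi$ over the domain $\{1,\dots,n\}$, the relation $\omega[\le]$ is a linear order of the domain (reflexive, total, antisymmetric and transitive), and for all $x,y$ the atom $Pred(x,y)$ is in $\omega$ if and only if $x$ is the immediate predecessor of $y$ in this order (that is, $x$ is strictly below $y$ and no element lies strictly between them). For weights $w,\overline w:\mathcal P\to\mathbb R$ put $$\mathsf{WFOMC}(\psi\wedge Linear(\le,Pred),n,w,\overline w)=\sum_{\omega\models\psi\wedge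 Linear(\le,Pred)}\ \prod_{l\in\omega}w(\mathsf{pred}(l))\prod_{l\in\mathsf{HB}_n\setminus\omega}\overline w(\mathsf{pred}(l)),$$ where the sum is over the models $\omega\subseteq\mathsf{HB}_n$ and $\mathsf{pred}(l)$ is the predicate symbol of the atom $l$. Then $\mathsf{WFOMC}(\psi\wedge Linear(\le,Pred),n,w,\overline w)$ can be computed in time polynomial in $n$: there are a program and a polynomial $b$, depending only on $\mathcal P$, $\le$, $Pred$ and $\psi$, such that for all $n\in\mathbb N$ and all $w,\overline w:\mathcal P\to\mathbb R$ the program, on input $(n,w,\overline w)$, halts after at most $b(n)$ steps with output $\mathsf{WFOMC}(\psi\wedge Linear(\le,Pred),n,w,\overline w)$. Here programs are those of a random access machine with one memory for natural numbers and one for real numbers, whose steps are: addition, truncated subtraction and zero tests of natural numbers; addition, subtraction and multiplication of real numbers; loading natural or rational constants; and moving a number from or to a memory cell whose address is a stored natural number. Real numbers are never tested. -/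

import Mathlib

/-! ### Two-variable first-order logic with counting quantifiers

A relational language has `m` predicate symbols, indexed by `Fin m`; the symbol `P` has arity
`ar P` (any natural number).  The two logical variables are the elements of `Fin 2`. -/

/-- The comparison signs allowed in a counting quantifier. -/
inductive CountCmp where
  | le
  | eq
  | ge

/-- `c.holds a k`: the number `a` stands in relation `c` to `k`. -/
def CountCmp.holds : CountCmp → ℕ → ℕ → Prop
  | .le, a, k => a ≤ k
  | .eq, a, k => a = k
  | .ge, a, k => k ≤ a

/-- Constant-free formulas of C²: first-order formulas with equality over the two variables
`Fin 2` (which may be requantified), with counting quantifiers `∃^{⋈ k} v`. -/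
inductive C2Formula {m : ℕ} (ar : Fin m → ℕ) where
  | atom (P : Fin m) (t : Fin (ar P) → Fin 2)
  | equal (u v : Fin 2)
  | neg (φ : C2Formula ar)
  | and (φ χ : C2Formula ar)
  | or (φ χ : C2Formula ar)
  | imp (φ χ : C2Formula ar)
  | iff (φ χ : C2Formula ar)
  | all (v : Fin 2) (φ : C2Formula ar)
  | ex (v : Fin 2) (φ : C2Formula ar)
  | exCount (c : CountCmp) (k : ℕ) (v : Fin 2) (φ : C2Formula ar)

namespace C2Formula

/-- The free variables of a formula. -/
def freeVars {m : ℕ} {ar : Fin m → ℕ} : C2Formula ar → Finset (Fin 2)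
  | atom _ t => Finset.univ.image t
  | equal u v => {u, v}
  | neg φ => φ.freeVars
  | and φ χ => φ.freeVars ∪ χ.freeVars
  | or φ χ => φ.freeVars ∪ χ.freeVars
  | imp φ χ => φ.freeVars ∪ χ.freeVars
  | iff φ χ => φ.freeVars ∪ χ.freeVars
  | all v φ => φ.freeVars.erase v
  | ex v φ => φ.freeVars.erase v
  | exCount _ _ v φ => φ.freeVars.erase v

/-- A sentence is a formula without free variables. -/
def IsSentence {m : ℕ} {ar : Fin m → ℕ} (φ : C2Formula ar) : Prop :=
  φ.freeVars = ∅

end C2Formula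

/-! ### Herbrand semantics over the domain `Fin n` -/

/-- The Herbrand base: all ground atoms `P(a₁, …, a_k)` with `a_i` in the domain `Fin n`. -/
abbrev GroundAtom {m : ℕ} (ar : Fin m → ℕ) (n : ℕ) : Type :=
  (P : Fin m) × (Fin (ar P) → Fin n)

/-- A possible world is a subset of the Herbrand base. -/
abbrev World {m : ℕ} (ar : Fin m → ℕ) (n : ℕ) : Type :=
  Finset (GroundAtom ar n)

/-- Satisfaction of a formula in a possible world under a partial assignment of domain elements to
the variables (partial, so that sentences have their usual meaning over the empty domain as well).
The assignment is defined on all free variables whenever one starts from a sentence. -/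
def C2Formula.Sat {m : ℕ} {ar : Fin m → ℕ} {n : ℕ} (ω : World ar n) :
    (Fin 2 → Option (Fin n)) → C2Formula ar → Prop
  | e, .atom P t => ∃ a : Fin (ar P) → Fin n, (∀ i, e (t i) = some (a i)) ∧ ⟨P, a⟩ ∈ ω
  | e, .equal u v => ∃ a : Fin n, e u = some a ∧ e v = some a
  | e, .neg φ => ¬ φ.Sat ω e
  | e, .and φ χ => φ.Sat ω e ∧ χ.Sat ω e
  | e, .or φ χ => φ.Sat ω e ∨ χ.Sat ω e
  | e, .imp φ χ => φ.Sat ω e → χ.Sat ω e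
  | e, .iff φ χ => (φ.Sat ω e ↔ χ.Sat ω e)
  | e, .all v φ => ∀ a : Fin n, φ.Sat ω (Function.update e v (some a))
  | e, .ex v φ => ∃ a : Fin n, φ.Sat ω (Function.update e v (some a))
  | e, .exCount c k v φ =>
      c.holds {a : Fin n | φ.Sat ω (Function.update e v (some a))}.ncard k

/-- `ω` is a model of the sentence `ψ`. -/
def C2Formula.Models {m : ℕ} {ar : Fin m → ℕ} {n : ℕ} (ω : World ar n) (ψ : C2Formula ar) : Prop :=
  ψ.Sat ω (fun _ => none)

/-- The binary relation on the domain that the world `ω` assigns to the predicate `R` of arity 2: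
`R(a, b) ∈ ω`. -/
def World.rel {m : ℕ} {ar : Fin m → ℕ} {n : ℕ} (ω : World ar n) (R : Fin m) (hR : ar R = 2)
    (a b : Fin n) : Prop :=
  (⟨R, fun i => ![a, b] (Fin.cast hR i)⟩ : GroundAtom ar n) ∈ ω

/-- The linear order axioms for a binary relation. -/
structure IsLinearOrderRel {α : Type} (r : α → α → Prop) : Prop where
  refl : ∀ x, r x x
  total : ∀ x y, r x y ∨ r y x
  antisymm : ∀ x y, r x y → r y x → x = y
  trans : ∀ x y z, r x y → r y z → r x z

/-- `x` is the immediate predecessor of `y` with respect to the order `r`: it is strictly below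
`y`, and nothing lies strictly between them. -/
def IsImmediatePred {α : Type} (r : α → α → Prop) (x y : α) : Prop :=
  (r x y ∧ ¬ r y x) ∧ ¬ ∃ z, (r x z ∧ ¬ r z x) ∧ (r z y ∧ ¬ r y z)

/-- `ω` is a model of `ψ ∧ Linear(le, pr)`. -/
def ModelsLinearPred {m : ℕ} {ar : Fin m → ℕ} (ψ : C2Formula ar) (le pr : Fin m)
    (hle : ar le = 2) (hpr : ar pr = 2) {n : ℕ} (ω : World ar n) : Prop :=
  ψ.Models ω ∧ IsLinearOrderRel (ω.rel le hle) ∧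
    ∀ x y, ω.rel pr hpr x y ↔ IsImmediatePred (ω.rel le hle) x y

/-! ### Weighted first-order model counting -/

open Classical in
/-- `WFOMC(φ, n, w, w̄)`, where `φ` is given by its class `M` of models over the domain of size `n`:
the sum over the models `ω` of the product of the positive weights of the atoms in `ω` and of the
negative weights of the atoms of the Herbrand base outside `ω`. -/
noncomputable def WFOMC {m : ℕ} {ar : Fin m → ℕ} (n : ℕ) (M : World ar n → Prop)
    (w wbar : Fin m → ℝ) : ℝ :=
  ∑ ω : World ar n with M ω, (∏ l ∈ ω, w l.1) * ∏ l ∈ ωᶜ, wbar l.1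

/-! ### Random access machines over the reals, with a step count

Structured programs over two unbounded memories, one holding natural numbers (used for counters and
addresses) and one holding real numbers.  Natural numbers can be added and subtracted (truncated)
but not multiplied in one step, and real numbers can be added, subtracted and multiplied.  Real
numbers cannot be tested, rounded or converted to natural numbers, so that the control flow and the
running time depend on the natural-number input alone.  A program contains only natural and
rational constants. -/

namespace RealRAM

/-- The contents of the two memories. -/
structure State where
  nat : ℕ → ℕ
  real : ℕ → ℝ

/-- The elementary instructions; the first argument names the cell that is written, except that
the two `store` instructions write to the cell whose address is held in natural-number cell `i`. -/
inductive Instr where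
  | natConst (i c : ℕ)
  | natAdd (i j k : ℕ)
  | natSub (i j k : ℕ)
  | natLoad (i j : ℕ)
  | natStore (i j : ℕ)
  | realConst (i : ℕ) (q : ℚ)
  | realAdd (i j k : ℕ)
  | realSub (i j k : ℕ)
  | realMul (i j k : ℕ)
  | realLoad (i j : ℕ)
  | realStore (i j : ℕ)

/-- The effect of an elementary instruction. -/
noncomputable def Instr.exec : Instr → State → State
  | natConst i c, s => { s with nat := Function.update s.nat i c }
  | natAdd i j k, s => { s with nat := Function.update s.nat i (s.nat j + s.nat k) }
  | natSub i j k, s => { s with nat := Function.update s.nat i (s.nat j - s.nat k) }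
  | natLoad i j, s => { s with nat := Function.update s.nat i (s.nat (s.nat j)) }
  | natStore i j, s => { s with nat := Function.update s.nat (s.nat i) (s.nat j) }
  | realConst i q, s => { s with real := Function.update s.real i (q : ℝ) }
  | realAdd i j k, s => { s with real := Function.update s.real i (s.real j + s.real k) }
  | realSub i j k, s => { s with real := Function.update s.real i (s.real j - s.real k) }
  | realMul i j k, s => { s with real := Function.update s.real i (s.real j * s.real k) }
  | realLoad i j, s => { s with real := Function.update s.real i (s.real (s.nat j)) }
  | realStore i j, s => { s with real := Function.update s.real (s.nat i) (s.real j) }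

/-- Programs; the branching and loop conditions ask whether natural-number cell `i` is nonzero. -/
inductive Prog where
  | skip
  | instr (c : Instr)
  | seq (p q : Prog)
  | ifNonzero (i : ℕ) (p q : Prog)
  | whileNonzero (i : ℕ) (p : Prog)

/-- `Run p s t s'`: started in state `s`, the program `p` halts in state `s'` after exactly `t`
steps.  Every elementary instruction and every evaluation of a condition costs one step. -/
inductive Run : Prog → State → ℕ → State → Prop where
  | skip (s : State) : Run .skip s 0 s
  | instr (c : Instr) (s : State) : Run (.instr c) s 1 (c.exec s)
  | seq {p q : Prog} {s s' s'' : State} {t t' : ℕ} (hp : Run p s t s') (hq : Run q s' t' s'') :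
      Run (.seq p q) s (t + t') s''
  | ifTrue {i : ℕ} {p q : Prog} {s s' : State} {t : ℕ} (hi : s.nat i ≠ 0) (hp : Run p s t s') :
      Run (.ifNonzero i p q) s (t + 1) s'
  | ifFalse {i : ℕ} {p q : Prog} {s s' : State} {t : ℕ} (hi : s.nat i = 0) (hq : Run q s t s') :
      Run (.ifNonzero i p q) s (t + 1) s'
  | whileStop {i : ℕ} {p : Prog} {s : State} (hi : s.nat i = 0) :
      Run (.whileNonzero i p) s 1 s
  | whileStep {i : ℕ} {p : Prog} {s s' s'' : State} {t t' : ℕ} (hi : s.nat i ≠ 0)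
      (hp : Run p s t s') (hw : Run (.whileNonzero i p) s' t' s'') :
      Run (.whileNonzero i p) s (t + 1 + t') s''

/-- The initial state on input `(n, w, w̄)`: natural-number cell `0` holds `n`, real cells `2 i` and
`2 i + 1` hold `w i` and `w̄ i` for each predicate `i`, and every other cell holds `0`. -/
noncomputable def initState {m : ℕ} (n : ℕ) (w wbar : Fin m → ℝ) : State where
  nat := fun a => if a = 0 then n else 0
  real := fun a =>
    if h : a / 2 < m then (if a % 2 = 0 then w ⟨a / 2, h⟩ else wbar ⟨a / 2, h⟩) else 0

/-- `F (n, w, w̄)` can be computed in time polynomial in `n`: one program, on every input, halts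
after a number of steps that is bounded by a fixed polynomial in `n`, with the value of `F` in real
cell `0`. -/
def ComputableInPolyTime {m : ℕ} (F : ℕ → (Fin m → ℝ) → (Fin m → ℝ) → ℝ) : Prop :=
  ∃ (prog : Prog) (b : Polynomial ℕ), ∀ (n : ℕ) (w wbar : Fin m → ℝ),
    ∃ (t : ℕ) (s : State), Run prog (initState n w wbar) t s ∧ t ≤ b.eval n ∧
      s.real 0 = F n w wbar

end RealRAM

/-! Fixing the order. Truth is invariant under renaming the domain and a finite chain has no
nontrivial automorphism, so the count is `n!` times the sum over the models in which the order is
the standard one and `Pred` its successor relation (`wfomc_eq`).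

Removing quantifiers. With two variables, a quantified subformula has at most one free variable, so
its truth is a property of one element; `∀` and `∃` are counting quantifiers with thresholds `0`
(for the negated scope) and `1`. Guess the truth values of all quantified subformulas at all
elements. Exactly one guess is confirmed by counting (`validGuess_iff`), so summing over confirmed
guesses changes nothing. Relative to a guess, `ψ` and all scopes are quantifier-free: their value at
a pair depends only on the nullary atoms, the types of the two elements (guessed bits included) and
the atoms joining them (`guessEval_pair`). Atoms with three or more distinct elements are never
read, and each contributes a factor `w + w̄` (`sum_prod_wideAtom`).

Dynamic programming along the order. What remains is a sum over a type for each element and an edge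
for each pair, with conditions on how many neighbours of each kind an element has. Elements are
added in increasing order. All that matters of an old element is its state: its type, its counts
truncated above all thresholds, and whether it is the last so far, hence the immediate predecessor
of the next one. The number of states does not depend on `n`, so the generating polynomial, with one
variable per state, has polynomially many coefficients. A new element acts by substitution: each
state variable becomes a sum over edges of a weight times the variable of the new state times
markers for the counts at the new element; the markers are then read off, truncated, and turned into
the variable of the new element (`stepOp_total`). At the end, the variables of states with a wrong
guess or with `ψ` false become `0`, the others `1`.

Machine. Polynomials are stored as dense coefficient tables; the digits of a position in base `(n +
2) ^ G` are the exponents. Multiplying or dividing by a variable moves positions by a power of the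
base. Together with scalar multiples, sums and loops of length `n`, these moves give all operators
used (`OpExpr.computable`). Substitution is a loop that replaces one factor of the variable at a
time (`replaceX_pow`), and factorials and powers are obtained by the same means. -/

namespace RealRAM

/-! ### Combinators for machine programs of polynomial running time. -/

/-- Two states agree when they have the same real memory and the same first 32 natural cells. -/
def State.Agree (s s' : State) : Prop :=
  s.real = s'.real ∧ ∀ i < 32, s.nat i = s'.nat i

/-- `Impl f`: the state transformer `f` leaves the natural cells `0` and `1` alone, and (as long as
cell `1` holds `1`) is carried out, up to the natural cells from `32` on, by programs whose running
time is polynomial in the content of cell `0`; the programs can be chosen to preserve any given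
number of the cells from `32` on. -/
def Impl (f : State → State) : Prop :=
  (∀ s, (f s).nat 0 = s.nat 0 ∧ (f s).nat 1 = s.nat 1) ∧
  ∀ d : ℕ, ∃ (p : Prog) (b : Polynomial ℕ), ∀ s s' : State, s.Agree s' → s.nat 1 = 1 →
    ∃ (t : ℕ) (s'' : State), Run p s' t s'' ∧ (f s).Agree s'' ∧
      (∀ i < d, s''.nat (32 + i) = s'.nat (32 + i)) ∧ t ≤ b.eval (s.nat 0)

/-- The instructions that use the first 32 natural cells only and do not write to cells `0`, `1`. -/
def Instr.Safe : Instr → Prop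
  | natConst i _ => 2 ≤ i ∧ i < 32
  | natAdd i j k => (2 ≤ i ∧ i < 32) ∧ j < 32 ∧ k < 32
  | natSub i j k => (2 ≤ i ∧ i < 32) ∧ j < 32 ∧ k < 32
  | natLoad _ _ => False
  | natStore _ _ => False
  | realConst _ _ => True
  | realAdd _ _ _ => True
  | realSub _ _ _ => True
  | realMul _ _ _ => True
  | realLoad _ j => j < 32
  | realStore i _ => i < 32

theorem Impl.instr {c : Instr} (hc : c.Safe) : Impl c.exec := by
  refine ⟨fun s => ?_, fun d => ⟨.instr c, 1, fun s s' h _ => ⟨1, _, Run.instr c s', ?_, ?_, by simp⟩⟩⟩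
  · cases c <;> simp_all only [Instr.Safe, Instr.exec, and_self, Function.update_apply] <;>
      constructor <;> (rw [if_neg]; omega)
  · obtain ⟨hr, hn⟩ := h
    cases c <;> simp only [Instr.Safe] at hc <;> refine ⟨?_, fun i hi => ?_⟩ <;>
      simp only [Instr.exec, hr, Function.update_apply]
    all_goals first
      | exact hn i hi
      | (rw [hn _ hc.2.1, hn _ hc.2.2, hn i hi])
      | (rw [hn _ hc]) 
      | (rw [hn i hi])
  · intro i hi
    cases c <;> simp only [Instr.Safe] at hc <;> simp only [Instr.exec, Function.update_apply] <;>
      (rw [if_neg]; omega)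

theorem Impl.id : Impl (fun s => s) :=
  ⟨fun _ => ⟨rfl, rfl⟩, fun _ => ⟨.skip, 0, fun _ s' h _ => ⟨0, s', Run.skip s', h, by simp, by simp⟩⟩⟩

theorem Impl.seq {f g : State → State} (hf : Impl f) (hg : Impl g) : Impl (fun s => g (f s)) := by
  refine ⟨fun s => ⟨(hg.1 _).1.trans (hf.1 s).1, (hg.1 _).2.trans (hf.1 s).2⟩, fun d => ?_⟩
  obtain ⟨p, b, hp⟩ := hf.2 d
  obtain ⟨q, c, hq⟩ := hg.2 d
  refine ⟨.seq p q, b + c, fun s s' h h1 => ?_⟩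
  obtain ⟨t, s1, r1, a1, k1, b1⟩ := hp s s' h h1
  obtain ⟨t', s2, r2, a2, k2, b2⟩ := hq (f s) s1 a1 ((hf.1 s).2.trans h1)
  refine ⟨_, s2, Run.seq r1 r2, a2, fun i hi => (k2 i hi).trans (k1 i hi), ?_⟩
  rw [(hf.1 s).1] at b2
  rw [Polynomial.eval_add]
  omega

theorem Impl.ite {f g : State → State} (hf : Impl f) (hg : Impl g) {i : ℕ} (hi : i < 32) :
    Impl (fun s => if s.nat i = 0 then g s else f s) := by
  refine ⟨fun s => ?_, fun d => ?_⟩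
  · dsimp only
    split_ifs
    exacts [hg.1 s, hf.1 s]
  obtain ⟨p, b, hp⟩ := hf.2 d
  obtain ⟨q, c, hq⟩ := hg.2 d
  refine ⟨.ifNonzero i p q, b + c + 1, fun s s' h h1 => ?_⟩
  by_cases h0 : s.nat i = 0
  · obtain ⟨t, s1, r1, a1, k1, b1⟩ := hq s s' h h1
    refine ⟨_, s1, Run.ifFalse (by rw [← h.2 i hi, h0]) r1, by simpa [h0] using a1, k1, ?_⟩
    simp only [Polynomial.eval_add, Polynomial.eval_one]
    omega
  · obtain ⟨t, s1, r1, a1, k1, b1⟩ := hp s s' h h1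
    refine ⟨_, s1, Run.ifTrue (by rwa [← h.2 i hi]) r1, by simpa [h0] using a1, k1, ?_⟩
    simp only [Polynomial.eval_add, Polynomial.eval_one]
    omega

theorem Impl.iterate_nat {f : State → State} (hf : Impl f) (k : ℕ) (s : State) :
    (f^[k] s).nat 0 = s.nat 0 ∧ (f^[k] s).nat 1 = s.nat 1 := by
  induction k generalizing s with
  | zero => exact ⟨rfl, rfl⟩
  | succ k ih =>
    rw [Function.iterate_succ_apply]
    exact ⟨(ih _).1.trans (hf.1 s).1, (ih _).2.trans (hf.1 s).2⟩

/-- Looping as often as natural cell `0` says. -/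
theorem Impl.iter {f : State → State} (hf : Impl f) : Impl (fun s => f^[s.nat 0] s) := by
  refine ⟨fun s => hf.iterate_nat _ s, fun d => ?_⟩
  -- The loop counter is cell `32 + d`, so the body has to preserve one cell more than the loop.
  -- This is why `Impl` asks for programs for every `d`: nested loops get distinct counters.
  obtain ⟨p, b, hp⟩ := hf.2 (d + 1)
  have loop : ∀ (k : ℕ) (s s' : State), s.Agree s' → s.nat 1 = 1 → s'.nat (32 + d) = k →
      ∃ (t : ℕ) (s'' : State),
        Run (.whileNonzero (32 + d) (.seq p (.instr (.natSub (32 + d) (32 + d) 1)))) s' t s'' ∧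
        (f^[k] s).Agree s'' ∧ (∀ i < d, s''.nat (32 + i) = s'.nat (32 + i)) ∧
        t ≤ k * (b.eval (s.nat 0) + 2) + 1 := by
    intro k
    induction k with
    | zero =>
      intro s s' h _ hk
      exact ⟨1, s', Run.whileStop hk, h, fun _ _ => rfl, by omega⟩
    | succ k ih =>
      intro s s' h h1 hk
      obtain ⟨t, s1, r1, a1, k1, b1⟩ := hp s s' h h1
      have r2 := Run.instr (.natSub (32 + d) (32 + d) 1) s1
      set s2 := (Instr.natSub (32 + d) (32 + d) 1).exec s1 with hs2
      have h11 : s1.nat 1 = 1 := by rw [← a1.2 1 (by norm_num), (hf.1 s).2, h1]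
      have a2 : (f s).Agree s2 := by
        refine ⟨a1.1, fun i hi => ?_⟩
        rw [hs2]
        simp only [Instr.exec, Function.update_apply]
        rw [if_neg (by omega)]
        exact a1.2 i hi
      have hk2 : s2.nat (32 + d) = k := by
        rw [hs2]
        simp only [Instr.exec, Function.update_apply, if_true]
        rw [k1 d (by omega), hk, h11]
        rfl
      obtain ⟨t', s3, r3, a3, k3, b3⟩ := ih (f s) s2 a2 ((hf.1 s).2.trans h1) hk2
      refine ⟨_, s3, Run.whileStep (by omega) (Run.seq r1 r2) r3, a3, fun i hi => ?_, ?_⟩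
      · rw [k3 i hi, hs2]
        simp only [Instr.exec, Function.update_apply]
        rw [if_neg (by omega)]
        exact k1 i (by omega)
      · rw [(hf.1 s).1] at b3
        nlinarith
  refine ⟨.seq (.instr (.natConst (32 + d) 0)) (.seq (.instr (.natAdd (32 + d) (32 + d) 0))
      (.whileNonzero (32 + d) (.seq p (.instr (.natSub (32 + d) (32 + d) 1))))),
    Polynomial.X * (b + 2) + 3, fun s s' h h1 => ?_⟩
  have r1 := Run.instr (.natConst (32 + d) 0) s'
  set s1 := (Instr.natConst (32 + d) 0).exec s' with hs1
  have r2 := Run.instr (.natAdd (32 + d) (32 + d) 0) s1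
  set s2 := (Instr.natAdd (32 + d) (32 + d) 0).exec s1 with hs2
  have hnat : ∀ i, i ≠ 32 + d → s2.nat i = s'.nat i := by
    intro i hi
    simp [hs2, hs1, Instr.exec, Function.update_apply, hi]
  have hctr : s2.nat (32 + d) = s.nat 0 := by
    have : (0 : ℕ) ≠ 32 + d := by omega
    rw [h.2 0 (by norm_num)]
    simp [hs2, hs1, Instr.exec, this]
  have a2 : s.Agree s2 := ⟨h.1, fun i hi => by rw [hnat i (by omega)]; exact h.2 i hi⟩
  obtain ⟨t, s3, r3, a3, k3, b3⟩ := loop _ s s2 a2 h1 hctr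
  refine ⟨_, s3, Run.seq r1 (Run.seq r2 r3), a3, fun i hi => ?_, ?_⟩
  · rw [k3 i hi, hnat _ (by omega)]
  · simp only [Polynomial.eval_add, Polynomial.eval_mul, Polynomial.eval_X, Polynomial.eval_ofNat]
    omega

/-- Looping `(n + 2) ^ k` times, where `n` is the content of natural cell `0`. -/
theorem Impl.iterPow {f : State → State} (hf : Impl f) (k : ℕ) :
    Impl (fun s => f^[(s.nat 0 + 2) ^ k] s) := by
  induction k with
  | zero => simpa using hf
  | succ k ih =>
    -- One loop of length `n` and two more copies of the `(n + 2) ^ k`-fold iteration make `n + 2`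
    -- of them.
    have h := (ih.iter.seq ih).seq ih
    convert h using 2 with s
    have key : ∀ j s, (fun s : State => f^[(s.nat 0 + 2) ^ k] s)^[j] s =
        f^[(s.nat 0 + 2) ^ k * j] s := by
      intro j
      induction j with
      | zero => intro s; simp
      | succ j ihj =>
        intro s
        rw [Function.iterate_succ_apply, ihj, (hf.iterate_nat _ s).1, ← Function.iterate_add_apply]
        ring_nf
    have h2 := key (s.nat 0 + 2) s
    rw [Function.iterate_succ_apply', Function.iterate_succ_apply'] at h2
    rw [pow_succ]
    exact h2.symm

/-- The initial instruction establishes the invariant that cell `1` holds `1`; it supplies the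
decrement of the loop counters. -/
theorem Impl.computable {m : ℕ} {F : ℕ → (Fin m → ℝ) → (Fin m → ℝ) → ℝ} {f : State → State}
    (hf : Impl f)
    (h : ∀ n w wbar s, s.nat 0 = n → s.nat 1 = 1 → s.real = (initState n w wbar).real →
      (f s).real 0 = F n w wbar) :
    ComputableInPolyTime F := by
  obtain ⟨p, b, hp⟩ := hf.2 0
  refine ⟨.seq (.instr (.natConst 1 1)) p, 1 + b, fun n w wbar => ?_⟩
  set s1 := (Instr.natConst 1 1).exec (initState n w wbar) with hs1
  have h0 : s1.nat 0 = n := by simp [hs1, Instr.exec, initState]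
  have h1 : s1.nat 1 = 1 := by simp [hs1, Instr.exec]
  obtain ⟨t, s2, r2, a2, -, b2⟩ := hp s1 s1 ⟨rfl, fun _ _ => rfl⟩ h1
  refine ⟨_, s2, Run.seq (Run.instr _ _) r2, ?_, ?_⟩
  · rw [h0] at b2
    simpa using b2
  · rw [← a2.1, h n w wbar s1 h0 h1 rfl]

end RealRAM
-- Remainders, powers and table addresses by repeated addition and subtraction.
namespace RealRAM

theorem Impl.congr {f g : State → State} (hf : Impl f)
    (h : ∀ s, g s = f s) : Impl g := by
  rwa [show g = f from funext h]

theorem Impl.iterConst {f : State → State} (hf : Impl f) (k : ℕ) : Impl (fun s => f^[k] s) := by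
  induction k with
  | zero => exact Impl.id
  | succ k ih => exact hf.seq ih

/-- Execution of a list of instructions. -/
noncomputable def execs : List Instr → State → State
  | [], s => s
  | c :: l, s => execs l (c.exec s)

theorem Impl.execs {l : List Instr} (h : ∀ c ∈ l, c.Safe) : Impl (execs l) := by
  induction l with
  | nil => exact Impl.id
  | cons c l ih =>
    exact (Impl.instr (h c (by simp))).seq (ih fun c hc => h c (by simp [hc]))

/-- The instruction list `l` repeated while natural register `8` is at least register `6`. -/
noncomputable def modStep (s : State) : State :=
  if (execs [.natAdd 9 8 1, .natSub 9 9 6] s).nat 9 = 0 then execs [.natAdd 9 8 1, .natSub 9 9 6] s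
  else execs [.natSub 8 8 6] (execs [.natAdd 9 8 1, .natSub 9 9 6] s)

theorem impl_modStep : Impl modStep :=
  (Impl.execs (l := [.natAdd 9 8 1, .natSub 9 9 6]) (by simp [Instr.Safe])).seq
    (Impl.ite (i := 9) (Impl.execs (l := [.natSub 8 8 6]) (by simp [Instr.Safe])) Impl.id
      (by norm_num))

theorem modStep_spec (s : State) (h1 : s.nat 1 = 1) :
    (modStep s).real = s.real ∧ (∀ i, i ≠ 8 → i ≠ 9 → (modStep s).nat i = s.nat i) ∧
      (modStep s).nat 8 = if s.nat 6 ≤ s.nat 8 then s.nat 8 - s.nat 6 else s.nat 8 := by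
  -- With truncated subtraction, `x + 1 - c` is nonzero exactly when `c ≤ x`.
  have h9 : (execs [.natAdd 9 8 1, .natSub 9 9 6] s).nat 9 = s.nat 8 + 1 - s.nat 6 := by
    simp [execs, Instr.exec, h1]
  unfold modStep
  rw [h9]
  by_cases hle : s.nat 6 ≤ s.nat 8
  · rw [if_neg (by omega), if_pos hle]
    refine ⟨by simp [execs, Instr.exec], fun i h8 h9 => ?_, ?_⟩ <;>
    simp [execs, Instr.exec, *]
  · rw [if_pos (by omega), if_neg hle]
    refine ⟨by simp [execs, Instr.exec], fun i h8 h9 => ?_, ?_⟩ <;>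
    simp [execs, Instr.exec, *]

/-- Remainder by repeated subtraction with a fixed number of rounds: every effective round lowers
the value by at least one, and surplus rounds do nothing. -/
theorem modStep_iterate (k : ℕ) (s : State) (h1 : s.nat 1 = 1) (hC : 0 < s.nat 6)
    (hk : s.nat 8 < k + s.nat 6) :
    (modStep^[k] s).real = s.real ∧ (∀ i, i ≠ 8 → i ≠ 9 → (modStep^[k] s).nat i = s.nat i) ∧
      (modStep^[k] s).nat 8 = s.nat 8 % s.nat 6 := by
  induction k generalizing s with
  | zero =>
    simp [Nat.mod_eq_of_lt (show s.nat 8 < s.nat 6 by omega)]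
  | succ k ih =>
    obtain ⟨a, b, c⟩ := modStep_spec s h1
    rw [Function.iterate_succ_apply]
    have h6 := b 6 (by norm_num) (by norm_num)
    obtain ⟨a', b', c'⟩ := ih (modStep s) (by rw [b 1 (by norm_num) (by norm_num), h1])
      (by rw [h6]; exact hC) (by rw [c, h6]; split_ifs <;> omega)
    refine ⟨a'.trans a, fun i h8 h9 => (b' i h8 h9).trans (b i h8 h9), ?_⟩
    rw [c', c, h6]
    split_ifs with hle
    · exact (Nat.mod_eq_sub_mod hle).symm
    · rfl

/-- Register `r` receives `(n + 2) ^ k`, where `n` is the content of natural cell `0`. -/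
noncomputable def setPow (r k : ℕ) (s : State) : State :=
  (Instr.natAdd r r 1).exec^[(s.nat 0 + 2) ^ k] ((Instr.natConst r 0).exec s)

theorem impl_setPow {r : ℕ} (h2 : 2 ≤ r) (h32 : r < 32) (k : ℕ) : Impl (setPow r k) := by
  have h := (Impl.instr (c := .natConst r 0) ⟨h2, h32⟩).seq
    ((Impl.instr (c := .natAdd r r 1) ⟨⟨h2, h32⟩, h32, by norm_num⟩).iterPow k)
  refine h.congr fun s => ?_
  have : (0 : ℕ) ≠ r := by omega
  simp [setPow, Instr.exec, this]

theorem setPow_spec {r : ℕ} (h2 : 2 ≤ r) (k : ℕ) (s : State) (h1 : s.nat 1 = 1) :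
    setPow r k s = { s with nat := Function.update s.nat r ((s.nat 0 + 2) ^ k) } := by
  have key : ∀ j c, (Instr.natAdd r r 1).exec^[j] { s with nat := Function.update s.nat r c } =
      { s with nat := Function.update s.nat r (c + j) } := by
    intro j
    induction j with
    | zero => intro c; rfl
    | succ j ih =>
      intro c
      have : (1 : ℕ) ≠ r := by omega
      rw [Function.iterate_succ_apply]
      have h : (Instr.natAdd r r 1).exec { s with nat := Function.update s.nat r c } =
          { s with nat := Function.update s.nat r (c + 1) } := by
        simp [Instr.exec, this, h1]
      rw [h, ih]
      simp [add_left_comm, add_comm]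
  have h := key ((s.nat 0 + 2) ^ k) 0
  rw [zero_add] at h
  exact h

/-- Register `r` receives `c + k * (register 2)`. -/
noncomputable def setBase (r c k : ℕ) (s : State) : State :=
  (Instr.natAdd r r 2).exec^[k] ((Instr.natConst r c).exec s)

theorem impl_setBase {r : ℕ} (h2 : 2 < r) (h32 : r < 32) (c k : ℕ) : Impl (setBase r c k) :=
  (Impl.instr (c := .natConst r c) ⟨h2.le, h32⟩).seq
    ((Impl.instr (c := .natAdd r r 2) ⟨⟨h2.le, h32⟩, h32, by norm_num⟩).iterConst k)

/-- Used for table addresses, with the table length in register `2`. The slot number `k` is fixed in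
the program, so the product costs a constant number of additions. -/
theorem setBase_spec {r : ℕ} (h2 : 2 < r) (c k : ℕ) (s : State) :
    setBase r c k s = { s with nat := Function.update s.nat r (c + k * s.nat 2) } := by
  have : (2 : ℕ) ≠ r := by omega
  induction k with
  | zero => simp [setBase, Instr.exec]
  | succ k ih =>
    rw [setBase, Function.iterate_succ_apply']
    rw [setBase] at ih
    rw [ih]
    simp [Instr.exec, this]
    ring_nf

end RealRAM

/-! ### Digits -/

/-- The vector of the `D` lowest digits of `x` in base `B`. -/
noncomputable def digitVec (B D x : ℕ) : ℕ →₀ ℕ :=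
  Finsupp.onFinset (Finset.range D) (fun v => if v < D then x / B ^ v % B else 0)
    (fun v h => by
      by_contra hv
      simp only [Finset.mem_range] at hv
      simp [hv] at h)

theorem digitVec_apply (B D x v : ℕ) :
    digitVec B D x v = if v < D then x / B ^ v % B else 0 := rfl

/-- The hypothesis excludes a carry, so no digit other than digit `v` changes. -/
theorem div_pow_add_pow {B v x : ℕ} (hB : 0 < B) (h : x / B ^ v % B + 1 < B) (u : ℕ) :
    (x + B ^ v) / B ^ u % B = x / B ^ u % B + if u = v then 1 else 0 := by
  rcases lt_trichotomy u v with huv | rfl | huv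
  · obtain ⟨d, rfl⟩ : ∃ d, v = u + (d + 1) := ⟨v - u - 1, by omega⟩
    rw [if_neg (by omega), pow_add, pow_succ' B d, Nat.add_mul_div_left _ _ (pow_pos hB u),
      Nat.add_mul_mod_self_left, add_zero]
  · rw [if_pos rfl, Nat.add_div_right _ (pow_pos hB u), Nat.add_mod, Nat.mod_eq_of_lt (a := 1) (by omega), Nat.mod_eq_of_lt h]
  · obtain ⟨d, rfl⟩ : ∃ d, u = v + 1 + d := ⟨u - v - 1, by omega⟩
    rw [if_neg (by omega), pow_add, ← Nat.div_div_eq_div_mul, ← Nat.div_div_eq_div_mul, add_zero]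
    congr 2
    rw [pow_succ, ← Nat.div_div_eq_div_mul, ← Nat.div_div_eq_div_mul,
      Nat.add_div_right _ (pow_pos hB v)]
    set y := x / B ^ v
    rw [Nat.add_div hB, Nat.div_eq_of_lt (a := 1) (by omega),
      Nat.mod_eq_of_lt (a := 1) (by omega), if_neg (by omega)]
    rfl

/-- Moving by `B ^ v` in the table is raising the exponent of variable `v` by one. -/
theorem digitVec_add {B D v x : ℕ} (hB : 0 < B) (hv : v < D) (h : x / B ^ v % B + 1 < B) :
    digitVec B D (x + B ^ v) = Finsupp.single v 1 + digitVec B D x := by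
  ext u
  rw [Finsupp.add_apply, digitVec_apply, digitVec_apply, Finsupp.single_apply]
  by_cases hu : u < D
  · rw [if_pos hu, if_pos hu, div_pow_add_pow hB h, add_comm]
    simp [eq_comm]
  · rw [if_neg hu, if_neg hu, if_neg (by omega)]

/-- Without a carry the move stays inside the table: digit `v` is at most `B - 2`, and the digits
above it are unchanged. -/
theorem add_pow_lt_pow {B D v x : ℕ} (hB : 0 < B) (hv : v < D) (h : x / B ^ v % B + 1 < B)
    (hx : x < B ^ D) : x + B ^ v < B ^ D := by
  obtain ⟨d, rfl⟩ : ∃ d, D = v + 1 + d := ⟨D - v - 1, by omega⟩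
  have hpos := pow_pos hB v
  have h1 : x / B ^ v / B < B ^ d := by
    rw [Nat.div_div_eq_div_mul, ← pow_succ]
    exact Nat.div_lt_of_lt_mul (by rwa [← pow_add])
  have h2 : x = B ^ v * (x / B ^ v) + x % B ^ v := (Nat.div_add_mod _ _).symm
  have h3 : x / B ^ v = B * (x / B ^ v / B) + x / B ^ v % B := (Nat.div_add_mod _ _).symm
  have h4 : x % B ^ v < B ^ v := Nat.mod_lt _ hpos
  set q := x / B ^ v / B
  set r := x / B ^ v % B
  have h5 : x / B ^ v + 2 ≤ B * B ^ d := by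
    have : B * (q + 1) ≤ B * B ^ d := Nat.mul_le_mul_left _ h1
    rw [mul_add] at this
    omega
  have h6 : B ^ v * (x / B ^ v + 2) ≤ B ^ v * (B * B ^ d) := Nat.mul_le_mul_left _ h5
  rw [pow_add, pow_succ, mul_assoc]
  rw [mul_add] at h6
  omega

/-- If digit `v` of the difference were `B - 1`, adding `B ^ v` back would carry and leave digit
`0`. -/
theorem digit_sub {B v x : ℕ} (hB : 0 < B) (h : 1 ≤ x / B ^ v % B) :
    B ^ v ≤ x ∧ (x - B ^ v) / B ^ v % B + 1 < B := by
  have hle : B ^ v ≤ x := by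
    by_contra hlt
    rw [Nat.div_eq_of_lt (by omega)] at h
    simp at h
  refine ⟨hle, ?_⟩
  obtain ⟨y, rfl⟩ := Nat.exists_eq_add_of_le' hle
  rw [Nat.add_sub_cancel]
  rw [Nat.add_div_right _ (pow_pos hB v)] at h
  set q := y / B ^ v
  by_contra hq
  have h1 := Nat.mod_lt q hB
  have h2 : q % B + 1 = B := by omega
  have h3 : (q + 1) % B = 0 := by
    rw [← Nat.mod_add_mod, h2, Nat.mod_self]
  omega

theorem digitVec_eq_zero {B D x : ℕ} (hx : x < B ^ D) (h : digitVec B D x = 0) :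
    x = 0 := by
  have h0 : ∀ v < D, x / B ^ v % B = 0 := fun v hv => by
    have := DFunLike.congr_fun h v
    rwa [digitVec_apply, if_pos hv] at this
  clear h
  induction D generalizing x with
  | zero => simpa using hx
  | succ D ih =>
    have h1 := ih (x := x / B) (Nat.div_lt_of_lt_mul (by rwa [← pow_succ'])) (fun v hv => by
      rw [Nat.div_div_eq_div_mul, ← pow_succ']
      exact h0 (v + 1) (by omega))
    have h2 := h0 0 (by omega)
    rw [pow_zero, Nat.div_one] at h2
    have := Nat.div_add_mod x B
    rw [h1, h2] at this
    omega

theorem digitVec_zero (B D : ℕ) : digitVec B D 0 = 0 := by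
  ext u
  simp [digitVec_apply]

/-- Lets the machine test a digit by one remainder and one comparison, without division. -/
theorem one_le_digit_iff {B v x : ℕ} (hB : 0 < B) :
    1 ≤ x / B ^ v % B ↔ B ^ v ≤ x % B ^ (v + 1) := by
  rw [Nat.mod_pow_succ]
  have := Nat.mod_lt x (pow_pos hB v)
  constructor
  · intro h
    calc B ^ v = B ^ v * 1 := (mul_one _).symm
      _ ≤ B ^ v * (x / B ^ v % B) := Nat.mul_le_mul_left _ h
      _ ≤ _ := Nat.le_add_left _ _
  · intro h
    by_contra h0
    have h0 : x / B ^ v % B = 0 := by omega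
    rw [h0] at h
    omega

/-- The corresponding test that a digit is not the largest possible one. -/
theorem digit_add_one_lt_iff {B v x : ℕ} (hB : 0 < B) :
    x / B ^ v % B + 1 < B ↔ x % B ^ (v + 1) < B ^ (v + 1) - B ^ v := by
  rw [Nat.mod_pow_succ, pow_succ]
  have := Nat.mod_lt x (pow_pos hB v)
  generalize x % B ^ v = l at *
  set r := x / B ^ v % B
  have hr : r < B := Nat.mod_lt _ hB
  constructor
  · intro h
    have : B ^ v * (r + 2) ≤ B ^ v * B := Nat.mul_le_mul_left _ h
    rw [mul_add] at this
    omega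
  · intro h
    by_contra h0
    have h0 : r + 1 = B := by omega
    have : B ^ v * B = B ^ v * r + B ^ v := by rw [← h0]; ring
    omega
-- Shifts of polynomials and straight-line programs over polynomial slots.
/-- Multiplication or division by a variable, or neither.  Division drops the monomials that the
variable does not divide. -/
inductive Shift where
  | none
  | up (v : ℕ)
  | down (v : ℕ)

namespace Shift

/-- The action on polynomials. -/
noncomputable def act : Shift → MvPolynomial ℕ ℝ → MvPolynomial ℕ ℝ
  | none, P => P
  | up v, P => MvPolynomial.X v * P
  | down v, P => P.divMonomial (Finsupp.single v 1)

/-- The variable is among the first `D`. -/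
def Below (D : ℕ) : Shift → Prop
  | none => True
  | up v => v < D
  | down v => v < D

/-- The entry `x` of the shifted table is read off from an entry of the original table. -/
def Inside (B x : ℕ) : Shift → Prop
  | none => True
  | up v => 1 ≤ x / B ^ v % B
  | down v => x / B ^ v % B + 1 < B

/-- The entry of the original table that becomes the entry `x` of the shifted table. -/
def source (B x : ℕ) : Shift → ℕ
  | none => x
  | up v => x - B ^ v
  | down v => x + B ^ v

theorem source_lt {B D x : ℕ} (hB : 0 < B) (hx : x < B ^ D) {σ : Shift} (hσ : σ.Below D)
    (h : σ.Inside B x) : σ.source B x < B ^ D := by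
  cases σ with
  | none => exact hx
  | up v => exact (Nat.sub_le _ _).trans_lt hx
  | down v => exact add_pow_lt_pow hB hσ h hx

/-- The bound on the exponents matters for division: at a position whose digit `v` is `B - 1`, the
source would have exponent `B`, which has no place in the table, and the bound makes that
coefficient zero. -/
theorem coeff_act {B D x : ℕ} (hB : 0 < B) {σ : Shift} (hσ : σ.Below D)
    {P : MvPolynomial ℕ ℝ} (hP : ∀ c, P.coeff c ≠ 0 → ∀ v, c v < B) :
    (σ.Inside B x →
      (σ.act P).coeff (digitVec B D x) = P.coeff (digitVec B D (σ.source B x))) ∧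
    (¬ σ.Inside B x → (σ.act P).coeff (digitVec B D x) = 0) := by
  classical
  cases σ with
  | none => simp [act, Inside, source]
  | up v =>
    have hv : v < D := hσ
    simp only [act, Inside, source, MvPolynomial.coeff_X_mul', Finsupp.mem_support_iff,
      digitVec_apply, if_pos hv]
    refine ⟨fun h => ?_, fun h => if_neg (by omega)⟩
    obtain ⟨hle, hd⟩ := digit_sub hB h
    rw [if_pos (by omega)]
    have := digitVec_add (D := D) hB hv hd
    rw [Nat.sub_add_cancel hle] at this
    rw [this, add_tsub_cancel_left]
  | down v =>
    have hv : v < D := hσ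
    simp only [act, Inside, source, MvPolynomial.coeff_divMonomial]
    refine ⟨fun h => by rw [digitVec_add hB hv h], fun h => ?_⟩
    by_contra h0
    have := hP _ h0 v
    rw [Finsupp.add_apply, Finsupp.single_eq_same, digitVec_apply, if_pos hv] at this
    omega

end Shift

/-- Straight-line programs with fixed-length loops over slots that hold polynomials.  A coefficient
is a rational constant or the number of a memory cell. -/
inductive SlotProg where
  | clear (j : ℕ)
  | axpy (j i : ℕ) (h : i ≠ j) (c : ℚ ⊕ ℕ) (σ : Shift)
  | seq (p q : SlotProg)
  | rep (p : SlotProg)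

/-- The value of a coefficient. -/
noncomputable def coefVal (ρ : ℕ → ℝ) : ℚ ⊕ ℕ → ℝ
  | .inl q => q
  | .inr i => ρ i

namespace SlotProg

/-- The effect on the slots; `n` is the length of the loops. -/
noncomputable def exec (ρ : ℕ → ℝ) (n : ℕ) :
    SlotProg → (ℕ → MvPolynomial ℕ ℝ) → ℕ → MvPolynomial ℕ ℝ
  | clear j, S => Function.update S j 0
  | axpy j i _ c σ, S => Function.update S j (S j + MvPolynomial.C (coefVal ρ c) * σ.act (S i))
  | seq p q, S => q.exec ρ n (p.exec ρ n S)
  | rep p, S => (p.exec ρ n)^[n] S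

/-- All variables are among the first `D`, all coefficients among the first `m` cells. -/
def Below (D m : ℕ) : SlotProg → Prop
  | clear _ => True
  | axpy _ _ _ c σ => (∀ i, c = .inr i → i < m) ∧ σ.Below D
  | seq p q => p.Below D m ∧ q.Below D m
  | rep p => p.Below D m

/-- The number of elementary commands that are executed. -/
def cost (n : ℕ) : SlotProg → ℕ
  | clear _ => 1
  | axpy _ _ _ _ _ => 1
  | seq p q => p.cost n + q.cost n
  | rep p => n * p.cost n

/-- Supplies the exponent `G` of the base: since a command raises exponents by at most one, the base
`(n + 2) ^ G` exceeds all exponents that occur when starting from a constant. -/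
theorem exists_cost_lt (p : SlotProg) : ∃ G, ∀ n, p.cost n < (n + 2) ^ G := by
  induction p with
  | clear j => exact ⟨1, fun n => by simp [cost]⟩
  | axpy j i h c σ => exact ⟨1, fun n => by simp [cost]⟩
  | seq p q hp hq =>
    obtain ⟨a, ha⟩ := hp
    obtain ⟨b, hb⟩ := hq
    refine ⟨a + b + 1, fun n => ?_⟩
    have h1 := ha n
    have h2 := hb n
    have h3 : (n + 2) ^ a ≤ (n + 2) ^ (a + b) := Nat.pow_le_pow_right (by omega) (by omega)
    have h4 : (n + 2) ^ b ≤ (n + 2) ^ (a + b) := Nat.pow_le_pow_right (by omega) (by omega)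
    rw [cost, pow_succ]
    nlinarith
  | rep p hp =>
    obtain ⟨a, ha⟩ := hp
    refine ⟨a + 1, fun n => ?_⟩
    have h1 := ha n
    rw [cost, pow_succ]
    nlinarith

end SlotProg

/-- All exponents of `P` are at most `g`. -/
def ExponentsLE (g : ℕ) (P : MvPolynomial ℕ ℝ) : Prop :=
  ∀ c, P.coeff c ≠ 0 → ∀ v, c v ≤ g

theorem ExponentsLE.act {g : ℕ} {P : MvPolynomial ℕ ℝ} (h : ExponentsLE g P) (σ : Shift) :
    ExponentsLE (g + 1) (σ.act P) := by
  classical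
  intro c hc v
  cases σ with
  | none => exact (h c hc v).trans (Nat.le_succ g)
  | up u =>
    simp only [Shift.act, MvPolynomial.coeff_X_mul'] at hc
    split_ifs at hc with hu
    · have := h _ hc v
      rw [Finsupp.tsub_apply, Finsupp.single_apply] at this
      split_ifs at this <;> omega
    · exact absurd rfl hc
  | down u =>
    simp only [Shift.act, MvPolynomial.coeff_divMonomial] at hc
    have := h _ hc v
    rw [Finsupp.add_apply] at this
    omega

/-- Only shifts change exponents, by at most one per command. -/
theorem ExponentsLE.exec (ρ : ℕ → ℝ) (n : ℕ) (p : SlotProg) {g : ℕ} {S : ℕ → MvPolynomial ℕ ℝ}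
    (h : ∀ j, ExponentsLE g (S j)) (j : ℕ) : ExponentsLE (g + p.cost n) (p.exec ρ n S j) := by
  induction p generalizing g S j with
  | clear i =>
    intro c hc v
    rw [SlotProg.exec, Function.update_apply] at hc
    split_ifs at hc with hj
    · simp at hc
    · exact (h j c hc v).trans (Nat.le_add_right _ _)
  | axpy i k hik q σ =>
    intro c hc v
    rw [SlotProg.exec, Function.update_apply] at hc
    split_ifs at hc with hj
    · rw [MvPolynomial.coeff_add, MvPolynomial.coeff_C_mul] at hc
      by_cases h0 : (S i).coeff c = 0
      · rw [h0, zero_add] at hc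
        exact (h k).act σ c (right_ne_zero_of_mul hc) v
      · exact (h i c h0 v).trans (Nat.le_add_right _ _)
    · exact (h j c hc v).trans (Nat.le_add_right _ _)
  | seq p q hp hq =>
    rw [SlotProg.exec, SlotProg.cost, ← add_assoc]
    exact hq (fun j => hp h j) j
  | rep p hp =>
    rw [SlotProg.exec, SlotProg.cost]
    have key : ∀ k j, ExponentsLE (g + k * p.cost n) ((p.exec ρ n)^[k] S j) := by
      intro k
      induction k with
      | zero => simpa using h
      | succ k ih =>
        intro j
        rw [Function.iterate_succ_apply', Nat.succ_mul, ← add_assoc]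
        exact hp ih j
    exact key n j

/-! ### Coefficient tables in the real memory. -/

namespace RealRAM

/-- The real memory holds, from cell `m + 3` on, the tables of the coefficients of the polynomials
`S 0, S 1, …`; the exponent vectors are the digits of the positions. -/
structure Holds (m D B n : ℕ) (ρ : ℕ → ℝ) (s : State) (S : ℕ → MvPolynomial ℕ ℝ) : Prop where
  n_eq : s.nat 0 = n
  one : s.nat 1 = 1
  low : ∀ a < m, s.real a = ρ a
  table : ∀ j x, x < B ^ D → s.real (m + 3 + j * B ^ D + x) = (S j).coeff (digitVec B D x)

/-- The registers set up for a sweep over a table. -/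
structure SweepRegs (G D v src dst : ℕ) (s : State) : Prop where
  one : s.nat 1 = 1
  src : s.nat 3 = src
  dst : s.nat 4 = dst
  low : s.nat 5 = ((s.nat 0 + 2) ^ G) ^ v
  high : s.nat 6 = ((s.nat 0 + 2) ^ G) ^ (v + 1)

/-- The variable of a shift. -/
def _root_.Shift.var : Shift → ℕ
  | .none => 0
  | .up v => v
  | .down v => v

/-- For the table position in register `7`, register `9` becomes the flag that the shifted entry has
a source, and register `10` the address of that source. -/
theorem exists_prep (G D : ℕ) (σ : Shift) : ∃ f, Impl f ∧ ∀ s src dst,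
    SweepRegs G D σ.var src dst s → s.nat 7 < ((s.nat 0 + 2) ^ G) ^ D →
    (f s).real = s.real ∧ (∀ i < 8, (f s).nat i = s.nat i) ∧
    ((f s).nat 9 ≠ 0 ↔ σ.Inside ((s.nat 0 + 2) ^ G) (s.nat 7)) ∧
    (σ.Inside ((s.nat 0 + 2) ^ G) (s.nat 7) →
      (f s).nat 10 = src + σ.source ((s.nat 0 + 2) ^ G) (s.nat 7)) := by
  have loop : ∀ (s : State) (src dst v : ℕ), SweepRegs G D v src dst s →
      s.nat 7 < ((s.nat 0 + 2) ^ G) ^ D → ∀ s', s' = modStep^[(s.nat 0 + 2) ^ (G * D)]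
        (execs [.natConst 8 0, .natAdd 8 8 7] s) →
      s'.real = s.real ∧ (∀ i < 8, s'.nat i = s.nat i) ∧
        s'.nat 8 = s.nat 7 % ((s.nat 0 + 2) ^ G) ^ (v + 1) := by
    rintro s src dst v h hx s' rfl
    have e1 : (execs [.natConst 8 0, .natAdd 8 8 7] s).real = s.real := by
      simp [execs, Instr.exec]
    have e2 : ∀ i, i ≠ 8 → (execs [.natConst 8 0, .natAdd 8 8 7] s).nat i = s.nat i := by
      intro i hi
      simp [execs, Instr.exec, hi]
    have e3 : (execs [.natConst 8 0, .natAdd 8 8 7] s).nat 8 = s.nat 7 := by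
      simp [execs, Instr.exec]
    have e4 := e2 6 (by norm_num)
    -- As many rounds as the table has entries are enough, because the dividend is a position in the
    -- table.
    obtain ⟨a, b, c⟩ := modStep_iterate ((s.nat 0 + 2) ^ (G * D))
      (execs [.natConst 8 0, .natAdd 8 8 7] s) ((e2 1 (by norm_num)).trans h.one)
      (by rw [e4, h.high]; positivity) (by rw [e3, pow_mul]; omega)
    refine ⟨a.trans e1, fun i hi => (b i (by omega) (by omega)).trans (e2 i (by omega)), ?_⟩
    rw [c, e3, e4, h.high]
  have hpos : ∀ s : State, 0 < (s.nat 0 + 2) ^ G := fun s => by positivity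
  have himpl : Impl (fun s => modStep^[(s.nat 0 + 2) ^ (G * D)]
      (execs [.natConst 8 0, .natAdd 8 8 7] s)) := by
    have h := (Impl.execs (l := [.natConst 8 0, .natAdd 8 8 7]) (by simp [Instr.Safe])).seq
      (impl_modStep.iterPow (G * D))
    exact h.congr fun s => by simp [execs, Instr.exec]
  cases σ with
  | none =>
    refine ⟨execs [.natConst 9 1, .natAdd 10 3 7], Impl.execs (by simp [Instr.Safe]),
      fun s src dst h hx => ⟨by simp [execs, Instr.exec], fun i hi => ?_, ?_, ?_⟩⟩
    · simp [execs, Instr.exec, show i ≠ 9 by omega, show i ≠ 10 by omega]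
    · simp [execs, Instr.exec, Shift.Inside]
    · simp [execs, Instr.exec, Shift.source, h.src]
  | up v =>
    -- With `r` the remainder in register `8`, the flag is `r + 1 - B ^ v`, which is nonzero when `B
    -- ^ v ≤ r`. The subtraction in the address does not truncate, by `digit_sub`.
    refine ⟨_, himpl.seq (Impl.execs (l := [.natAdd 9 8 1, .natSub 9 9 5, .natAdd 10 3 7,
      .natSub 10 10 5]) (by simp [Instr.Safe])), fun s src dst h hx => ?_⟩
    obtain ⟨a, b, c⟩ := loop s src dst v h hx _ rfl
    set s' := modStep^[(s.nat 0 + 2) ^ (G * D)] (execs [.natConst 8 0, .natAdd 8 8 7] s)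
    have hlow : s.nat 5 = ((s.nat 0 + 2) ^ G) ^ v := h.low
    refine ⟨by simp [execs, Instr.exec, a], fun i hi => ?_, ?_, fun hin => ?_⟩
    · rw [← b i hi]
      simp [execs, Instr.exec, show i ≠ 9 by omega, show i ≠ 10 by omega]
    · simp only [Shift.Inside]
      rw [one_le_digit_iff (hpos s), ← c, ← hlow, ← b 5 (by norm_num)]
      simp [execs, Instr.exec, (b 1 (by norm_num)).trans h.one]
      omega
    · have := (digit_sub (hpos s) hin).1
      simp [execs, Instr.exec, Shift.source, b 3 (by norm_num), b 5 (by norm_num),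
        b 7 (by norm_num), h.src, hlow]
      omega
  | down v =>
    -- Here the flag is `B ^ (v + 1) - B ^ v - r`, which is nonzero when `r` is below the difference
    -- of the two powers.
    refine ⟨_, himpl.seq (Impl.execs (l := [.natSub 9 6 5, .natSub 9 9 8, .natAdd 10 3 7,
      .natAdd 10 10 5]) (by simp [Instr.Safe])), fun s src dst h hx => ?_⟩
    obtain ⟨a, b, c⟩ := loop s src dst v h hx _ rfl
    set s' := modStep^[(s.nat 0 + 2) ^ (G * D)] (execs [.natConst 8 0, .natAdd 8 8 7] s)
    have hlow : s.nat 5 = ((s.nat 0 + 2) ^ G) ^ v := h.low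
    have hhigh : s.nat 6 = ((s.nat 0 + 2) ^ G) ^ (v + 1) := h.high
    refine ⟨by simp [execs, Instr.exec, a], fun i hi => ?_, ?_, fun hin => ?_⟩
    · rw [← b i hi]
      simp [execs, Instr.exec, show i ≠ 9 by omega, show i ≠ 10 by omega]
    · simp only [Shift.Inside]
      rw [digit_add_one_lt_iff (hpos s), ← c, ← hlow, ← hhigh, ← b 5 (by norm_num),
        ← b 6 (by norm_num)]
      simp [execs, Instr.exec]
      omega
    · simp [execs, Instr.exec, Shift.source, b 3 (by norm_num), b 5 (by norm_num),
        b 7 (by norm_num), h.src, hlow]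
      omega

end RealRAM
-- Sweeps over tables and the execution of slot programs.
namespace RealRAM

/-- The instructions that add a multiple of the real cell addressed by register `10` to the real
cell at position `register 4 + register 7`. -/
def accInstrs (m : ℕ) : ℚ ⊕ ℕ → List Instr
  | .inl q => [.natAdd 11 4 7, .realLoad m 10, .realLoad (m + 1) 11, .realConst (m + 2) q,
      .realMul m (m + 2) m, .realAdd (m + 1) (m + 1) m, .realStore 11 (m + 1)]
  | .inr i => [.natAdd 11 4 7, .realLoad m 10, .realLoad (m + 1) 11,
      .realMul m i m, .realAdd (m + 1) (m + 1) m, .realStore 11 (m + 1)]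

/-- Real cells `m`, `m + 1`, `m + 2` are scratch space; hence the restriction on `a`, and the start
of the tables at `m + 3`. -/
theorem acc_spec {m : ℕ} {ρ : ℕ → ℝ} {c : ℚ ⊕ ℕ} (hc : ∀ i, c = .inr i → i < m) (s : State)
    (hρ : ∀ a < m, s.real a = ρ a) (hdst : m + 3 ≤ s.nat 4) :
    (∀ i < 10, (execs (accInstrs m c) s).nat i = s.nat i) ∧
    ∀ a, a < m ∨ m + 3 ≤ a → (execs (accInstrs m c) s).real a =
      if a = s.nat 4 + s.nat 7 then s.real a + coefVal ρ c * s.real (s.nat 10) else s.real a := by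
  cases c with
  | inl q =>
    refine ⟨fun i hi => ?_, fun a ha => ?_⟩
    · simp [accInstrs, execs, Instr.exec, show i ≠ 11 by omega]
    · by_cases h : a = s.nat 4 + s.nat 7
      · subst h
        simp [accInstrs, execs, Instr.exec, coefVal, show s.nat 4 + s.nat 7 ≠ m by omega]
      · simp [accInstrs, execs, Instr.exec, h, show a ≠ m by omega, show a ≠ m + 1 by omega,
          show a ≠ m + 2 by omega]
  | inr i =>
    have hi := hc i rfl
    refine ⟨fun i hi => ?_, fun a ha => ?_⟩
    · simp [accInstrs, execs, Instr.exec, show i ≠ 11 by omega]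
    · by_cases h : a = s.nat 4 + s.nat 7
      · subst h
        simp [accInstrs, execs, Instr.exec, coefVal, show s.nat 4 + s.nat 7 ≠ m by omega,
          show i ≠ m by omega, show i ≠ m + 1 by omega, hρ i hi]
      · simp [accInstrs, execs, Instr.exec, h, show a ≠ m by omega, show a ≠ m + 1 by omega]

theorem impl_acc (m : ℕ) (c : ℚ ⊕ ℕ) : Impl (execs (accInstrs m c)) :=
  Impl.execs (by cases c <;> simp [accInstrs, Instr.Safe])

/-- One position of the sweep that adds a multiple of a shifted table to another table. -/
theorem exists_axpyBody (m G D : ℕ) {c : ℚ ⊕ ℕ} (hc : ∀ i, c = .inr i → i < m)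
    (σ : Shift) : ∃ f, Impl f ∧ ∀ (ρ : ℕ → ℝ) s src dst,
    SweepRegs G D σ.var src dst s → s.nat 7 < ((s.nat 0 + 2) ^ G) ^ D → m + 3 ≤ dst →
    (∀ a < m, s.real a = ρ a) →
    (∀ i < 7, (f s).nat i = s.nat i) ∧ (f s).nat 7 = s.nat 7 + 1 ∧
    ∀ a, a < m ∨ m + 3 ≤ a →
      (a = dst + s.nat 7 → σ.Inside ((s.nat 0 + 2) ^ G) (s.nat 7) → (f s).real a = s.real a +
        coefVal ρ c * s.real (src + σ.source ((s.nat 0 + 2) ^ G) (s.nat 7))) ∧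
      (¬ (a = dst + s.nat 7 ∧ σ.Inside ((s.nat 0 + 2) ^ G) (s.nat 7)) →
        (f s).real a = s.real a) := by
  obtain ⟨p, hp, hspec⟩ := exists_prep G D σ
  refine ⟨_, (hp.seq (Impl.ite (i := 9) (impl_acc m c) Impl.id (by norm_num))).seq
    (Impl.instr (c := .natAdd 7 7 1) (by simp [Instr.Safe])), fun ρ s src dst h hx hdst hρ => ?_⟩
  obtain ⟨e1, e2, e3, e4⟩ := hspec s src dst h hx
  have inc : ∀ s' : State, s'.nat 1 = 1 →
      (∀ i < 7, ((Instr.natAdd 7 7 1).exec s').nat i = s'.nat i) ∧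
      ((Instr.natAdd 7 7 1).exec s').nat 7 = s'.nat 7 + 1 ∧
      ((Instr.natAdd 7 7 1).exec s').real = s'.real := by
    intro s' h1
    refine ⟨fun i hi => ?_, ?_, rfl⟩
    · simp [Instr.exec, show i ≠ 7 by omega]
    · simp [Instr.exec, h1]
  by_cases hin : σ.Inside ((s.nat 0 + 2) ^ G) (s.nat 7)
  · have h9 := e3.mpr hin
    simp only [h9, if_false]
    obtain ⟨a1, a2⟩ := acc_spec (ρ := ρ) hc (p s) (by rwa [e1])
      (by rw [e2 4 (by norm_num), h.dst]; exact hdst)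
    obtain ⟨i1, i2, i3⟩ := inc (execs (accInstrs m c) (p s))
      (by rw [a1 1 (by norm_num), e2 1 (by norm_num), h.one])
    refine ⟨fun i hi => by rw [i1 i hi, a1 i (by omega), e2 i (by omega)],
      by rw [i2, a1 7 (by norm_num), e2 7 (by norm_num)], fun a ha => ?_⟩
    rw [i3, a2 a ha, e2 4 (by norm_num), e2 7 (by norm_num), h.dst, e4 hin, e1]
    exact ⟨fun h1 _ => if_pos h1, fun h1 => if_neg fun h2 => h1 ⟨h2, hin⟩⟩
  · have h9 : (p s).nat 9 = 0 := by
      by_contra h0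
      exact hin (e3.mp h0)
    simp only [h9, if_true]
    obtain ⟨i1, i2, i3⟩ := inc (p s) (by rw [e2 1 (by norm_num), h.one])
    refine ⟨fun i hi => by rw [i1 i hi, e2 i (by omega)], by rw [i2, e2 7 (by norm_num)],
      fun a ha => ?_⟩
    rw [i3, e1]
    exact ⟨fun _ h2 => absurd h2 hin, fun _ => rfl⟩

/-- Preparation of the registers for a sweep. -/
theorem exists_setup (m G D i j v : ℕ) : ∃ f, Impl f ∧ ∀ s, s.nat 1 = 1 →
    (f s).real = s.real ∧ (f s).nat 0 = s.nat 0 ∧ (f s).nat 7 = 0 ∧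
    SweepRegs G D v (m + 3 + i * ((s.nat 0 + 2) ^ G) ^ D) (m + 3 + j * ((s.nat 0 + 2) ^ G) ^ D)
      (f s) := by
  refine ⟨_, (((((impl_setPow (r := 2) (by norm_num) (by norm_num) (G * D)).seq
    (impl_setPow (r := 5) (by norm_num) (by norm_num) (G * v))).seq
    (impl_setPow (r := 6) (by norm_num) (by norm_num) (G * (v + 1)))).seq
    (impl_setBase (r := 3) (by norm_num) (by norm_num) (m + 3) i)).seq
    (impl_setBase (r := 4) (by norm_num) (by norm_num) (m + 3) j)).seq
    (Impl.instr (c := .natConst 7 0) (by simp [Instr.Safe])), fun s h1 => ?_⟩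
  rw [setPow_spec (by norm_num) _ s h1, setPow_spec (r := 5) (by norm_num) _ _ (by simpa using h1),
    setPow_spec (r := 6) (by norm_num) _ _ (by simpa using h1), setBase_spec (by norm_num),
    setBase_spec (by norm_num)]
  refine ⟨by simp [Instr.exec], by simp [Instr.exec], by simp [Instr.exec], ?_⟩
  constructor <;> simp [Instr.exec, h1, pow_mul]

/-- Loop invariant of a sweep: the positions already passed hold the new values, everything else
outside the scratch cells is as at the start. -/
theorem sweep_spec {m L dst : ℕ} {body : State → State} {upd : ℕ → ℝ} (s : State)
    (h7 : s.nat 7 = 0)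
    (hbody : ∀ (s' : State) (x : ℕ), x < L → (∀ i < 7, s'.nat i = s.nat i) → s'.nat 7 = x →
      (∀ a, a < m ∨ m + 3 ≤ a →
        s'.real a = if dst ≤ a ∧ a < dst + x then upd (a - dst) else s.real a) →
      (∀ i < 7, (body s').nat i = s.nat i) ∧ (body s').nat 7 = x + 1 ∧
      ∀ a, a < m ∨ m + 3 ≤ a → (body s').real a = if a = dst + x then upd x else s'.real a)
    (k : ℕ) (hk : k ≤ L) :
    (∀ i < 7, (body^[k] s).nat i = s.nat i) ∧ (body^[k] s).nat 7 = k ∧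
      ∀ a, a < m ∨ m + 3 ≤ a →
        (body^[k] s).real a = if dst ≤ a ∧ a < dst + k then upd (a - dst) else s.real a := by
  induction k with
  | zero =>
    refine ⟨fun _ _ => rfl, h7, fun a _ => ?_⟩
    rw [if_neg (by omega)]
    rfl
  | succ k ih =>
    obtain ⟨i1, i2, i3⟩ := ih (by omega)
    rw [Function.iterate_succ_apply']
    obtain ⟨b1, b2, b3⟩ := hbody _ k (by omega) i1 i2 i3
    refine ⟨b1, b2, fun a ha => ?_⟩
    rw [b3 a ha, i3 a ha]
    by_cases h : a = dst + k
    · rw [if_pos h, if_pos (by omega), h, Nat.add_sub_cancel_left]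
    · rw [if_neg h]
      by_cases h2 : dst ≤ a ∧ a < dst + k
      · rw [if_pos h2, if_pos (by omega)]
      · rw [if_neg h2, if_neg (by omega)]

/-- Tables of different slots do not overlap. -/
theorem eq_of_mul_add_eq {L k j x y : ℕ} (hx : x < L) (hy : y < L)
    (h : k * L + x = j * L + y) : k = j := by
  rcases lt_trichotomy k j with hlt | rfl | hlt
  · have := Nat.mul_le_mul_right L (Nat.succ_le_of_lt hlt)
    rw [Nat.succ_mul] at this
    omega
  · rfl
  · have := Nat.mul_le_mul_right L (Nat.succ_le_of_lt hlt)
    rw [Nat.succ_mul] at this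
    omega

/-- A sweep over the table of slot `j` that replaces it by the table of another polynomial. -/
theorem exists_sweep (m G D i j v : ℕ) {body : State → State} (hbody : Impl body) :
    ∃ f, Impl f ∧ ∀ n ρ s S P, Holds m D ((n + 2) ^ G) n ρ s S →
    (∀ s' x, SweepRegs G D v (m + 3 + i * ((n + 2) ^ G) ^ D) (m + 3 + j * ((n + 2) ^ G) ^ D) s' →
      s'.nat 0 = n → s'.nat 7 = x → x < ((n + 2) ^ G) ^ D →
      (∀ a < m, s'.real a = ρ a) →
      (∀ y < ((n + 2) ^ G) ^ D, x ≤ y → s'.real (m + 3 + j * ((n + 2) ^ G) ^ D + y) =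
        (S j).coeff (digitVec ((n + 2) ^ G) D y)) →
      (∀ k ≠ j, ∀ y < ((n + 2) ^ G) ^ D, s'.real (m + 3 + k * ((n + 2) ^ G) ^ D + y) =
        (S k).coeff (digitVec ((n + 2) ^ G) D y)) →
      (∀ i < 7, (body s').nat i = s'.nat i) ∧ (body s').nat 7 = x + 1 ∧
      ∀ a, a < m ∨ m + 3 ≤ a → (body s').real a =
        if a = m + 3 + j * ((n + 2) ^ G) ^ D + x then P.coeff (digitVec ((n + 2) ^ G) D x)
        else s'.real a) →
    Holds m D ((n + 2) ^ G) n ρ (f s) (Function.update S j P) := by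
  obtain ⟨p, hp, hps⟩ := exists_setup m G D i j v
  refine ⟨_, hp.seq (hbody.iterPow (G * D)), fun n ρ s S P hS hb => ?_⟩
  obtain ⟨e1, e2, e3, e4⟩ := hps s hS.one
  rw [hS.n_eq] at e2 e4
  simp only [e2, pow_mul]
  set L := ((n + 2) ^ G) ^ D with hL
  obtain ⟨r1, r2, r3⟩ := sweep_spec (m := m) (L := L) (dst := m + 3 + j * L) (body := body)
    (upd := fun x => P.coeff (digitVec ((n + 2) ^ G) D x)) (p s) e3 (by
      intro s' x hx h1 h2 h3
      have hregs : SweepRegs G D v (m + 3 + i * L) (m + 3 + j * L) s' := by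
        constructor
        · rw [h1 1 (by norm_num), e4.one]
        · rw [h1 3 (by norm_num), e4.src]
        · rw [h1 4 (by norm_num), e4.dst]
        · rw [h1 5 (by norm_num), h1 0 (by norm_num), e4.low]
        · rw [h1 6 (by norm_num), h1 0 (by norm_num), e4.high]
      obtain ⟨b1, b2, b3⟩ := hb s' x hregs (by rw [h1 0 (by norm_num), e2]) h2 hx
        (fun a ha => by rw [h3 a (Or.inl ha), if_neg (by omega), e1, hS.low a ha])
        (fun y hy hxy => by
          rw [h3 _ (Or.inr (by omega)), if_neg (by omega), e1, hS.table j y hy])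
        (fun k hk y hy => by
          rw [h3 _ (Or.inr (by omega)), if_neg, e1, hS.table k y hy]
          rintro ⟨q1, q2⟩
          exact hk (eq_of_mul_add_eq hy (y := k * L + y - j * L) (by omega) (by omega)))
      exact ⟨fun i hi => (b1 i hi).trans (h1 i hi), b2, b3⟩) L le_rfl
  refine ⟨by rw [r1 0 (by norm_num), e2], by rw [r1 1 (by norm_num), e4.one],
    fun a ha => by rw [r3 a (Or.inl ha), if_neg (by omega), e1, hS.low a ha], fun k y hy => ?_⟩
  rw [← hL] at hy ⊢
  rw [r3 _ (Or.inr (by omega))]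
  by_cases hk : k = j
  · subst hk
    rw [if_pos (by omega), Nat.add_sub_cancel_left, Function.update_self]
  · rw [if_neg, Function.update_of_ne hk, e1, hS.table k y hy]
    rintro ⟨q1, q2⟩
    exact hk (eq_of_mul_add_eq hy (y := k * L + y - j * L) (by omega) (by omega))

/-- Because `i ≠ j`, the source table stays intact during the sweep, so the order in which positions
are visited does not matter. -/
theorem exists_axpy (m G D j i : ℕ) (hij : i ≠ j) {c : ℚ ⊕ ℕ} (hc : ∀ i, c = .inr i → i < m)
    {σ : Shift} (hσ : σ.Below D) : ∃ f, Impl f ∧ ∀ n ρ s S,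
    Holds m D ((n + 2) ^ G) n ρ s S → (∀ c, (S i).coeff c ≠ 0 → ∀ v, c v < (n + 2) ^ G) →
    Holds m D ((n + 2) ^ G) n ρ (f s)
      (Function.update S j (S j + MvPolynomial.C (coefVal ρ c) * σ.act (S i))) := by
  obtain ⟨b, hb, hbs⟩ := exists_axpyBody m G D hc σ
  obtain ⟨f, hf, hfs⟩ := exists_sweep m G D i j σ.var hb
  refine ⟨f, hf, fun n ρ s S hS hE => hfs n ρ s S _ hS fun s' x h1 h2 h3 h4 h5 h6 h7 => ?_⟩
  have hB : 0 < (n + 2) ^ G := by positivity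
  obtain ⟨c1, c2, c3⟩ := hbs ρ s' _ _ h1 (by rwa [h2, h3]) (by omega) h5
  refine ⟨c1, by rw [c2, h3], fun a ha => ?_⟩
  obtain ⟨d1, d2⟩ := c3 a ha
  rw [h2, h3] at d1 d2
  obtain ⟨q1, q2⟩ := Shift.coeff_act hB (x := x) hσ hE
  by_cases hax : a = m + 3 + j * ((n + 2) ^ G) ^ D + x
  · rw [if_pos hax, MvPolynomial.coeff_add, MvPolynomial.coeff_C_mul]
    by_cases hin : σ.Inside ((n + 2) ^ G) x
    · rw [d1 hax hin, hax, h6 x h4 le_rfl, q1 hin,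
        h7 i hij _ (Shift.source_lt hB h4 hσ hin)]
    · rw [d2 fun h => hin h.2, hax, h6 x h4 le_rfl, q2 hin, mul_zero, add_zero]
  · rw [if_neg hax, d2 fun h => hax h.1]

theorem exists_clear (m G D j : ℕ) : ∃ f, Impl f ∧ ∀ n ρ s S,
    Holds m D ((n + 2) ^ G) n ρ s S →
    Holds m D ((n + 2) ^ G) n ρ (f s) (Function.update S j 0) := by
  -- Clearing reads no source; source slot `0` and variable `0` are dummies.
  obtain ⟨f, hf, hfs⟩ := exists_sweep m G D 0 j 0
    (body := execs [.natAdd 11 4 7, .realConst m 0, .realStore 11 m, .natAdd 7 7 1])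
    (Impl.execs (by simp [Instr.Safe]))
  refine ⟨f, hf, fun n ρ s S hS => hfs n ρ s S _ hS fun s' x h1 h2 h3 h4 h5 h6 h7 =>
    ⟨fun i hi => ?_, ?_, fun a ha => ?_⟩⟩
  · simp [execs, Instr.exec, show i ≠ 7 by omega, show i ≠ 11 by omega]
  · simp [execs, Instr.exec, h1.one, h3]
  · simp [execs, Instr.exec, h1.dst, h3, Function.update_apply, show a ≠ m by omega]

/-- The exponent bound `g` plus the remaining cost serves as a budget: as long as it is below the
base, no digit overflows at any intermediate stage. -/
theorem exists_slotProg (m G D : ℕ) (p : SlotProg) (hp : p.Below D m) : ∃ f, Impl f ∧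
    ∀ n ρ s S g, Holds m D ((n + 2) ^ G) n ρ s S → (∀ j, ExponentsLE g (S j)) →
      g + p.cost n < (n + 2) ^ G → Holds m D ((n + 2) ^ G) n ρ (f s) (p.exec ρ n S) := by
  induction p with
  | clear j =>
    obtain ⟨f, hf, hfs⟩ := exists_clear m G D j
    exact ⟨f, hf, fun n ρ s S g hS _ _ => hfs n ρ s S hS⟩
  | axpy j i hij c σ =>
    obtain ⟨f, hf, hfs⟩ := exists_axpy m G D j i hij hp.1 hp.2
    exact ⟨f, hf, fun n ρ s S g hS hE hg => hfs n ρ s S hS fun c hc v =>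
      ((hE i c hc v).trans (Nat.le_add_right _ _)).trans_lt hg⟩
  | seq p q ihp ihq =>
    obtain ⟨f, hf, hfs⟩ := ihp hp.1
    obtain ⟨f', hf', hfs'⟩ := ihq hp.2
    refine ⟨_, hf.seq hf', fun n ρ s S g hS hE hg => ?_⟩
    rw [SlotProg.cost] at hg
    exact hfs' n ρ _ _ (g + p.cost n) (hfs n ρ s S g hS hE (by omega))
      (fun j => ExponentsLE.exec ρ n p hE j) (by omega)
  | rep p ihp =>
    obtain ⟨f, hf, hfs⟩ := ihp hp
    refine ⟨_, hf.iter, fun n ρ s S g hS hE hg => ?_⟩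
    rw [SlotProg.cost] at hg
    rw [SlotProg.exec, hS.n_eq]
    have key : ∀ k ≤ n, Holds m D ((n + 2) ^ G) n ρ (f^[k] s) ((p.exec ρ n)^[k] S) ∧
        ∀ j, ExponentsLE (g + k * p.cost n) ((p.exec ρ n)^[k] S j) := by
      intro k
      induction k with
      | zero => exact fun _ => ⟨hS, by simpa using hE⟩
      | succ k ih =>
        intro hk
        obtain ⟨i1, i2⟩ := ih (by omega)
        have h1 : (k + 1) * p.cost n ≤ n * p.cost n := Nat.mul_le_mul_right _ hk
        rw [Nat.succ_mul] at h1
        rw [Function.iterate_succ_apply', Function.iterate_succ_apply', Nat.succ_mul, ← add_assoc]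
        exact ⟨hfs n ρ _ _ _ i1 i2 (by omega), fun j => ExponentsLE.exec ρ n p i2 j⟩
    exact (key n le_rfl).1

/-- The constant coefficient of the polynomial in slot `0` after a program has been executed,
starting from `1` in slot `0` and `0` in the other slots. -/
theorem computable_of_slotProg {m : ℕ} {F : ℕ → (Fin m → ℝ) → (Fin m → ℝ) → ℝ} {D : ℕ}
    (p : SlotProg) (hp : p.Below D (2 * m))
    (h : ∀ n w wbar, (p.exec (initState n w wbar).real n (Function.update 0 0 1) 0).coeff 0 =
      F n w wbar) : ComputableInPolyTime F := by
  obtain ⟨G, hG⟩ := p.exists_cost_lt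
  obtain ⟨f, hf, hfs⟩ := exists_slotProg (2 * m) G D p hp
  -- Cell `2 * m + 3` is position `0` of slot `0`, the constant coefficient. All other table cells
  -- are initially `0`, so this single write stores the polynomial `1`.
  have hstart : Impl (Instr.exec (.realConst (2 * m + 3) 1)) := Impl.instr (by simp [Instr.Safe])
  have hend : Impl (execs [.realConst (2 * m) 0, .realAdd 0 (2 * m + 3) (2 * m)]) :=
    Impl.execs (by simp [Instr.Safe])
  refine ((hstart.seq hf).seq hend).computable fun n w wbar s h0 h1 hs => ?_
  have hB : 0 < (n + 2) ^ G := by positivity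
  have hzero : ∀ a, 2 * m ≤ a → (initState n w wbar).real a = 0 := fun a ha => by
    simp only [initState]
    rw [dif_neg (by omega)]
  have hH := hfs n (initState n w wbar).real ((Instr.realConst (2 * m + 3) 1).exec s)
    (Function.update 0 0 1) 0 ⟨by simpa [Instr.exec] using h0, by simpa [Instr.exec] using h1,
      fun a ha => by simp [Instr.exec, hs, show a ≠ 2 * m + 3 by omega], fun j x hx => by
        simp only [Instr.exec, hs, Function.update_apply]
        by_cases hj : j = 0
        · subst hj
          by_cases h0 : x = 0
          · subst h0
            simp [digitVec_zero]
          · have : digitVec ((n + 2) ^ G) D x ≠ 0 := fun h => h0 (digitVec_eq_zero hx h)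
            rw [if_neg (by omega), hzero _ (by omega), if_pos rfl, MvPolynomial.coeff_one,
              if_neg this.symm]
        · have : 0 < j * ((n + 2) ^ G) ^ D := by positivity
          rw [if_neg (by omega), hzero _ (by omega), if_neg hj]
          simp⟩
    (fun j c hc v => by
      rw [Function.update_apply] at hc
      split_ifs at hc
      · rw [MvPolynomial.coeff_one] at hc
        split_ifs at hc with h0
        · simp [← h0]
        · simp at hc
      · simp at hc)
    (by rw [zero_add]; exact hG n)
  rw [← h n w wbar]
  have ht := hH.table 0 0 (by positivity)
  rw [digitVec_zero, zero_mul, add_zero, add_zero] at ht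
  rw [← ht]
  simp [execs, Instr.exec]

end RealRAM
open MvPolynomial

/-! ### Operators on polynomials -/

/-- Real polynomials in countably many variables. -/
abbrev RPoly := MvPolynomial ℕ ℝ

/-- Division by a variable, dropping the monomials that it does not divide. -/
noncomputable def divX (v : ℕ) : Module.End ℝ RPoly where
  toFun P := P.divMonomial (Finsupp.single v 1)
  map_add' P Q := add_divMonomial P Q _
  map_smul' c P := by
    ext d
    simp [coeff_divMonomial]

/-- Multiplication by a polynomial. -/
noncomputable def mulBy (Q : RPoly) : Module.End ℝ RPoly := LinearMap.mulLeft ℝ Q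

@[simp] theorem mulBy_apply (Q P : RPoly) : mulBy Q P = Q * P := rfl

/-- The input of a weighted model counting problem: the domain size and the weights. -/
structure CountingInput (m : ℕ) where
  size : ℕ
  pos : Fin m → ℝ
  neg : Fin m → ℝ

/-- Expressions for operators on polynomials; `pow e` is the iterate of `e` whose length is the
domain size. -/
inductive OpExpr (m : ℕ) where
  | mulX (v : ℕ)
  | divX (v : ℕ)
  | const (q : ℚ)
  | pos (i : Fin m)
  | neg (i : Fin m)
  | add (e f : OpExpr m)
  | mul (e f : OpExpr m)
  | pow (e : OpExpr m)

namespace OpExpr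

/-- The operator denoted by an expression. -/
noncomputable def eval {m : ℕ} (I : CountingInput m) : OpExpr m → Module.End ℝ RPoly
  | mulX v => mulBy (X v)
  | divX v => _root_.divX v
  | const q => mulBy (C (q : ℝ))
  | pos i => mulBy (C (I.pos i))
  | neg i => mulBy (C (I.neg i))
  | add e f => e.eval I + f.eval I
  | mul e f => e.eval I * f.eval I
  | pow e => e.eval I ^ I.size

/-- The content of slot `k` is replaced by a multiple of its shift. -/
def modify (k : ℕ) (c : ℚ ⊕ ℕ) (σ : Shift) : SlotProg :=
  .seq (.seq (.clear (k + 1)) (.axpy (k + 1) k (by omega) c σ))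
    (.seq (.clear k) (.axpy k (k + 1) (by omega) (.inl 1) .none))

/-- A program that applies the operator to slot `k`, using only slots from `k` on. -/
def compile {m : ℕ} : OpExpr m → ℕ → SlotProg
  | mulX v, k => modify k (.inl 1) (.up v)
  | divX v, k => modify k (.inl 1) (.down v)
  | const q, k => modify k (.inl q) .none
  | pos i, k => modify k (.inr (2 * i)) .none
  | neg i, k => modify k (.inr (2 * i + 1)) .none
  | add e f, k =>
    .seq (.seq (.seq (.clear (k + 1)) (.axpy (k + 1) k (by omega) (.inl 1) .none))
        (e.compile (k + 1)))
      (.seq (.seq (.seq (.clear (k + 2)) (.axpy (k + 2) k (by omega) (.inl 1) .none))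
        (f.compile (k + 2)))
      (.seq (.clear k) (.seq (.axpy k (k + 1) (by omega) (.inl 1) .none)
        (.axpy k (k + 2) (by omega) (.inl 1) .none))))
  | mul e f, k => .seq (f.compile k) (e.compile k)
  | pow e, k => .rep (e.compile k)

theorem modify_exec (ρ : ℕ → ℝ) (n k : ℕ) (c : ℚ ⊕ ℕ) (σ : Shift) (S : ℕ → RPoly) :
    (modify k c σ).exec ρ n S k = C (coefVal ρ c) * σ.act (S k) ∧
      ∀ j < k, (modify k c σ).exec ρ n S j = S j := by
  refine ⟨?_, fun j hj => ?_⟩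
  · simp [modify, SlotProg.exec, coefVal, Shift.act]
  · simp [modify, SlotProg.exec, show j ≠ k by omega, show j ≠ k + 1 by omega]

/-- The slots form a stack: a compiled expression never touches the slots below its own. For a sum,
slot `k` therefore still holds the argument when the second summand is started, and the first result
survives in slot `k + 1`. -/
theorem compile_exec {m : ℕ} (I : CountingInput m) {ρ : ℕ → ℝ}
    (hpos : ∀ i : Fin m, ρ (2 * i) = I.pos i) (hneg : ∀ i : Fin m, ρ (2 * i + 1) = I.neg i)
    (e : OpExpr m) (k : ℕ) (S : ℕ → RPoly) :
    (e.compile k).exec ρ I.size S k = e.eval I (S k) ∧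
      ∀ j < k, (e.compile k).exec ρ I.size S j = S j := by
  induction e generalizing k S with
  | mulX v => simpa [eval, coefVal, compile, Shift.act] using modify_exec ρ I.size k (.inl 1) (.up v) S
  | divX v =>
    have h := modify_exec ρ I.size k (.inl 1) (.down v) S
    simp only [coefVal, Rat.cast_one, map_one, one_mul] at h
    exact h
  | const q => simpa [eval, coefVal, compile, Shift.act] using modify_exec ρ I.size k (.inl q) .none S
  | pos i =>
    simpa [eval, coefVal, hpos, compile, Shift.act] using
      modify_exec ρ I.size k (.inr (2 * i)) .none S
  | neg i =>
    simpa [eval, coefVal, hneg, compile, Shift.act] using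
      modify_exec ρ I.size k (.inr (2 * i + 1)) .none S
  | add e f he hf =>
    rw [compile, eval]
    simp only [SlotProg.exec, coefVal, Rat.cast_one, map_one, one_mul, Shift.act]
    set S1 := Function.update (Function.update S (k + 1) 0) (k + 1)
      (Function.update S (k + 1) 0 (k + 1) + Function.update S (k + 1) 0 k) with hS1
    obtain ⟨e1, e2⟩ := he (k + 1) S1
    set S2 := (e.compile (k + 1)).exec ρ I.size S1
    set S3 := Function.update (Function.update S2 (k + 2) 0) (k + 2)
      (Function.update S2 (k + 2) 0 (k + 2) + Function.update S2 (k + 2) 0 k) with hS3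
    obtain ⟨f1, f2⟩ := hf (k + 2) S3
    set S4 := (f.compile (k + 2)).exec ρ I.size S3
    have h1 : S1 (k + 1) = S k := by simp [hS1]
    have h2 : ∀ j < k + 1, S2 j = S j := fun j hj => by
      rw [e2 j hj]
      simp [hS1, show j ≠ k + 1 by omega]
    have h3 : S3 (k + 2) = S k := by simp [hS3, h2]
    have h4 : ∀ j < k + 2, S4 j = S2 j := fun j hj => by
      rw [f2 j hj]
      simp [hS3, show j ≠ k + 2 by omega]
    refine ⟨?_, fun j hj => ?_⟩
    · simp [f1, h3, h4 (k + 1), e1, h1]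
    · simp [show j ≠ k by omega, h4 j (by omega), h2 j (by omega)]
  | mul e f he hf =>
    obtain ⟨f1, f2⟩ := hf k S
    obtain ⟨e1, e2⟩ := he k ((f.compile k).exec ρ I.size S)
    exact ⟨e1.trans (by rw [f1]; rfl), fun j hj => (e2 j hj).trans (f2 j hj)⟩
  | pow e he =>
    rw [compile, eval, SlotProg.exec]
    generalize I.size = n at he ⊢
    have key : ∀ l, ((e.compile k).exec ρ n)^[l] S k = (e.eval I ^ l) (S k) ∧
        ∀ j < k, ((e.compile k).exec ρ n)^[l] S j = S j := by
      intro l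
      induction l with
      | zero => exact ⟨rfl, fun _ _ => rfl⟩
      | succ l ih =>
        rw [Function.iterate_succ_apply', pow_succ']
        obtain ⟨h1, h2⟩ := he k (((e.compile k).exec ρ n)^[l] S)
        exact ⟨by rw [h1, ih.1]; rfl, fun j hj => (h2 j hj).trans (ih.2 j hj)⟩
    exact key n

/-- Stated for all larger `D'`, so that subexpressions can share the maximum of their bounds. -/
theorem exists_below {m : ℕ} (e : OpExpr m) : ∃ D, ∀ D' ≥ D, ∀ k,
    (e.compile k).Below D' (2 * m) := by
  have modify_below : ∀ (k D' : ℕ) (c : ℚ ⊕ ℕ) (σ : Shift), (∀ i, c = .inr i → i < 2 * m) →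
      σ.Below D' → (modify k c σ).Below D' (2 * m) := by
    intro k D' c σ hc hσ
    exact ⟨⟨trivial, hc, hσ⟩, trivial, by simp, trivial⟩
  induction e with
  | mulX v => exact ⟨v + 1, fun D' hD k => modify_below _ _ _ _ (by simp) (by
      simp [Shift.Below]; omega)⟩
  | divX v => exact ⟨v + 1, fun D' hD k => modify_below _ _ _ _ (by simp) (by
      simp [Shift.Below]; omega)⟩
  | const q => exact ⟨0, fun D' hD k => modify_below _ _ _ _ (by simp) (by simp [Shift.Below])⟩
  | pos i => exact ⟨0, fun D' hD k => modify_below _ _ _ _ (by simp) (by simp [Shift.Below])⟩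
  | neg i => exact ⟨0, fun D' hD k => modify_below _ _ _ _ (by simp; omega) (by simp [Shift.Below])⟩
  | add e f he hf =>
    obtain ⟨a, ha⟩ := he
    obtain ⟨b, hb⟩ := hf
    refine ⟨max a b, fun D' hD k => ?_⟩
    have h1 := ha D' (le_of_max_le_left hD) (k + 1)
    have h2 := hb D' (le_of_max_le_right hD) (k + 2)
    simp [compile, SlotProg.Below, Shift.Below, h1, h2]
  | mul e f he hf =>
    obtain ⟨a, ha⟩ := he
    obtain ⟨b, hb⟩ := hf
    exact ⟨max a b, fun D' hD k => ⟨hb D' (le_of_max_le_right hD) k,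
      ha D' (le_of_max_le_left hD) k⟩⟩
  | pow e he =>
    obtain ⟨a, ha⟩ := he
    exact ⟨a, fun D' hD k => ha D' hD k⟩

theorem computable {m : ℕ} (e : OpExpr m) : RealRAM.ComputableInPolyTime fun n w wbar =>
    (e.eval ⟨n, w, wbar⟩ 1).coeff 0 := by
  obtain ⟨D, hD⟩ := e.exists_below
  refine RealRAM.computable_of_slotProg (e.compile 0) (hD D le_rfl 0) fun n w wbar => ?_
  rw [(compile_exec ⟨n, w, wbar⟩ (fun i => ?_) (fun i => ?_) e 0 _).1]
  · simp
  · simp [RealRAM.initState]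
  · simp [RealRAM.initState, show (2 * (i : ℕ) + 1) / 2 = i by omega]

end OpExpr

/-! ### Computable operators -/

/-- A family of operators on polynomials that is given by an expression. -/
def IsOp {m : ℕ} (Φ : CountingInput m → Module.End ℝ RPoly) : Prop :=
  ∃ e : OpExpr m, ∀ I, e.eval I = Φ I

/-- A family of polynomials such that the multiplication operators are given by an expression. -/
def IsRPoly {m : ℕ} (Q : CountingInput m → RPoly) : Prop := IsOp fun I => mulBy (Q I)

section closure
variable {m : ℕ} {Φ Ψ : CountingInput m → Module.End ℝ RPoly} {P Q : CountingInput m → RPoly}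

theorem IsOp.divX (v : ℕ) : IsOp (m := m) fun _ => divX v := ⟨.divX v, fun _ => rfl⟩

theorem IsOp.add (h : IsOp Φ) (h' : IsOp Ψ) : IsOp fun I => Φ I + Ψ I := by
  obtain ⟨e, he⟩ := h
  obtain ⟨f, hf⟩ := h'
  exact ⟨.add e f, fun I => by rw [OpExpr.eval, he, hf]⟩

theorem IsOp.mul (h : IsOp Φ) (h' : IsOp Ψ) : IsOp fun I => Φ I * Ψ I := by
  obtain ⟨e, he⟩ := h
  obtain ⟨f, hf⟩ := h'
  exact ⟨.mul e f, fun I => by rw [OpExpr.eval, he, hf]⟩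

theorem IsOp.powSize (h : IsOp Φ) : IsOp fun I => Φ I ^ I.size := by
  obtain ⟨e, he⟩ := h
  exact ⟨.pow e, fun I => by rw [OpExpr.eval, he]⟩

theorem IsRPoly.X (v : ℕ) : IsRPoly (m := m) fun _ => X v := ⟨.mulX v, fun _ => rfl⟩

theorem IsRPoly.rat (q : ℚ) : IsRPoly (m := m) fun _ => C (q : ℝ) := ⟨.const q, fun _ => rfl⟩

theorem IsRPoly.pos (i : Fin m) : IsRPoly fun I => C (I.pos i) := ⟨.pos i, fun _ => rfl⟩

theorem IsRPoly.neg (i : Fin m) : IsRPoly fun I => C (I.neg i) := ⟨.neg i, fun _ => rfl⟩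

theorem mulBy_one : mulBy 1 = 1 := by
  refine LinearMap.ext fun P => ?_
  simp

theorem mulBy_add (P Q : RPoly) : mulBy (P + Q) = mulBy P + mulBy Q := by
  refine LinearMap.ext fun R => ?_
  simp [add_mul]

theorem mulBy_mul (P Q : RPoly) : mulBy (P * Q) = mulBy P * mulBy Q := by
  refine LinearMap.ext fun R => ?_
  simp [mul_assoc]

theorem IsRPoly.zero : IsRPoly (m := m) fun _ => 0 := by simpa using IsRPoly.rat (m := m) 0

theorem IsRPoly.one : IsRPoly (m := m) fun _ => 1 := by simpa using IsRPoly.rat (m := m) 1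

theorem IsOp.one : IsOp (m := m) fun _ => 1 := by
  simpa [IsRPoly, mulBy_one] using IsRPoly.one (m := m)

theorem IsRPoly.add (h : IsRPoly P) (h' : IsRPoly Q) : IsRPoly fun I => P I + Q I := by
  simpa [IsRPoly, mulBy_add] using IsOp.add h h'

theorem IsRPoly.mul (h : IsRPoly P) (h' : IsRPoly Q) : IsRPoly fun I => P I * Q I := by
  simpa [IsRPoly, mulBy_mul] using IsOp.mul h h'

theorem IsOp.zero : IsOp (m := m) fun _ => 0 := by
  have h := IsRPoly.zero (m := m)
  rwa [IsRPoly, show (fun _ : CountingInput m => mulBy 0) = fun _ => 0 from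
    funext fun _ => LinearMap.ext fun R => by simp] at h

theorem IsOp.sub (h : IsOp Φ) (h' : IsOp Ψ) : IsOp fun I => Φ I - Ψ I := by
  have h2 := h.add ((show IsOp fun _ => mulBy (C ((-1 : ℚ) : ℝ)) from IsRPoly.rat (-1)).mul h')
  convert h2 using 2 with I
  refine LinearMap.ext fun R => ?_
  simp [sub_eq_add_neg]

theorem IsOp.sum {ι : Type*} (s : Finset ι) {Φ : ι → CountingInput m → Module.End ℝ RPoly}
    (h : ∀ i ∈ s, IsOp (Φ i)) : IsOp fun I => ∑ i ∈ s, Φ i I := by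
  classical
  induction s using Finset.induction_on with
  | empty => simpa using IsOp.zero (m := m)
  | insert a s ha ih =>
    simp only [Finset.sum_insert ha]
    exact (h a (by simp)).add (ih fun i hi => h i (by simp [hi]))

theorem IsOp.listProd {ι : Type*} (l : List ι) {Φ : ι → CountingInput m → Module.End ℝ RPoly}
    (h : ∀ i ∈ l, IsOp (Φ i)) : IsOp fun I => (l.map fun i => Φ i I).prod := by
  induction l with
  | nil => simpa using IsOp.one (m := m)
  | cons a l ih =>
    simp only [List.map_cons, List.prod_cons]
    exact (h a (by simp)).mul (ih fun i hi => h i (by simp [hi]))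

theorem IsOp.pow (h : IsOp Φ) (k : ℕ) : IsOp fun I => Φ I ^ k := by
  induction k with
  | zero => simpa using IsOp.one (m := m)
  | succ k ih =>
    simp only [pow_succ]
    exact ih.mul h

theorem IsOp.powSizePow (h : IsOp Φ) (k : ℕ) : IsOp fun I => Φ I ^ I.size ^ k := by
  induction k with
  | zero => simpa using h
  | succ k ih =>
    simp only [pow_succ, pow_mul]
    exact ih.powSize

theorem IsRPoly.sum {ι : Type*} (s : Finset ι) {P : ι → CountingInput m → RPoly}
    (h : ∀ i ∈ s, IsRPoly (P i)) : IsRPoly fun I => ∑ i ∈ s, P i I := by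
  classical
  induction s using Finset.induction_on with
  | empty => simpa using IsRPoly.zero (m := m)
  | insert a s ha ih =>
    simp only [Finset.sum_insert ha]
    exact (h a (by simp)).add (ih fun i hi => h i (by simp [hi]))

theorem IsRPoly.prod {ι : Type*} (s : Finset ι) {P : ι → CountingInput m → RPoly}
    (h : ∀ i ∈ s, IsRPoly (P i)) : IsRPoly fun I => ∏ i ∈ s, P i I := by
  classical
  induction s using Finset.induction_on with
  | empty => simpa using IsRPoly.one (m := m)
  | insert a s ha ih =>
    simp only [Finset.prod_insert ha]
    exact (h a (by simp)).mul (ih fun i hi => h i (by simp [hi]))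

theorem IsRPoly.pow (h : IsRPoly P) (k : ℕ) : IsRPoly fun I => P I ^ k := by
  simpa using IsRPoly.prod (Finset.range k) (P := fun _ => P) fun _ _ => h

end closure

/-- A family of numbers that can be multiplied to constant polynomials by an expression. -/
def IsScalar {m : ℕ} (f : CountingInput m → ℝ) : Prop :=
  ∃ Φ : CountingInput m → Module.End ℝ RPoly, IsOp Φ ∧ ∀ I a, Φ I (C a) = C (a * f I)

namespace IsScalar
variable {m : ℕ} {f g : CountingInput m → ℝ}

theorem of_isRPoly (h : IsRPoly fun I => C (f I)) : IsScalar f :=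
  ⟨_, h, fun I a => by rw [mulBy_apply, ← C_mul, mul_comm]⟩

theorem add (hf : IsScalar f) (hg : IsScalar g) : IsScalar fun I => f I + g I := by
  obtain ⟨Φ, h1, h2⟩ := hf
  obtain ⟨Ψ, h3, h4⟩ := hg
  exact ⟨_, h1.add h3, fun I a => by rw [LinearMap.add_apply, h2, h4, ← C_add, mul_add]⟩

/-- Scalars are multiplied by composing operators: the output of the first is again a constant
polynomial. This is the reason for the arbitrary constant `a` in `IsScalar`. -/
theorem mul (hf : IsScalar f) (hg : IsScalar g) : IsScalar fun I => f I * g I := by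
  obtain ⟨Φ, h1, h2⟩ := hf
  obtain ⟨Ψ, h3, h4⟩ := hg
  exact ⟨_, h3.mul h1, fun I a => by rw [Module.End.mul_apply, h2, h4, mul_assoc]⟩

theorem rat (q : ℚ) : IsScalar (m := m) fun _ => (q : ℝ) := of_isRPoly (IsRPoly.rat q)

theorem sum {ι : Type*} (s : Finset ι) {f : ι → CountingInput m → ℝ}
    (h : ∀ i ∈ s, IsScalar (f i)) : IsScalar fun I => ∑ i ∈ s, f i I := by
  classical
  induction s using Finset.induction_on with
  | empty => simpa using rat (m := m) 0
  | insert a s ha ih =>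
    simp only [Finset.sum_insert ha]
    exact (h a (by simp)).add (ih fun i hi => h i (by simp [hi]))

theorem prod {ι : Type*} (s : Finset ι) {f : ι → CountingInput m → ℝ}
    (h : ∀ i ∈ s, IsScalar (f i)) : IsScalar fun I => ∏ i ∈ s, f i I := by
  classical
  induction s using Finset.induction_on with
  | empty => simpa using rat (m := m) 1
  | insert a s ha ih =>
    simp only [Finset.prod_insert ha]
    exact (h a (by simp)).mul (ih fun i hi => h i (by simp [hi]))

/-- The indicator of the empty domain. -/
theorem sizeEqZero : IsScalar (m := m) fun I => if I.size = 0 then 1 else 0 := by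
  -- The zeroth power of the zero operator is the identity; all other powers vanish.
  refine ⟨_, (IsOp.zero (m := m)).powSize, fun I a => ?_⟩
  by_cases h : I.size = 0
  · simp [h]
  · simp [h, zero_pow h]

theorem computable (h : IsScalar f) :
    RealRAM.ComputableInPolyTime fun n w wbar => f ⟨n, w, wbar⟩ := by
  obtain ⟨Φ, ⟨e, he⟩, h2⟩ := h
  have h3 := e.computable
  simp only [he] at h3
  convert h3 using 4 with n w wbar
  have := h2 ⟨n, w, wbar⟩ 1
  rw [C_1] at this
  rw [this, one_mul, coeff_C, if_pos rfl]

end IsScalar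

/-! ### Substitution for a variable -/

/-- Substitution of `Q` for the variable `v`. -/
noncomputable def substX (v : ℕ) (Q : RPoly) : RPoly →ₐ[ℝ] RPoly :=
  aeval (Function.update X v Q)

@[simp] theorem substX_X_self (v : ℕ) (Q : RPoly) : substX v Q (X v) = Q := by
  simp [substX]

theorem substX_X_of_ne {u v : ℕ} (h : u ≠ v) (Q : RPoly) : substX v Q (X u) = X u := by
  simp [substX, h]

theorem substX_eq_self {v : ℕ} {P : RPoly} (hP : P.degreeOf v = 0) (Q : RPoly) :
    substX v Q P = P := by
  refine (hom_congr_vars (f₁ := (substX v Q).toRingHom) (f₂ := RingHom.id RPoly) (p₁ := P)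
    (p₂ := P) ?_ (fun i hi _ => ?_) rfl)
  · ext a
    simp
  · have : i ≠ v := by
      rintro rfl
      exact (mem_vars_iff_degreeOf_ne_zero.mp hi) hP
    exact substX_X_of_ne this Q

/-- Replacement of one factor `X v` by `Q` in the monomials that are divisible by `X v`. -/
noncomputable def replaceX (v : ℕ) (Q : RPoly) : Module.End ℝ RPoly :=
  1 - mulBy (X v) * divX v + mulBy Q * divX v

theorem IsOp.replaceX {m : ℕ} {Q : CountingInput m → RPoly} (h : IsRPoly Q) (v : ℕ) :
    IsOp fun I => replaceX v (Q I) :=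
  (IsOp.one.sub ((show IsOp _ from IsRPoly.X v).mul (IsOp.divX v))).add
    ((show IsOp _ from h).mul (IsOp.divX v))

theorem coeff_divX (v : ℕ) (P : RPoly) (c : ℕ →₀ ℕ) :
    (divX v P).coeff c = P.coeff (Finsupp.single v 1 + c) := coeff_divMonomial _ _ _

theorem degreeOf_divX (v : ℕ) (P : RPoly) : (divX v P).degreeOf v ≤ P.degreeOf v - 1 := by
  rw [degreeOf_le_iff]
  intro c hc
  rw [mem_support_iff, coeff_divX] at hc
  have := degreeOf_le_iff.mp (le_refl (P.degreeOf v)) _ (mem_support_iff.mpr hc)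
  rw [Finsupp.add_apply, Finsupp.single_eq_same] at this
  omega

theorem degreeOf_divX_le (u v : ℕ) (P : RPoly) : (divX v P).degreeOf u ≤ P.degreeOf u := by
  rw [degreeOf_le_iff]
  intro c hc
  rw [mem_support_iff, coeff_divX] at hc
  have := degreeOf_le_iff.mp (le_refl (P.degreeOf u)) _ (mem_support_iff.mpr hc)
  rw [Finsupp.add_apply] at this
  omega

/-- Subtracting `X v` times the quotient leaves exactly the monomials without `X v`. -/
theorem degreeOf_sub_X_mul_divX (v : ℕ) (P : RPoly) :
    (P - X v * divX v P).degreeOf v = 0 ∧ ∀ u, (P - X v * divX v P).degreeOf u ≤ P.degreeOf u := by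
  classical
  have key : ∀ c, (P - X v * divX v P).coeff c = if c v = 0 then P.coeff c else 0 := by
    intro c
    rw [coeff_sub, coeff_X_mul', coeff_divX]
    by_cases h : c v = 0
    · rw [if_neg (by simpa using h), if_pos h, sub_zero]
    · rw [if_pos (by simpa using h), if_neg h, add_tsub_cancel_of_le, sub_self]
      exact Finsupp.single_le_iff.mpr (by omega)
  refine ⟨Nat.le_zero.mp (degreeOf_le_iff.mpr fun c hc => ?_), fun u =>
    degreeOf_le_iff.mpr fun c hc => ?_⟩
  · rw [mem_support_iff, key] at hc
    split_ifs at hc with h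
    exacts [h.le, absurd rfl hc]
  · rw [mem_support_iff, key] at hc
    split_ifs at hc with h
    exacts [degreeOf_le_iff.mp le_rfl _ (mem_support_iff.mpr hc), absurd rfl hc]

theorem replaceX_apply (v : ℕ) (Q P : RPoly) :
    replaceX v Q P = (P - X v * divX v P) + Q * divX v P := rfl

theorem degreeOf_replaceX {v : ℕ} {Q : RPoly} (hQ : Q.degreeOf v = 0) (P : RPoly) :
    (replaceX v Q P).degreeOf v ≤ P.degreeOf v - 1 := by
  rw [replaceX_apply]
  refine (degreeOf_add_le _ _ _).trans (max_le ?_ ((degreeOf_mul_le _ _ _).trans ?_))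
  · rw [(degreeOf_sub_X_mul_divX v P).1]
    exact Nat.zero_le _
  · rw [hQ, zero_add]
    exact degreeOf_divX v P

theorem degreeOf_replaceX_of_ne {u v : ℕ} {Q : RPoly} (hQ : Q.degreeOf u = 0) (P : RPoly) :
    (replaceX v Q P).degreeOf u ≤ P.degreeOf u := by
  rw [replaceX_apply]
  refine (degreeOf_add_le _ _ _).trans (max_le ((degreeOf_sub_X_mul_divX v P).2 u)
    ((degreeOf_mul_le _ _ _).trans ?_))
  rw [hQ, zero_add]
  exact degreeOf_divX_le u v P

theorem substX_replaceX {v : ℕ} {Q : RPoly} (hQ : Q.degreeOf v = 0) (P : RPoly) :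
    substX v Q (replaceX v Q P) = substX v Q P := by
  rw [replaceX_apply, map_add, map_sub, map_mul, map_mul, substX_X_self, substX_eq_self hQ]
  ring

/-- One application trades one factor `X v` for `Q` in every monomial that has one. Since `Q` is
free of `X v`, this lowers the degree in `v` and does not change the result of substituting `Q`; at
degree zero the substitution is the identity. Substitution thus becomes a loop of fixed length. -/
theorem replaceX_pow {v : ℕ} {Q : RPoly} (hQ : Q.degreeOf v = 0) (k : ℕ) (P : RPoly)
    (hP : P.degreeOf v ≤ k) : (replaceX v Q ^ k) P = substX v Q P := by
  induction k generalizing P with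
  | zero => rw [substX_eq_self (Nat.le_zero.mp hP)]; rfl
  | succ k ih =>
    rw [pow_succ, Module.End.mul_apply, ih, substX_replaceX hQ]
    exact (degreeOf_replaceX hQ P).trans (by omega)

theorem degreeOf_substX_le {u v : ℕ} {Q : RPoly} (hv : Q.degreeOf v = 0) (hu : Q.degreeOf u = 0)
    (P : RPoly) : (substX v Q P).degreeOf u ≤ P.degreeOf u := by
  rw [← replaceX_pow hv _ P le_rfl]
  generalize P.degreeOf v = k
  induction k with
  | zero => exact le_rfl
  | succ k ih =>
    rw [pow_succ', Module.End.mul_apply]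
    exact (degreeOf_replaceX_of_ne hu _).trans ih

theorem divX_X_mul (v : ℕ) (P : RPoly) : divX v (X v * P) = P := X_mul_divMonomial v P

theorem divX_eq_zero {v : ℕ} {P : RPoly} (h : P.degreeOf v = 0) : divX v P = 0 := by
  ext c
  rw [coeff_divX, coeff_zero]
  by_contra hc
  have := degreeOf_le_iff.mp h.le _ (mem_support_iff.mpr hc)
  simp at this

/-! ### Polynomials without a given variable -/

section degree
variable {v : ℕ} {P Q : RPoly}

theorem degreeOf_add_eq_zero (hP : P.degreeOf v = 0) (hQ : Q.degreeOf v = 0) :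
    (P + Q).degreeOf v = 0 := by
  have := degreeOf_add_le v P Q
  omega

theorem degreeOf_mul_eq_zero (hP : P.degreeOf v = 0) (hQ : Q.degreeOf v = 0) :
    (P * Q).degreeOf v = 0 := by
  have := degreeOf_mul_le v P Q
  omega

theorem degreeOf_sum_eq_zero {ι : Type*} (s : Finset ι) {P : ι → RPoly}
    (h : ∀ i ∈ s, (P i).degreeOf v = 0) : (∑ i ∈ s, P i).degreeOf v = 0 :=
  Nat.le_zero.mp ((degreeOf_sum_le v s P).trans (Finset.sup_le fun i hi => (h i hi).le))

theorem degreeOf_prod_eq_zero {ι : Type*} (s : Finset ι) {P : ι → RPoly}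
    (h : ∀ i ∈ s, (P i).degreeOf v = 0) : (∏ i ∈ s, P i).degreeOf v = 0 :=
  Nat.le_zero.mp ((degreeOf_prod_le v s P).trans (Finset.sum_eq_zero h).le)

end degree

/-! ### Factorials and powers as scalars -/

/-- The part of degree zero in `v` of the quotient by `X v`. -/
noncomputable def linearCoeff (v : ℕ) : Module.End ℝ RPoly := (1 - mulBy (X v) * divX v) * divX v

theorem one_sub_X_mul_divX (v : ℕ) {R : RPoly} (hR : R.degreeOf v = 0) (S : RPoly) :
    (1 - mulBy (X v) * divX v) (R + X v * S) = R := by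
  rw [LinearMap.sub_apply, Module.End.one_apply, Module.End.mul_apply, map_add, divX_X_mul,
    divX_eq_zero hR, zero_add, mulBy_apply, add_sub_cancel_right]

theorem exists_one_add_pow (t i : ℕ) :
    ∃ R : RPoly, (1 + X t) ^ i = 1 + X t * (C (i : ℝ) + X t * R) := by
  induction i with
  | zero => exact ⟨0, by simp⟩
  | succ i ih =>
    obtain ⟨R, hR⟩ := ih
    refine ⟨C (i : ℝ) + R + X t * R, ?_⟩
    rw [pow_succ, hR]
    push_cast
    rw [C_add, C_1]
    ring

/-- The linear coefficient of `(1 + X t) ^ i` is `i`: an exponent is turned into a numerical factor.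
-/
theorem linearCoeff_mul_one_add_pow {t : ℕ} {P : RPoly} (hP : P.degreeOf t = 0) (i : ℕ) :
    linearCoeff t (P * (1 + X t) ^ i) = P * C (i : ℝ) := by
  obtain ⟨R, hR⟩ := exists_one_add_pow t i
  rw [hR, show P * (1 + X t * (C (i : ℝ) + X t * R)) =
    P + X t * (P * C (i : ℝ) + X t * (P * R)) by ring, linearCoeff, Module.End.mul_apply, map_add,
    divX_X_mul, divX_eq_zero hP, zero_add, one_sub_X_mul_divX]
  exact degreeOf_mul_eq_zero hP (degreeOf_C _ _)

theorem IsOp.linearCoeff {m : ℕ} (v : ℕ) : IsOp (m := m) fun _ => linearCoeff v :=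
  (IsOp.one.sub ((show IsOp _ from IsRPoly.X v).mul (IsOp.divX v))).mul (IsOp.divX v)

theorem degreeOf_C_mul_X_pow (a : ℝ) (u k : ℕ) : (C a * X u ^ k : RPoly).degreeOf u ≤ k := by
  refine (degreeOf_mul_le _ _ _).trans ?_
  rw [degreeOf_C, degreeOf_X_self_pow, zero_add]

theorem degreeOf_C_mul_X_pow_of_ne (a : ℝ) {u v : ℕ} (h : v ≠ u) (k : ℕ) :
    (C a * X u ^ k : RPoly).degreeOf v = 0 :=
  degreeOf_mul_eq_zero (degreeOf_C _ _) (degreeOf_X_pow_of_ne k h)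

theorem divX_pow_X_pow (v k e : ℕ) (P : RPoly) :
    (divX v ^ k) (X v ^ (k + e) * P) = X v ^ e * P := by
  induction k with
  | zero => simp
  | succ k ih =>
    rw [pow_succ, Module.End.mul_apply, show (X v ^ (k + 1 + e) * P : RPoly) =
      X v * (X v ^ (k + e) * P) by ring, divX_X_mul, ih]

namespace IsScalar
variable {m : ℕ}

/-- The exponent of `X 0` acts as the loop counter. A round takes `i! * X 0 ^ i` to `i! * X 0 ^ (i +
1)`, substitutes `X 1 * (1 + X 2)` for `X 0`, extracts the linear coefficient in `X 2`, which gives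
the factor `i + 1`, and renames `X 1` to `X 0`. Finally `X 0` is set to `1`. -/
theorem factorial : IsScalar (m := m) fun I => (I.size.factorial : ℝ) := by
  have hQ : IsRPoly (m := m) fun _ => X 1 * (1 + X 2) :=
    (IsRPoly.X 1).mul (IsRPoly.one.add (IsRPoly.X 2))
  have hstep : IsOp (m := m) fun I => replaceX 1 (X 0) ^ I.size * (linearCoeff 2 *
      (replaceX 0 (X 1 * (1 + X 2)) ^ I.size * mulBy (X 0))) :=
    (IsOp.replaceX (IsRPoly.X 0) 1).powSize.mul ((IsOp.linearCoeff 2).mul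
      ((IsOp.replaceX hQ 0).powSize.mul (IsRPoly.X 0)))
  refine ⟨_, (IsOp.replaceX IsRPoly.one 0).powSize.mul hstep.powSize, fun I a => ?_⟩
  have key : ∀ i ≤ I.size, ((replaceX 1 (X 0) ^ I.size * (linearCoeff 2 *
      (replaceX 0 (X 1 * (1 + X 2)) ^ I.size * mulBy (X 0)))) ^ i) (C a) =
      C (a * (i.factorial : ℝ)) * X 0 ^ i := by
    intro i
    induction i with
    | zero => intro _; simp
    | succ i ih =>
      intro hi
      rw [pow_succ', Module.End.mul_apply, ih (by omega)]
      simp only [Module.End.mul_apply, mulBy_apply]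
      rw [show (X 0 * (C (a * (i.factorial : ℝ)) * X 0 ^ i) : RPoly) =
        C (a * (i.factorial : ℝ)) * X 0 ^ (i + 1) by ring]
      rw [replaceX_pow _ _ _ ((degreeOf_C_mul_X_pow _ _ _).trans hi), map_mul, map_pow,
        substX_X_self, substX_eq_self (degreeOf_C _ _), mul_pow, ← mul_assoc,
        linearCoeff_mul_one_add_pow (degreeOf_C_mul_X_pow_of_ne _ (by norm_num) _),
        show (C (a * (i.factorial : ℝ)) * X 1 ^ (i + 1) * C ((i + 1 : ℕ) : ℝ) : RPoly) =
          C (a * ((i + 1).factorial : ℝ)) * X 1 ^ (i + 1) by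
            rw [mul_right_comm, ← C_mul, Nat.factorial_succ]; push_cast; ring_nf,
        replaceX_pow _ _ _ ((degreeOf_C_mul_X_pow _ _ _).trans hi), map_mul, map_pow,
        substX_X_self, substX_eq_self (degreeOf_C _ _)]
      · exact degreeOf_X_of_ne (by norm_num)
      · exact degreeOf_mul_eq_zero (degreeOf_X_of_ne (by norm_num))
          (degreeOf_add_eq_zero (degreeOf_one _) (degreeOf_X_of_ne (by norm_num)))
  rw [Module.End.mul_apply, key _ le_rfl, replaceX_pow (degreeOf_one _) _ _
    (degreeOf_C_mul_X_pow _ _ _), map_mul, map_pow, substX_X_self,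
    substX_eq_self (degreeOf_C _ _), one_pow, mul_one]

/-- Powers whose exponent is a difference of two polynomial expressions. -/
theorem powOfAddEq {x : CountingInput m → ℝ} (hx : IsRPoly fun I => C (x I))
    (E : ℕ → ℕ) (k₀ k₁ k₂ k₃ a : ℕ)
    (hE : ∀ n, E n + (k₀ + n * k₁ + n ^ 2 * k₂) = n ^ a + n * k₃) :
    IsScalar fun I => x I ^ E I.size := by
  have pows : ∀ {Φ : CountingInput m → Module.End ℝ RPoly}, IsOp Φ → ∀ c₀ c₁ b c₂ : ℕ,
      IsOp fun I => Φ I ^ (c₀ + I.size * c₁ + I.size ^ b * c₂) := by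
    intro Φ h c₀ c₁ b c₂
    simp only [pow_add, pow_mul]
    exact ((h.pow c₀).mul (h.powSize.pow c₁)).mul ((h.powSizePow b).pow c₂)
  -- Multiplying by the larger power of `X 0` and dividing by the smaller one leaves `X 0 ^ E n`,
  -- and then `x` is substituted for `X 0`. The larger exponent also bounds the number of
  -- replacements needed.
  refine ⟨_, (pows (IsOp.replaceX hx 0) 0 k₃ a 1).mul
    ((pows (IsOp.divX 0) k₀ k₁ 2 k₂).mul
      (pows (show IsOp _ from IsRPoly.X 0) 0 k₃ a 1)), fun I c => ?_⟩
  have hmul : ∀ k, (mulBy (X 0) ^ k) (C c) = X 0 ^ k * C c := by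
    intro k
    induction k with
    | zero => simp
    | succ k ih => rw [pow_succ', Module.End.mul_apply, ih, mulBy_apply]; ring
  have h1 : 0 + I.size * k₃ + I.size ^ a * 1 =
      (k₀ + I.size * k₁ + I.size ^ 2 * k₂) + E I.size := by
    have := hE I.size
    omega
  rw [Module.End.mul_apply, Module.End.mul_apply, hmul, h1, divX_pow_X_pow,
    replaceX_pow (degreeOf_C _ _), map_mul, map_pow, substX_X_self,
    substX_eq_self (degreeOf_C _ _), ← C_pow, ← C_mul, mul_comm]
  rw [mul_comm]
  exact (degreeOf_C_mul_X_pow _ _ _).trans (by omega)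

end IsScalar

/-! ### Simultaneous substitution -/

section substList
variable {ι : Type*} {v : ι → ℕ} {Q : ι → RPoly}

/-- Successive substitution of `Q s` for the variable `v s`. -/
noncomputable def substList (v : ι → ℕ) (Q : ι → RPoly) : List ι → RPoly →ₐ[ℝ] RPoly
  | [] => AlgHom.id ℝ RPoly
  | s :: l => (substX (v s) (Q s)).comp (substList v Q l)

theorem substList_X_of_notMem {w : ℕ} {l : List ι} (h : ∀ s ∈ l, w ≠ v s) :
    substList v Q l (X w) = X w := by
  induction l with
  | nil => rfl
  | cons s l ih =>
    rw [substList, AlgHom.comp_apply, ih fun s hs => h s (by simp [hs]),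
      substX_X_of_ne (h s (by simp))]

/-- No `Q s'` contains a substituted variable, so successive substitution acts as simultaneous
substitution. -/
theorem substList_X (hv : Function.Injective v) (hQ : ∀ s s', (Q s').degreeOf (v s) = 0)
    {s : ι} {l : List ι} (hs : s ∈ l) : substList v Q l (X (v s)) = Q s := by
  induction l with
  | nil => simp at hs
  | cons s' l ih =>
    rw [substList, AlgHom.comp_apply]
    by_cases h : s ∈ l
    · rw [ih h, substX_eq_self (hQ _ _)]
    · obtain rfl : s = s' := by simpa [h] using hs
      rw [substList_X_of_notMem, substX_X_self]
      rintro s' hs' he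
      exact h (hv he ▸ hs')

theorem prod_replaceX_pow (hQ : ∀ s s', (Q s').degreeOf (v s) = 0) (k : ℕ) (l : List ι)
    {P : RPoly} (hP : ∀ s, P.degreeOf (v s) ≤ k) :
    (l.map fun s => replaceX (v s) (Q s) ^ k).prod P = substList v Q l P ∧
      ∀ s, (substList v Q l P).degreeOf (v s) ≤ k := by
  induction l with
  | nil => exact ⟨rfl, hP⟩
  | cons s l ih =>
    rw [List.map_cons, List.prod_cons, Module.End.mul_apply, ih.1, substList, AlgHom.comp_apply]
    exact ⟨replaceX_pow (hQ _ _) _ _ (ih.2 s),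
      fun s' => (degreeOf_substX_le (hQ _ _) (hQ _ _) _).trans (ih.2 s')⟩

end substList

/-! ### Extraction of truncated exponents -/

/-- The sum of the coefficients of those powers of the variable `v` whose exponent, truncated at
`K`, is `k`; correct for exponents up to `n`. -/
noncomputable def truncCoeff (n K v k : ℕ) : Module.End ℝ RPoly :=
  if k < K then (1 - mulBy (X v) * divX v) * divX v ^ k else replaceX v 1 ^ n * divX v ^ K

theorem IsOp.truncCoeff {m : ℕ} (K v k : ℕ) :
    IsOp (m := m) fun I => truncCoeff I.size K v k := by
  unfold _root_.truncCoeff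
  split_ifs
  · exact (IsOp.one.sub ((show IsOp _ from IsRPoly.X v).mul (IsOp.divX v))).mul
      ((IsOp.divX v).pow k)
  · exact (IsOp.replaceX IsRPoly.one v).powSize.mul ((IsOp.divX v).pow K)

theorem divX_pow_X_pow_of_lt {v k e : ℕ} (h : e < k) {P : RPoly} (hP : P.degreeOf v = 0) :
    (divX v ^ k) (X v ^ e * P) = 0 := by
  obtain ⟨d, rfl⟩ : ∃ d, k = (d + 1) + e := ⟨k - e - 1, by omega⟩
  have := divX_pow_X_pow v e 0 P
  rw [add_zero, pow_zero, one_mul] at this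
  rw [pow_add, Module.End.mul_apply, this, pow_succ, Module.End.mul_apply, divX_eq_zero hP,
    map_zero]

/-- Below `K`, dividing by `X v ^ k` and keeping the part free of `X v` isolates the exponent `k`.
At `K`, dividing by `X v ^ K` kills the smaller exponents, and setting `X v = 1` merges the
remaining ones. -/
theorem truncCoeff_apply {n K v k e : ℕ} (hk : k ≤ K) (he : e ≤ n) {P : RPoly}
    (hP : P.degreeOf v = 0) :
    truncCoeff n K v k (P * X v ^ e) = if min e K = k then P else 0 := by
  rw [truncCoeff, mul_comm]
  split_ifs with h1 h2 h2
  · obtain rfl : e = k := by omega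
    have := divX_pow_X_pow v e 0 P
    rw [add_zero, pow_zero, one_mul] at this
    rw [Module.End.mul_apply, this]
    simpa using one_sub_X_mul_divX v hP 0
  · rw [Module.End.mul_apply]
    rcases lt_or_gt_of_ne (show e ≠ k by omega) with h | h
    · rw [divX_pow_X_pow_of_lt h hP, map_zero]
    · obtain ⟨d, rfl⟩ : ∃ d, e = k + (d + 1) := ⟨e - k - 1, by omega⟩
      rw [divX_pow_X_pow, pow_succ', mul_assoc]
      simpa using one_sub_X_mul_divX v (degreeOf_zero (R := ℝ) v) (X v ^ d * P)
  · obtain ⟨d, rfl⟩ : ∃ d, e = K + d := ⟨e - K, by omega⟩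
    rw [Module.End.mul_apply, divX_pow_X_pow, replaceX_pow (degreeOf_one v), map_mul, map_pow,
      substX_X_self, substX_eq_self hP, one_pow, one_mul]
    have h3 := degreeOf_mul_le v (X v ^ d) P
    rw [degreeOf_X_self_pow, hP] at h3
    omega
  · rw [Module.End.mul_apply, divX_pow_X_pow_of_lt (by omega) hP, map_zero]

theorem prod_truncCoeff_apply {ι : Type*} {n K : ℕ} {y : ι → ℕ} (hy : Function.Injective y)
    {k e : ι → ℕ} (hk : ∀ r, k r ≤ K) (he : ∀ r, e r ≤ n) (l : List ι) (hl : l.Nodup)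
    {P : RPoly} (hP : ∀ r ∈ l, P.degreeOf (y r) = 0) :
    (l.map fun r => truncCoeff n K (y r) (k r)).prod (P * (l.map fun r => X (y r) ^ e r).prod) =
      if ∀ r ∈ l, min (e r) K = k r then P else 0 := by
  classical
  induction l generalizing P with
  | nil => simp
  | cons r l ih =>
    rw [List.nodup_cons] at hl
    rw [List.map_cons, List.prod_cons, List.map_cons, List.prod_cons, Module.End.mul_apply,
      ← mul_assoc, ih hl.2]
    · by_cases h : ∀ r ∈ l, min (e r) K = k r
      · rw [if_pos h, truncCoeff_apply (hk r) (he r) (hP r (by simp))]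
        exact if_congr (by simpa using fun _ => h) rfl rfl
      · rw [if_neg h, map_zero, if_neg fun h' => h fun r hr => h' r (by simp [hr])]
    · intro r' hr'
      refine degreeOf_mul_eq_zero (hP r' (by simp [hr'])) (degreeOf_X_pow_of_ne _ fun h => ?_)
      exact hl.1 (hy h ▸ hr')

/-! ### Structures built from pairwise interactions along a linear order -/

/-- The data of a sum over all ways to choose a type for each of the elements `0, …, n - 1` and an
edge for each pair of elements.  The pairs contribute to vectors of counts at their two ends. -/
structure PairSystem (m : ℕ) (T R E : Type) where
  cap : ℕ
  unary : T → CountingInput m → ℝ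
  pair : T → T → E → Bool → CountingInput m → ℝ
  lower : T → T → E → R → ℕ
  upper : T → T → E → R → ℕ

namespace PairSystem
variable {m : ℕ} {T R E : Type} (S : PairSystem m T R E)

/-- The state of an element: its type, its truncated counts, and whether it is the last one. -/
abbrev St : Type := T × (R → Fin (S.cap + 1)) × Bool

/-- Truncation of counts. -/
def trunc (e : R → ℕ) : R → Fin (S.cap + 1) :=
  fun r => ⟨min (e r) S.cap, by omega⟩

/-- The state of an element after a further element has been added. -/
def next (s : S.St) (τ : T) (e : E) : S.St :=
  (s.1, S.trunc fun r => s.2.1 r + S.lower s.1 τ e r, false)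

/-- A type for each of `n` elements and an edge for each pair. -/
abbrev Config (T E : Type) (n : ℕ) : Type := (b : Fin n) → T × (Fin b → E)

variable {S}

/-- The counts at an element. -/
def count (S : PairSystem m T R E) {n : ℕ} (c : Config T E n) (a : Fin n) (r : R) : ℕ :=
  (∑ b : Fin n, if h : a < b then S.lower (c a).1 (c b).1 ((c b).2 ⟨a, h⟩) r else 0) +
    ∑ a' : Fin a, S.upper (c ⟨a', a'.2.trans a.2⟩).1 (c a).1 ((c a).2 a') r

/-- The state of an element. -/
def state (S : PairSystem m T R E) {n : ℕ} (c : Config T E n) (a : Fin n) : S.St :=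
  ((c a).1, S.trunc (S.count c a), decide ((a : ℕ) + 1 = n))

/-- The weight of a configuration. -/
noncomputable def weight (S : PairSystem m T R E) (I : CountingInput m) {n : ℕ}
    (c : Config T E n) : ℝ :=
  ∏ b : Fin n, (S.unary (c b).1 I * ∏ a : Fin b,
    S.pair (c ⟨a, a.2.trans b.2⟩).1 (c b).1 ((c b).2 a) (decide ((a : ℕ) + 1 = b)) I)

/-- Addition of one element to a configuration. -/
def snoc {n : ℕ} (c : Config T E n) (x : T × (Fin n → E)) : Config T E (n + 1) :=
  Fin.snoc (α := fun b : Fin (n + 1) => T × (Fin b → E)) c x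

@[simp] theorem snoc_castSucc {n : ℕ} (c : Config T E n) (x : T × (Fin n → E)) (a : Fin n) :
    snoc c x a.castSucc = c a := Fin.snoc_castSucc (α := fun b : Fin (n + 1) => T × (Fin b → E)) x c a

@[simp] theorem snoc_last {n : ℕ} (c : Config T E n) (x : T × (Fin n → E)) :
    snoc c x (Fin.last n) = x := Fin.snoc_last (α := fun b : Fin (n + 1) => T × (Fin b → E)) x c

theorem count_snoc_castSucc {n : ℕ} (c : Config T E n) (x : T × (Fin n → E)) (a : Fin n) (r : R) :
    S.count (snoc c x) a.castSucc r = S.count c a r + S.lower (c a).1 x.1 (x.2 a) r := by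
  have h2 : ∀ a' : Fin a, snoc c x ⟨a', (a'.2.trans a.2).trans n.lt_succ_self⟩ =
      c ⟨a', a'.2.trans a.2⟩ := fun a' => snoc_castSucc c x ⟨a', a'.2.trans a.2⟩
  have h3 : ∀ b : Fin n, (if h : a.castSucc < b.castSucc then
      S.lower (c a).1 (snoc c x b.castSucc).1 ((snoc c x b.castSucc).2 ⟨a, h⟩) r else 0) =
      if h : a < b then S.lower (c a).1 (c b).1 ((c b).2 ⟨a, h⟩) r else 0 := by
    intro b
    rw [snoc_castSucc]
    rfl
  rw [count, Fin.sum_univ_castSucc, snoc_castSucc]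
  have h4 : a.castSucc < Fin.last n := Fin.castSucc_lt_last a
  rw [dif_pos h4, snoc_last, count, add_right_comm]
  refine congrArg₂ _ (congrArg₂ _ (Finset.sum_congr rfl fun b _ => h3 b)
    (Finset.sum_congr rfl fun a' _ => ?_)) rfl
  exact congrArg (fun y => S.upper y.1 (c a).1 ((c a).2 a') r) (h2 a')

theorem count_snoc_last {n : ℕ} (c : Config T E n) (x : T × (Fin n → E)) (r : R) :
    S.count (snoc c x) (Fin.last n) r = ∑ a : Fin n, S.upper (c a).1 x.1 (x.2 a) r := by
  rw [count, Finset.sum_eq_zero, zero_add, snoc_last]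
  · refine Finset.sum_congr rfl fun a _ => ?_
    exact congrArg (fun y => S.upper y.1 x.1 (x.2 a) r) (snoc_castSucc c x a)
  · intro b _
    rw [dif_neg]
    exact not_lt.mpr (Fin.le_last b)

/-- Truncated counts can be updated without knowing the true ones, since truncating before and after
an addition equals truncating after it. -/
theorem state_snoc_castSucc {n : ℕ} (c : Config T E n) (x : T × (Fin n → E)) (a : Fin n) :
    S.state (snoc c x) a.castSucc = S.next (S.state c a) x.1 (x.2 a) := by
  have h : ¬ ((a : ℕ) + 1 = n + 1) := by omega
  simp only [state, next, snoc_castSucc, Fin.val_castSucc, h, decide_false]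
  congr 2
  funext r
  simp only [trunc, Fin.mk.injEq, count_snoc_castSucc]
  omega

theorem state_snoc_last {n : ℕ} (c : Config T E n) (x : T × (Fin n → E)) :
    S.state (snoc c x) (Fin.last n) =
      (x.1, S.trunc fun r => ∑ a : Fin n, S.upper (c a).1 x.1 (x.2 a) r, true) := by
  simp only [state, snoc_last, Fin.val_last, decide_true]
  congr 3
  funext r
  exact count_snoc_last c x r

/-- The flag in the state marks the last element so far, which is the only one consecutive with the
new element. -/
theorem weight_snoc (I : CountingInput m) {n : ℕ} (c : Config T E n) (x : T × (Fin n → E)) :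
    S.weight I (snoc c x) = S.weight I c * (S.unary x.1 I *
      ∏ a : Fin n, S.pair (c a).1 x.1 (x.2 a) (S.state c a).2.2 I) := by
  rw [weight, Fin.prod_univ_castSucc, snoc_last, weight]
  congr 1
  · refine Finset.prod_congr rfl fun b _ => ?_
    rw [snoc_castSucc]
    refine congrArg _ (Finset.prod_congr rfl fun a _ => ?_)
    exact congrArg (fun y => S.pair y.1 (c b).1 ((c b).2 a) (decide ((a : ℕ) + 1 = b)) I)
      (snoc_castSucc c x ⟨a, a.2.trans b.2⟩)
  · refine congrArg _ (Finset.prod_congr rfl fun a _ => ?_)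
    exact congrArg (fun y => S.pair y.1 x.1 (x.2 a) (decide ((a : ℕ) + 1 = n)) I)
      (snoc_castSucc c x a)

/-- Configurations of `n + 1` elements. -/
def snocEquiv (T E : Type) (n : ℕ) : Config T E n × (T × (Fin n → E)) ≃ Config T E (n + 1) where
  toFun p := snoc p.1 p.2
  invFun c := (fun a => c a.castSucc, c (Fin.last n))
  left_inv p := Prod.ext (funext fun a => snoc_castSucc p.1 p.2 a) (snoc_last p.1 p.2)
  right_inv c := by
    funext a
    refine Fin.lastCases ?_ (fun a => ?_) a
    · exact snoc_last _ _
    · exact snoc_castSucc _ _ a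

variable [Fintype T] [Fintype E]

/-- The sum over all configurations, where an element in state `s` counts as `ξ s`. -/
noncomputable def total (S : PairSystem m T R E) (I : CountingInput m) (n : ℕ)
    (ξ : S.St → RPoly) : RPoly :=
  ∑ c : Config T E n, C (S.weight I c) * ∏ a, ξ (S.state c a)

/-- The sum over all configurations with one more element, of type `τ`. -/
noncomputable def totalLast (S : PairSystem m T R E) (I : CountingInput m) (n : ℕ) (τ : T)
    (ξ : S.St → RPoly) : RPoly :=
  ∑ c : Config T E n, ∑ t : Fin n → E, (C (S.weight I c) *
    ∏ a, (C (S.pair (c a).1 τ (t a) (S.state c a).2.2 I) * ξ (S.next (S.state c a) τ (t a)))) *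
    ξ (τ, S.trunc fun r => ∑ a : Fin n, S.upper (c a).1 τ (t a) r, true)

theorem total_succ (I : CountingInput m) (n : ℕ) (ξ : S.St → RPoly) :
    S.total I (n + 1) ξ = ∑ τ, C (S.unary τ I) * S.totalLast I n τ ξ := by
  simp only [total, totalLast, Finset.mul_sum]
  rw [Finset.sum_comm, ← Equiv.sum_comp (snocEquiv T E n), Fintype.sum_prod_type]
  refine Finset.sum_congr rfl fun c _ => ?_
  rw [Fintype.sum_prod_type]
  refine Finset.sum_congr rfl fun τ _ => Finset.sum_congr rfl fun t _ => ?_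
  rw [snocEquiv, Equiv.coe_fn_mk, Fin.prod_univ_castSucc, weight_snoc, state_snoc_last]
  simp only [state_snoc_castSucc]
  rw [Finset.prod_mul_distrib, C_mul, C_mul, map_prod]
  ring

theorem total_zero (I : CountingInput m) (ξ : S.St → RPoly) : S.total I 0 ξ = 1 := by
  simp [total, weight]

theorem map_total (I : CountingInput m) (n : ℕ) (ξ : S.St → RPoly) (φ : RPoly →ₐ[ℝ] RPoly) :
    φ (S.total I n ξ) = S.total I n fun s => φ (ξ s) := by
  simp only [total, map_sum, map_mul, map_prod, algHom_C, algebraMap_eq]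

theorem map_totalLast (I : CountingInput m) (n : ℕ) (τ : T) (ξ : S.St → RPoly)
    (φ : RPoly →ₐ[ℝ] RPoly) :
    φ (S.totalLast I n τ ξ) = S.totalLast I n τ fun s => φ (ξ s) := by
  simp only [totalLast, map_sum, map_mul, map_prod, algHom_C, algebraMap_eq]

theorem degreeOf_total (I : CountingInput m) (n : ℕ) {ξ : S.St → RPoly} {v : ℕ}
    (h : ∀ s, (ξ s).degreeOf v ≤ 1) : (S.total I n ξ).degreeOf v ≤ n := by
  refine (degreeOf_sum_le _ _ _).trans (Finset.sup_le fun c _ => ?_)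
  refine (degreeOf_C_mul_le _ _ _).trans ((degreeOf_prod_le _ _ _).trans ?_)
  refine (Finset.sum_le_sum fun a _ => h _).trans (by simp)

theorem degreeOf_totalLast (I : CountingInput m) (n : ℕ) (τ : T) {ξ : S.St → RPoly} {v : ℕ}
    (h : ∀ s, (ξ s).degreeOf v ≤ 1) : (S.totalLast I n τ ξ).degreeOf v ≤ n + 1 := by
  refine (degreeOf_sum_le _ _ _).trans (Finset.sup_le fun c _ => ?_)
  refine (degreeOf_sum_le _ _ _).trans (Finset.sup_le fun t _ => ?_)
  refine (degreeOf_mul_le _ _ _).trans (add_le_add ?_ (h _))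
  refine (degreeOf_C_mul_le _ _ _).trans ((degreeOf_prod_le _ _ _).trans ?_)
  exact (Finset.sum_le_sum fun a _ => (degreeOf_C_mul_le _ _ _).trans (h _)).trans (by simp)

end PairSystem
-- Adding an element as an operator on generating polynomials.
namespace PairSystem
variable {m : ℕ} {T R E : Type} [Fintype T] [Fintype R] [DecidableEq R]
  (S : PairSystem m T R E)

/-- A numbering of the variables used to add an element: two for each state and one for each
component of the counts. -/
noncomputable def var : S.St ⊕ S.St ⊕ R → ℕ := by
  classical exact fun w => (Fintype.equivFin (S.St ⊕ S.St ⊕ R) w : ℕ)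

theorem var_injective : Function.Injective S.var := fun w w' h => by
  classical exact (Fintype.equivFin (S.St ⊕ S.St ⊕ R)).injective (Fin.val_injective h)

/-- The variable of a state before the new element is compared with it. -/
noncomputable def oldVar (s : S.St) : ℕ := S.var (.inl s)

/-- The variable of a state after the new element has been compared with it. -/
noncomputable def newVar (s : S.St) : ℕ := S.var (.inr (.inl s))

/-- The variable that counts at the new element. -/
noncomputable def countVar (r : R) : ℕ := S.var (.inr (.inr r))

theorem oldVar_injective : Function.Injective S.oldVar := fun s s' h => by
  simpa using S.var_injective h

theorem newVar_injective : Function.Injective S.newVar := fun s s' h => by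
  simpa using S.var_injective h

theorem countVar_injective : Function.Injective S.countVar := fun s s' h => by
  simpa using S.var_injective h

theorem oldVar_ne_newVar (s s' : S.St) : S.oldVar s ≠ S.newVar s' := fun h => by
  simpa using S.var_injective h

theorem oldVar_ne_countVar (s : S.St) (r : R) : S.oldVar s ≠ S.countVar r := fun h => by
  simpa using S.var_injective h

theorem newVar_ne_countVar (s : S.St) (r : R) : S.newVar s ≠ S.countVar r := fun h => by
  simpa using S.var_injective h

variable [Fintype E]

/-- What becomes of an element in state `s` when it is compared with a new element of type `τ`. -/
noncomputable def spread (I : CountingInput m) (τ : T) (s : S.St) : RPoly :=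
  ∑ e, C (S.pair s.1 τ e s.2.2 I) * X (S.newVar (S.next s τ e)) *
    ∏ r, X (S.countVar r) ^ S.upper s.1 τ e r

/-- The comparison of a new element of type `τ` with all others. -/
noncomputable def spreadOp (I : CountingInput m) (τ : T) : Module.End ℝ RPoly :=
  ((Finset.univ : Finset S.St).toList.map fun s =>
    replaceX (S.oldVar s) (S.spread I τ s) ^ I.size).prod

/-- The creation of a new element of type `τ` with the counts given by the exponents. -/
noncomputable def createOp (I : CountingInput m) (τ : T) : Module.End ℝ RPoly :=
  ∑ k : R → Fin (S.cap + 1), mulBy (X (S.newVar (τ, k, true))) *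
    ((Finset.univ : Finset R).toList.map fun r =>
      truncCoeff I.size S.cap (S.countVar r) (k r)).prod

/-- The renaming of the variables. -/
noncomputable def renameOp (I : CountingInput m) : Module.End ℝ RPoly :=
  ((Finset.univ : Finset S.St).toList.map fun s =>
    replaceX (S.newVar s) (X (S.oldVar s)) ^ I.size).prod

/-- The addition of a new element. -/
noncomputable def stepOp (I : CountingInput m) : Module.End ℝ RPoly :=
  ∑ τ, mulBy (C (S.unary τ I)) * (S.renameOp I * (S.createOp I τ * S.spreadOp I τ))

/-- The evaluation of the polynomial. -/
noncomputable def evalOp (g : S.St → CountingInput m → ℝ) (I : CountingInput m) :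
    Module.End ℝ RPoly :=
  ((Finset.univ : Finset S.St).toList.map fun s =>
    replaceX (S.oldVar s) (C (g s I)) ^ I.size).prod

variable {S}

theorem prod_replaceX_pow_univ {v : S.St → ℕ} (hv : Function.Injective v) {Q : S.St → RPoly}
    (hQ : ∀ s s', (Q s').degreeOf (v s) = 0) (n : ℕ) :
    ∃ φ : RPoly →ₐ[ℝ] RPoly, (∀ s, φ (X (v s)) = Q s) ∧ ∀ P : RPoly,
      (∀ s, P.degreeOf (v s) ≤ n) →
      ((Finset.univ : Finset S.St).toList.map fun s => replaceX (v s) (Q s) ^ n).prod P = φ P :=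
  ⟨substList v Q (Finset.univ : Finset S.St).toList,
    fun s => substList_X hv hQ (by simp), fun _ hP => (prod_replaceX_pow hQ n _ hP).1⟩

theorem degreeOf_X_le_one (u v : ℕ) : (X u : RPoly).degreeOf v ≤ 1 := by
  rw [degreeOf_X]
  split_ifs <;> omega

/-- Separate variables for the states before and after the comparison keep the substituted
polynomials free of the variables being replaced. -/
theorem spreadOp_total (I : CountingInput m) (τ : T) {n : ℕ} (hn : n ≤ I.size) :
    S.spreadOp I τ (S.total I n fun s => X (S.oldVar s)) = S.total I n (S.spread I τ) := by
  obtain ⟨φ, h1, h2⟩ := prod_replaceX_pow_univ S.oldVar_injective (Q := S.spread I τ)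
    (fun s s' => degreeOf_sum_eq_zero _ fun e _ => degreeOf_mul_eq_zero
      (degreeOf_mul_eq_zero (degreeOf_C _ _) (degreeOf_X_of_ne (S.oldVar_ne_newVar _ _)))
      (degreeOf_prod_eq_zero _ fun r _ => degreeOf_X_pow_of_ne _ (S.oldVar_ne_countVar _ _)))
    I.size
  rw [spreadOp, h2, map_total]
  · simp only [h1]
  · exact fun s => (degreeOf_total I n fun s' => degreeOf_X_le_one _ _).trans hn

/-- Expanding a product over old elements of sums over edges gives the sum over all ways `t` to join
the new element; the exponents of the counting variables add up to its counts. -/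
theorem total_spread (I : CountingInput m) (τ : T) (n : ℕ) :
    S.total I n (S.spread I τ) = ∑ c : Config T E n, ∑ t : Fin n → E, (C (S.weight I c) *
      ∏ a, (C (S.pair (c a).1 τ (t a) (S.state c a).2.2 I) *
        X (S.newVar (S.next (S.state c a) τ (t a))))) *
      ∏ r, X (S.countVar r) ^ ∑ a : Fin n, S.upper (c a).1 τ (t a) r := by
  classical
  rw [total]
  refine Finset.sum_congr rfl fun c _ => ?_
  simp only [spread]
  rw [Finset.prod_univ_sum, Fintype.piFinset_univ, Finset.mul_sum]
  refine Finset.sum_congr rfl fun t _ => ?_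
  rw [Finset.prod_mul_distrib, mul_assoc]
  congr 2
  rw [Finset.prod_comm]
  refine Finset.prod_congr rfl fun r _ => ?_
  rw [Finset.prod_pow_eq_pow_sum]
  rfl

/-- Of all candidate vectors `k`, only the truncation of `e` survives the extraction. -/
theorem createOp_mul_prod (I : CountingInput m) (τ : T) {P : RPoly}
    (hP : ∀ r, P.degreeOf (S.countVar r) = 0) {e : R → ℕ} (he : ∀ r, e r ≤ I.size) :
    S.createOp I τ (P * ∏ r, X (S.countVar r) ^ e r) = P * X (S.newVar (τ, S.trunc e, true)) := by
  classical
  rw [createOp, LinearMap.sum_apply, Finset.sum_eq_single (S.trunc e)]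
  · rw [← Finset.prod_map_toList, Module.End.mul_apply, prod_truncCoeff_apply S.countVar_injective
      (fun r => Nat.le_of_lt_succ (S.trunc e r).2) he _ (Finset.nodup_toList _) fun r _ => hP r,
      if_pos, mulBy_apply, mul_comm]
    exact fun r _ => rfl
  · intro k _ hk
    rw [← Finset.prod_map_toList, Module.End.mul_apply, prod_truncCoeff_apply S.countVar_injective
      (fun r => Nat.le_of_lt_succ (k r).2) he _ (Finset.nodup_toList _) fun r _ => hP r,
      if_neg, map_zero]
    intro h
    exact hk (funext fun r => Fin.ext (h r (by simp)).symm)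
  · simp

/-- Each pair adds at most one to a count, so the exponents stay within the range in which
`truncCoeff` is correct. -/
theorem createOp_spread (hup : ∀ τ τ' e r, S.upper τ τ' e r ≤ 1) (I : CountingInput m) (τ : T)
    {n : ℕ} (hn : n ≤ I.size) : S.createOp I τ (S.total I n (S.spread I τ)) =
      S.totalLast I n τ fun s => X (S.newVar s) := by
  rw [total_spread, map_sum, totalLast]
  refine Finset.sum_congr rfl fun c _ => ?_
  rw [map_sum]
  refine Finset.sum_congr rfl fun t _ => createOp_mul_prod I τ (fun r => ?_) fun r => ?_
  · refine degreeOf_mul_eq_zero (degreeOf_C _ _) (degreeOf_prod_eq_zero _ fun a _ =>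
      degreeOf_mul_eq_zero (degreeOf_C _ _) (degreeOf_X_of_ne (S.newVar_ne_countVar _ _).symm))
  · exact (Finset.sum_le_sum fun a _ => hup _ _ _ _).trans (by simpa using hn)

theorem renameOp_totalLast (I : CountingInput m) (τ : T) {n : ℕ} (hn : n + 1 ≤ I.size) :
    S.renameOp I (S.totalLast I n τ fun s => X (S.newVar s)) =
      S.totalLast I n τ fun s => X (S.oldVar s) := by
  obtain ⟨φ, h1, h2⟩ := prod_replaceX_pow_univ S.newVar_injective (Q := fun s => X (S.oldVar s))
    (fun s s' => degreeOf_X_of_ne (S.oldVar_ne_newVar _ _).symm) I.size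
  rw [renameOp, h2, map_totalLast]
  · simp only [h1]
  · exact fun s => (degreeOf_totalLast I n τ fun s' => degreeOf_X_le_one _ _).trans hn

theorem stepOp_total (hup : ∀ τ τ' e r, S.upper τ τ' e r ≤ 1) (I : CountingInput m) {n : ℕ}
    (hn : n + 1 ≤ I.size) : S.stepOp I (S.total I n fun s => X (S.oldVar s)) =
      S.total I (n + 1) fun s => X (S.oldVar s) := by
  rw [stepOp, LinearMap.sum_apply, total_succ]
  refine Finset.sum_congr rfl fun τ _ => ?_
  rw [Module.End.mul_apply, Module.End.mul_apply, Module.End.mul_apply,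
    spreadOp_total I τ (by omega), createOp_spread hup I τ (by omega), renameOp_totalLast I τ hn,
    mulBy_apply]

theorem stepOp_pow (hup : ∀ τ τ' e r, S.upper τ τ' e r ≤ 1) (I : CountingInput m) (a : ℝ) {n : ℕ}
    (hn : n ≤ I.size) : (S.stepOp I ^ n) (C a) = a • S.total I n fun s => X (S.oldVar s) := by
  induction n with
  | zero => rw [total_zero, pow_zero, Module.End.one_apply, smul_eq_C_mul, mul_one]
  | succ n ih => rw [pow_succ', Module.End.mul_apply, ih (by omega), map_smul, stepOp_total hup I hn]

theorem evalOp_total (g : S.St → CountingInput m → ℝ) (I : CountingInput m) {n : ℕ}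
    (hn : n ≤ I.size) : S.evalOp g I (S.total I n fun s => X (S.oldVar s)) =
      C (∑ c : Config T E n, S.weight I c * ∏ a, g (S.state c a) I) := by
  obtain ⟨φ, h1, h2⟩ := prod_replaceX_pow_univ S.oldVar_injective (Q := fun s => C (g s I))
    (fun s s' => degreeOf_C _ _) I.size
  rw [evalOp, h2, map_total]
  · simp only [h1, total, map_sum, C_mul, map_prod]
  · exact fun s => (degreeOf_total I n fun s' => degreeOf_X_le_one _ _).trans hn

/-- The sum over all configurations is a scalar if the weights are. -/
theorem isScalar (hup : ∀ τ τ' e r, S.upper τ τ' e r ≤ 1)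
    (hunary : ∀ τ, IsRPoly fun I => C (S.unary τ I))
    (hpair : ∀ τ τ' e b, IsRPoly fun I => C (S.pair τ τ' e b I))
    {g : S.St → CountingInput m → ℝ} (hg : ∀ s, IsRPoly fun I => C (g s I)) :
    IsScalar fun I => ∑ c : Config T E I.size, S.weight I c * ∏ a, g (S.state c a) I := by
  have hspread : ∀ τ, IsOp fun I => S.spreadOp I τ := fun τ =>
    IsOp.listProd _ fun s _ => (IsOp.replaceX (IsRPoly.sum _ fun e _ =>
      ((hpair _ _ _ _).mul (IsRPoly.X _)).mul
        (IsRPoly.prod _ fun r _ => (IsRPoly.X _).pow _)) _).powSize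
  have hcreate : ∀ τ, IsOp fun I => S.createOp I τ := fun τ =>
    IsOp.sum _ fun k _ => (show IsOp _ from IsRPoly.X _).mul
      (IsOp.listProd _ fun r _ => IsOp.truncCoeff _ _ _)
  have hrename : IsOp fun I => S.renameOp I :=
    IsOp.listProd _ fun s _ => (IsOp.replaceX (IsRPoly.X _) _).powSize
  have hstep : IsOp fun I => S.stepOp I :=
    IsOp.sum _ fun τ _ => (show IsOp _ from hunary τ).mul
      (hrename.mul ((hcreate τ).mul (hspread τ)))
  have heval : IsOp fun I => S.evalOp g I :=
    IsOp.listProd _ fun s _ => (IsOp.replaceX (hg s) _).powSize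
  refine ⟨_, heval.mul hstep.powSize, fun I a => ?_⟩
  rw [Module.End.mul_apply, stepOp_pow hup I a le_rfl, map_smul, evalOp_total g I le_rfl,
    smul_eq_C_mul, ← C_mul]

end PairSystem

/-! ### Satisfaction depends on the free variables only -/

section relabel
variable {m : ℕ} {ar : Fin m → ℕ} {n : ℕ}

theorem C2Formula.Sat.congr (ω : World ar n) (φ : C2Formula ar) {e e' : Fin 2 → Option (Fin n)}
    (h : ∀ v ∈ φ.freeVars, e v = e' v) : φ.Sat ω e ↔ φ.Sat ω e' := by
  have upd : ∀ {χ : C2Formula ar} {v : Fin 2} {e e' : Fin 2 → Option (Fin n)},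
      (∀ w ∈ χ.freeVars.erase v, e w = e' w) → ∀ a, ∀ w ∈ χ.freeVars,
        Function.update e v a w = Function.update e' v a w := by
    intro χ v e e' h a w hw
    by_cases hwv : w = v
    · subst hwv
      simp
    · simp [hwv, h w (Finset.mem_erase.mpr ⟨hwv, hw⟩)]
  induction φ generalizing e e' with
  | atom P t =>
    have h' : ∀ i, e (t i) = e' (t i) := fun i => h _ (by simp [C2Formula.freeVars])
    simp [C2Formula.Sat, h']
  | equal u v =>
    have hu := h u (by simp [C2Formula.freeVars])
    have hv := h v (by simp [C2Formula.freeVars])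
    simp [C2Formula.Sat, hu, hv]
  | neg φ ih => exact not_congr (ih h)
  | and φ χ ih ih' =>
    exact and_congr (ih fun v hv => h v (Finset.mem_union_left _ hv))
      (ih' fun v hv => h v (Finset.mem_union_right _ hv))
  | or φ χ ih ih' =>
    exact or_congr (ih fun v hv => h v (Finset.mem_union_left _ hv))
      (ih' fun v hv => h v (Finset.mem_union_right _ hv))
  | imp φ χ ih ih' =>
    exact imp_congr (ih fun v hv => h v (Finset.mem_union_left _ hv))
      (ih' fun v hv => h v (Finset.mem_union_right _ hv))
  | iff φ χ ih ih' =>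
    exact iff_congr (ih fun v hv => h v (Finset.mem_union_left _ hv))
      (ih' fun v hv => h v (Finset.mem_union_right _ hv))
  | all v φ ih => exact forall_congr' fun a => ih (upd h _)
  | ex v φ ih => exact exists_congr fun a => ih (upd h _)
  | exCount c k v φ ih =>
    simp only [C2Formula.Sat]
    rw [show {a : Fin n | φ.Sat ω (Function.update e v (some a))} =
      {a : Fin n | φ.Sat ω (Function.update e' v (some a))} from
        Set.ext fun a => ih (upd h _)]

/-! ### Relabelling the domain -/

/-- The permutation of the ground atoms induced by a permutation of the domain. -/
def atomPerm (ar : Fin m → ℕ) (σ : Equiv.Perm (Fin n)) : Equiv.Perm (GroundAtom ar n) where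
  toFun l := ⟨l.1, fun i => σ (l.2 i)⟩
  invFun l := ⟨l.1, fun i => σ.symm (l.2 i)⟩
  left_inv l := by simp
  right_inv l := by simp

/-- The world with the elements of the domain permuted. -/
def relabel (σ : Equiv.Perm (Fin n)) (ω : World ar n) : World ar n :=
  ω.map (atomPerm ar σ).toEmbedding

theorem atomPerm_mem_relabel (σ : Equiv.Perm (Fin n)) (ω : World ar n) (l : GroundAtom ar n) :
    atomPerm ar σ l ∈ relabel σ ω ↔ l ∈ ω := by
  simp [relabel]

theorem mk_mem_relabel (σ : Equiv.Perm (Fin n)) (ω : World ar n) (P : Fin m)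
    (f : Fin (ar P) → Fin n) :
    (⟨P, fun i => σ (f i)⟩ : GroundAtom ar n) ∈ relabel σ ω ↔ ⟨P, f⟩ ∈ ω :=
  atomPerm_mem_relabel σ ω ⟨P, f⟩

/-- Isomorphism invariance; formulas have no constants that could name an element. -/
theorem sat_relabel (σ : Equiv.Perm (Fin n)) (ω : World ar n) (φ : C2Formula ar)
    (e : Fin 2 → Option (Fin n)) :
    φ.Sat (relabel σ ω) (fun v => (e v).map σ) ↔ φ.Sat ω e := by
  have upd : ∀ (e : Fin 2 → Option (Fin n)) (v : Fin 2) (a : Fin n),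
      Function.update (fun v => (e v).map σ) v (some (σ a)) =
        fun w => (Function.update e v (some a) w).map σ := by
    intro e v a
    funext w
    by_cases h : w = v
    · subst h
      simp
    · simp [h]
  induction φ generalizing e with
  | atom P t =>
    simp only [C2Formula.Sat]
    constructor
    · rintro ⟨a, h1, h2⟩
      refine ⟨fun i => σ.symm (a i), fun i => ?_, (mk_mem_relabel σ ω P _).mp (by simpa using h2)⟩
      obtain ⟨b, hb, hb'⟩ := Option.map_eq_some_iff.mp (h1 i)
      simp [hb, ← hb']
    · rintro ⟨a, h1, h2⟩
      exact ⟨fun i => σ (a i), fun i => by rw [h1 i]; rfl, (mk_mem_relabel σ ω P a).mpr h2⟩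
  | equal u v =>
    simp only [C2Formula.Sat, Option.map_eq_some_iff]
    constructor
    · rintro ⟨_, ⟨b, hb, rfl⟩, ⟨c, hc, hcb⟩⟩
      exact ⟨b, hb, by rw [hc, σ.injective hcb]⟩
    · rintro ⟨a, h1, h2⟩
      exact ⟨σ a, ⟨a, h1, rfl⟩, ⟨a, h2, rfl⟩⟩
  | neg φ ih => exact not_congr (ih e)
  | and φ χ ih ih' => exact and_congr (ih e) (ih' e)
  | or φ χ ih ih' => exact or_congr (ih e) (ih' e)
  | imp φ χ ih ih' => exact imp_congr (ih e) (ih' e)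
  | iff φ χ ih ih' => exact iff_congr (ih e) (ih' e)
  | all v φ ih =>
    simp only [C2Formula.Sat]
    rw [← σ.forall_congr_right]
    exact forall_congr' fun a => by rw [upd]; exact ih _
  | ex v φ ih =>
    simp only [C2Formula.Sat]
    rw [← σ.exists_congr_right]
    exact exists_congr fun a => by rw [upd]; exact ih _
  | exCount c k v φ ih =>
    simp only [C2Formula.Sat]
    rw [← Set.ncard_image_of_injective {a : Fin n | φ.Sat ω (Function.update e v (some a))}
      σ.injective]
    rw [show {a : Fin n | φ.Sat (relabel σ ω)
        (Function.update (fun v => (e v).map σ) v (some a))} =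
      σ '' {a : Fin n | φ.Sat ω (Function.update e v (some a))} from Set.ext fun a => ?_]
    obtain ⟨b, rfl⟩ := σ.surjective a
    rw [σ.injective.mem_set_image]
    refine Iff.trans ?_ (ih (Function.update e v (some b)))
    rw [← upd]
    rfl

theorem models_relabel (σ : Equiv.Perm (Fin n)) (ω : World ar n) (ψ : C2Formula ar) :
    ψ.Models (relabel σ ω) ↔ ψ.Models ω := sat_relabel σ ω ψ fun _ => none

theorem rel_relabel (σ : Equiv.Perm (Fin n)) (ω : World ar n) {Q : Fin m} (hQ : ar Q = 2)
    (a b : Fin n) : (relabel σ ω).rel Q hQ (σ a) (σ b) ↔ ω.rel Q hQ a b := by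
  have : (fun i : Fin (ar Q) => ![σ a, σ b] (Fin.cast hQ i)) =
      fun i => σ (![a, b] (Fin.cast hQ i)) := by
    funext i
    generalize Fin.cast hQ i = j
    fin_cases j <;> rfl
  rw [World.rel, World.rel, this]
  exact mk_mem_relabel σ ω Q _

/-- The product of the weights of the atoms. -/
noncomputable def worldWeight (w wbar : Fin m → ℝ) (ω : World ar n) : ℝ :=
  ∏ l : GroundAtom ar n, if l ∈ ω then w l.1 else wbar l.1

theorem prod_mul_prod_compl_eq_worldWeight (w wbar : Fin m → ℝ) (ω : World ar n) :
    (∏ l ∈ ω, w l.1) * ∏ l ∈ ωᶜ, wbar l.1 = worldWeight w wbar ω := by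
  rw [worldWeight, ← Finset.prod_mul_prod_compl ω]
  congr 1
  · exact Finset.prod_congr rfl fun l hl => (if_pos hl).symm
  · exact Finset.prod_congr rfl fun l hl => (if_neg (Finset.mem_compl.mp hl)).symm

theorem worldWeight_relabel (w wbar : Fin m → ℝ) (σ : Equiv.Perm (Fin n)) (ω : World ar n) :
    worldWeight w wbar (relabel σ ω) = worldWeight w wbar ω := by
  rw [worldWeight, ← Equiv.prod_comp (atomPerm ar σ)]
  simp only [atomPerm_mem_relabel]
  rfl

/-! ### Reduction to the standard linear order. -/

/-- Every linear order on a set of `n` elements is isomorphic to the standard one. -/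
theorem IsLinearOrderRel.exists_equiv {α : Type} [Fintype α] (hα : Fintype.card α = n)
    {r : α → α → Prop} (hr : IsLinearOrderRel r) :
    ∃ σ : Fin n ≃ α, ∀ a b, r (σ a) (σ b) ↔ a ≤ b := by
  classical
  let : LinearOrder α :=
    { le := r
      le_refl := hr.refl
      le_trans := hr.trans
      le_antisymm := hr.antisymm
      le_total := hr.total
      toDecidableLE := Classical.decRel _ }
  exact ⟨(Fintype.orderIsoFinOfCardEq α hα).toEquiv,
    fun a b => (Fintype.orderIsoFinOfCardEq α hα).le_iff_le⟩

theorem isImmediatePred_iff {r : Fin n → Fin n → Prop} {σ : Equiv.Perm (Fin n)}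
    (h : ∀ a b, r (σ a) (σ b) ↔ a ≤ b) (a b : Fin n) :
    IsImmediatePred r (σ a) (σ b) ↔ (a : ℕ) + 1 = b := by
  unfold IsImmediatePred
  rw [← σ.exists_congr_right]
  simp only [h, not_le]
  constructor
  · rintro ⟨⟨-, h1⟩, h2⟩
    by_contra h3
    have : (a : ℕ) + 1 < b := by
      have : (a : ℕ) < b := h1
      omega
    refine h2 ⟨⟨a + 1, by omega⟩, ⟨?_, ?_⟩, ?_, ?_⟩ <;>
      simp only [Fin.le_def, Fin.lt_def] <;> omega
  · intro h1
    refine ⟨⟨?_, ?_⟩, ?_⟩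
    · rw [Fin.le_def]; omega
    · rw [Fin.lt_def]; omega
    · rintro ⟨z, ⟨-, h2⟩, -, h3⟩
      rw [Fin.lt_def] at h2 h3
      omega

/-- `ω` is a model of `ψ` in which `le` is the standard order and `pr` its successor relation. -/
structure StdModel (ψ : C2Formula ar) (le pr : Fin m) (hle : ar le = 2) (hpr : ar pr = 2)
    (ω : World ar n) : Prop where
  models : ψ.Models ω
  le_iff : ∀ a b, ω.rel le hle a b ↔ a ≤ b
  pr_iff : ∀ a b : Fin n, ω.rel pr hpr a b ↔ (a : ℕ) + 1 = b

variable {ψ : C2Formula ar} {le pr : Fin m} {hle : ar le = 2} {hpr : ar pr = 2}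

/-- Listing the domain in the order of the model gives the relabelling; immediate predecessors then
become consecutive numbers. -/
theorem modelsLinearPred_iff (ω : World ar n) : ModelsLinearPred ψ le pr hle hpr ω ↔
    ∃ σ ω', StdModel ψ le pr hle hpr ω' ∧ relabel σ ω' = ω := by
  constructor
  · rintro ⟨h1, h2, h3⟩
    obtain ⟨σ, hσ⟩ := h2.exists_equiv (Fintype.card_fin n)
    have hω : relabel σ (relabel σ.symm ω) = ω := by
      ext l
      obtain ⟨l, rfl⟩ := (atomPerm ar σ).surjective l
      rw [atomPerm_mem_relabel]
      obtain ⟨l, rfl⟩ := (atomPerm ar σ.symm).surjective l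
      rw [atomPerm_mem_relabel]
      simp [atomPerm]
    refine ⟨σ, relabel σ.symm ω, ⟨?_, fun a b => ?_, fun a b => ?_⟩, hω⟩
    · rwa [← models_relabel σ, hω]
    · rw [← rel_relabel σ, hω, hσ]
    · rw [← rel_relabel σ, hω, h3, isImmediatePred_iff hσ]
  · rintro ⟨σ, ω', h, rfl⟩
    have hσ : ∀ a b, (relabel σ ω').rel le hle (σ a) (σ b) ↔ a ≤ b := fun a b => by
      rw [rel_relabel, h.le_iff]
    refine ⟨(models_relabel _ _ _).mpr h.models, ⟨?_, ?_, ?_, ?_⟩, ?_⟩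
    · rw [← σ.forall_congr_right]
      exact fun a => (hσ a a).mpr le_rfl
    · intro x y
      obtain ⟨a, rfl⟩ := σ.surjective x
      obtain ⟨b, rfl⟩ := σ.surjective y
      rw [hσ, hσ]
      exact le_total a b
    · intro x y
      obtain ⟨a, rfl⟩ := σ.surjective x
      obtain ⟨b, rfl⟩ := σ.surjective y
      rw [hσ, hσ]
      exact fun h1 h2 => congrArg σ (le_antisymm h1 h2)
    · intro x y z
      obtain ⟨a, rfl⟩ := σ.surjective x
      obtain ⟨b, rfl⟩ := σ.surjective y
      obtain ⟨c, rfl⟩ := σ.surjective z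
      rw [hσ, hσ, hσ]
      exact le_trans
    · intro x y
      obtain ⟨a, rfl⟩ := σ.surjective x
      obtain ⟨b, rfl⟩ := σ.surjective y
      rw [isImmediatePred_iff hσ, rel_relabel, h.pr_iff]

/-- The permutation `σ` followed by the inverse of `σ'` preserves the standard order of `Fin n`,
whose only automorphism is the identity. -/
theorem relabel_injective {σ σ' : Equiv.Perm (Fin n)} {ω ω' : World ar n}
    (h : StdModel ψ le pr hle hpr ω) (h' : StdModel ψ le pr hle hpr ω')
    (he : relabel σ ω = relabel σ' ω') : σ = σ' ∧ ω = ω' := by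
  have h1 : ∀ a b, σ'.symm (σ a) ≤ σ'.symm (σ b) ↔ a ≤ b := by
    intro a b
    rw [← h'.le_iff, ← rel_relabel σ', ← he, Equiv.apply_symm_apply, Equiv.apply_symm_apply,
      rel_relabel, h.le_iff]
  have h2 : (⟨σ.trans σ'.symm, h1 _ _⟩ : Fin n ≃o Fin n) = OrderIso.refl _ :=
    Subsingleton.elim _ _
  have h3 : σ = σ' := Equiv.ext fun a => by
    have := DFunLike.congr_fun h2 a
    exact (Equiv.symm_apply_eq σ').mp this
  subst h3
  exact ⟨rfl, Finset.map_injective _ he⟩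

-- Models correspond bijectively to pairs of a permutation and a standard model, and relabelling
-- preserves weights; the permutations contribute the factor `n!`.
open Classical in
theorem wfomc_eq (w wbar : Fin m → ℝ) :
    WFOMC n (fun ω : World ar n => ModelsLinearPred ψ le pr hle hpr ω) w wbar =
      n.factorial * ∑ ω : World ar n with StdModel ψ le pr hle hpr ω, worldWeight w wbar ω := by
  have h : ∑ ω : World ar n with ModelsLinearPred ψ le pr hle hpr ω, worldWeight w wbar ω =
      ∑ p ∈ (Finset.univ : Finset (Equiv.Perm (Fin n))) ×ˢ
        ({ω : World ar n | StdModel ψ le pr hle hpr ω} : Finset _), worldWeight w wbar p.2 := by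
    symm
    refine Finset.sum_bij (fun p _ => relabel p.1 p.2) ?_ ?_ ?_ ?_
    · intro p hp
      simp only [Finset.mem_product, Finset.mem_filter, Finset.mem_univ, true_and] at hp ⊢
      exact (modelsLinearPred_iff _).mpr ⟨_, _, hp, rfl⟩
    · intro p hp q hq he
      simp only [Finset.mem_product, Finset.mem_filter, Finset.mem_univ, true_and] at hp hq
      obtain ⟨h1, h2⟩ := relabel_injective hp hq he
      exact Prod.ext h1 h2
    · intro ω hω
      simp only [Finset.mem_filter, Finset.mem_univ, true_and] at hω
      obtain ⟨σ, ω', h1, h2⟩ := (modelsLinearPred_iff _).mp hω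
      exact ⟨(σ, ω'), by simpa using h1, h2⟩
    · intro p _
      rw [worldWeight_relabel]
  rw [WFOMC, Finset.sum_congr rfl fun ω _ => prod_mul_prod_compl_eq_worldWeight w wbar ω, h,
    Finset.sum_product]
  dsimp only
  rw [Finset.sum_const, Finset.card_univ, Fintype.card_perm, Fintype.card_fin,
    nsmul_eq_mul]

end relabel

/-! ### Truth values of quantified subformulas -/

section guess
variable {m : ℕ} {ar : Fin m → ℕ}

/-- A counting quantifier together with the variable that it binds and its scope. -/
structure Quant (ar : Fin m → ℕ) where
  var : Fin 2
  cmp : CountCmp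
  bound : ℕ
  body : C2Formula ar

namespace C2Formula

/-- The quantified subformulas of a formula, written with counting quantifiers. -/
def quants : C2Formula ar → List (Quant ar)
  | atom _ _ => []
  | equal _ _ => []
  | neg φ => φ.quants
  | and φ χ => φ.quants ++ χ.quants
  | or φ χ => φ.quants ++ χ.quants
  | imp φ χ => φ.quants ++ χ.quants
  | iff φ χ => φ.quants ++ χ.quants
  | all v φ => ⟨v, .le, 0, neg φ⟩ :: φ.quants
  | ex v φ => ⟨v, .ge, 1, φ⟩ :: φ.quants
  | exCount c k v φ => ⟨v, c, k, φ⟩ :: φ.quants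

/-- The truth value of a formula, given the truth values of the atoms, of the equations and of the
quantified subformulas. -/
def evalWith (A : (P : Fin m) → (Fin (ar P) → Fin 2) → Prop) (E : Fin 2 → Fin 2 → Prop)
    (q : Quant ar → Prop) : C2Formula ar → Prop
  | atom P t => A P t
  | equal u v => E u v
  | neg φ => ¬ φ.evalWith A E q
  | and φ χ => φ.evalWith A E q ∧ χ.evalWith A E q
  | or φ χ => φ.evalWith A E q ∨ χ.evalWith A E q
  | imp φ χ => φ.evalWith A E q → χ.evalWith A E q
  | iff φ χ => (φ.evalWith A E q ↔ χ.evalWith A E q)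
  | all v φ => q ⟨v, .le, 0, neg φ⟩
  | ex v φ => q ⟨v, .ge, 1, φ⟩
  | exCount c k v φ => q ⟨v, c, k, φ⟩

theorem quants_body {φ : C2Formula ar} {Q : Quant ar} (h : Q ∈ φ.quants) :
    Q.body.quants ⊆ φ.quants := by
  induction φ with
  | atom P t => simp [quants] at h
  | equal u v => simp [quants] at h
  | neg φ ih => exact ih h
  | and φ χ ih ih' | or φ χ ih ih' | imp φ χ ih ih' | iff φ χ ih ih' =>
    rcases List.mem_append.mp h with h | h
    · exact List.subset_append_of_subset_left _ (ih h)
    · exact List.subset_append_of_subset_right _ (ih' h)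
  | all v φ ih | ex v φ ih | exCount c k v φ ih =>
    rcases List.mem_cons.mp h with rfl | h
    · exact List.subset_cons_self _ _
    · exact List.subset_cons_of_subset _ (ih h)

end C2Formula

theorem C2Formula.length_quants_body {φ : C2Formula ar} {Q : Quant ar} (h : Q ∈ φ.quants) :
    Q.body.quants.length < φ.quants.length := by
  induction φ with
  | atom P t => simp [quants] at h
  | equal u v => simp [quants] at h
  | neg φ ih => exact ih h
  | and φ χ ih ih' | or φ χ ih ih' | imp φ χ ih ih' | iff φ χ ih ih' =>
    simp only [quants, List.length_append]
    rcases List.mem_append.mp h with h | h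
    · exact (ih h).trans_le (Nat.le_add_right _ _)
    · exact (ih' h).trans_le (Nat.le_add_left _ _)
  | all v φ ih | ex v φ ih | exCount c k v φ ih =>
    simp only [quants, List.length_cons]
    rcases List.mem_cons.mp h with rfl | h
    · exact Nat.lt_succ_self _
    · exact (ih h).trans (Nat.lt_succ_self _)

variable {n : ℕ} (ω : World ar n)

/-- The assignment with the value `b` for `v` and `a` for the other variable. -/
def assign (v : Fin 2) (a b : Fin n) : Fin 2 → Fin n := fun w => if w = v then b else a

/-- The truth value of a quantified formula whose free variable has the value `a`. -/
def Quant.Holds (Q : Quant ar) (a : Fin n) : Prop :=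
  Q.cmp.holds {b : Fin n | Q.body.Sat ω fun w => some (assign Q.var a b w)}.ncard Q.bound

variable {ω}

theorem update_some_eq_assign (e : Fin 2 → Fin n) (v : Fin 2) (b : Fin n) :
    Function.update (fun w => some (e w)) v (some b) =
      fun w => some (assign v (e (1 - v)) b w) := by
  have h : ∀ w v : Fin 2, w ≠ v → w = 1 - v := by decide
  funext w
  by_cases hw : w = v
  · subst hw
    simp [assign]
  · rw [Function.update_of_ne hw, assign, if_neg hw, ← h w v hw]

/-- A universal statement says that at most zero elements are counterexamples. Its value can depend
only on the variable that is not bound, `1 - v`. -/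
theorem sat_all_iff (v : Fin 2) (φ : C2Formula ar) (e : Fin 2 → Fin n) :
    (C2Formula.all v φ).Sat ω (fun w => some (e w)) ↔
      (⟨v, .le, 0, .neg φ⟩ : Quant ar).Holds ω (e (1 - v)) := by
  simp only [C2Formula.Sat, Quant.Holds, update_some_eq_assign, CountCmp.holds]
  rw [Nat.le_zero, Set.ncard_eq_zero (Set.toFinite _), Set.eq_empty_iff_forall_notMem]
  exact forall_congr' fun b => not_not.symm

theorem sat_ex_iff (v : Fin 2) (φ : C2Formula ar) (e : Fin 2 → Fin n) :
    (C2Formula.ex v φ).Sat ω (fun w => some (e w)) ↔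
      (⟨v, .ge, 1, φ⟩ : Quant ar).Holds ω (e (1 - v)) := by
  simp only [C2Formula.Sat, Quant.Holds, update_some_eq_assign, CountCmp.holds]
  rw [Nat.one_le_iff_ne_zero, Ne, Set.ncard_eq_zero (Set.toFinite _), ← Ne,
    ← Set.nonempty_iff_ne_empty]
  rfl

theorem sat_exCount_iff (c : CountCmp) (k : ℕ) (v : Fin 2) (φ : C2Formula ar)
    (e : Fin 2 → Fin n) : (C2Formula.exCount c k v φ).Sat ω (fun w => some (e w)) ↔
      (⟨v, c, k, φ⟩ : Quant ar).Holds ω (e (1 - v)) := by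
  simp only [C2Formula.Sat, Quant.Holds, update_some_eq_assign]

variable (ω) in
/-- The truth value of a formula in a world, where the truth values of the quantified formulas of
the list `L` are guessed. -/
def guessEval (L : List (Quant ar)) (g : Fin n → Fin L.length → Bool) (e : Fin 2 → Fin n)
    (φ : C2Formula ar) : Prop :=
  φ.evalWith (fun P t => (⟨P, fun i => e (t i)⟩ : GroundAtom ar n) ∈ ω) (fun u v => e u = e v)
    fun Q => ∃ i, L.get i = Q ∧ g (e (1 - Q.var)) i = true

variable (ω) in
/-- The guess is confirmed by counting. -/
def ValidGuess (L : List (Quant ar)) (g : Fin n → Fin L.length → Bool) : Prop :=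
  ∀ a i, g a i = true ↔ (L.get i).cmp.holds
    {b : Fin n | guessEval ω L g (assign (L.get i).var a b) (L.get i).body}.ncard (L.get i).bound

/-- The induction is purely propositional: at a quantifier it stops and uses that the guess is right
there. -/
theorem guessEval_iff_sat_of {L : List (Quant ar)} {g : Fin n → Fin L.length → Bool}
    (φ : C2Formula ar) (hφ : φ.quants ⊆ L)
    (hq : ∀ Q ∈ φ.quants, ∀ e : Fin 2 → Fin n, (∃ i, L.get i = Q ∧ g (e (1 - Q.var)) i = true) ↔
      Q.Holds ω (e (1 - Q.var)))
    (e : Fin 2 → Fin n) : guessEval ω L g e φ ↔ φ.Sat ω fun w => some (e w) := by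
  induction φ generalizing e with
  | atom P t =>
    simp only [guessEval, C2Formula.evalWith, C2Formula.Sat, Option.some.injEq]
    constructor
    · exact fun h => ⟨_, fun _ => rfl, h⟩
    · rintro ⟨a, h1, h2⟩
      rwa [funext h1]
  | equal u v =>
    simp only [guessEval, C2Formula.evalWith, C2Formula.Sat, Option.some.injEq]
    exact ⟨fun h => ⟨_, h, rfl⟩, fun ⟨a, h1, h2⟩ => h1.trans h2.symm⟩
  | neg φ ih => exact not_congr (ih hφ hq e)
  | and φ χ ih ih' =>
    have h := List.append_subset.mp hφ
    exact and_congr (ih h.1 (fun Q hQ => hq Q (List.mem_append_left _ hQ)) e)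
      (ih' h.2 (fun Q hQ => hq Q (List.mem_append_right _ hQ)) e)
  | or φ χ ih ih' =>
    have h := List.append_subset.mp hφ
    exact or_congr (ih h.1 (fun Q hQ => hq Q (List.mem_append_left _ hQ)) e)
      (ih' h.2 (fun Q hQ => hq Q (List.mem_append_right _ hQ)) e)
  | imp φ χ ih ih' =>
    have h := List.append_subset.mp hφ
    exact imp_congr (ih h.1 (fun Q hQ => hq Q (List.mem_append_left _ hQ)) e)
      (ih' h.2 (fun Q hQ => hq Q (List.mem_append_right _ hQ)) e)
  | iff φ χ ih ih' =>
    have h := List.append_subset.mp hφ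
    exact iff_congr (ih h.1 (fun Q hQ => hq Q (List.mem_append_left _ hQ)) e)
      (ih' h.2 (fun Q hQ => hq Q (List.mem_append_right _ hQ)) e)
  | all v φ ih => exact (hq _ List.mem_cons_self e).trans (sat_all_iff v φ e).symm
  | ex v φ ih => exact (hq _ List.mem_cons_self e).trans (sat_ex_iff v φ e).symm
  | exCount c k v φ ih => exact (hq _ List.mem_cons_self e).trans (sat_exCount_iff c k v φ e).symm

/-- Induction on the number of quantified subformulas: the scope of a quantifier has fewer of them,
so it is evaluated correctly, and then the confirmation by counting forces the guess for the
quantifier itself to be right. -/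
theorem ValidGuess.guessEval_iff {L : List (Quant ar)} {g : Fin n → Fin L.length → Bool}
    (hg : ValidGuess ω L g) (φ : C2Formula ar) (hφ : φ.quants ⊆ L) (e : Fin 2 → Fin n) :
    guessEval ω L g e φ ↔ φ.Sat ω fun w => some (e w) := by
  have step : ∀ Q ∈ L, (∀ e, guessEval ω L g e Q.body ↔ Q.body.Sat ω fun w => some (e w)) →
      ∀ e : Fin 2 → Fin n, (∃ i, L.get i = Q ∧ g (e (1 - Q.var)) i = true) ↔
        Q.Holds ω (e (1 - Q.var)) := by
    intro Q hQ h e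
    -- The list may contain `Q` several times; a confirmed guess is right at each of its positions.
    have key : ∀ i, L.get i = Q → (g (e (1 - Q.var)) i = true ↔ Q.Holds ω (e (1 - Q.var))) := by
      rintro i rfl
      rw [hg, Quant.Holds]
      simp only [h]
    constructor
    · rintro ⟨i, h1, h2⟩
      exact (key i h1).mp h2
    · intro h2
      obtain ⟨i, hi⟩ := List.mem_iff_get.mp hQ
      exact ⟨i, hi, (key i hi).mpr h2⟩
  induction hl : φ.quants.length using Nat.strong_induction_on generalizing φ e with
  | _ l ih =>
    refine guessEval_iff_sat_of φ hφ (fun Q hQ => step Q (hφ hQ) fun e => ?_) e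
    exact ih _ (hl ▸ C2Formula.length_quants_body hQ) _
      (List.Subset.trans (C2Formula.quants_body hQ) hφ) e rfl

/-- The true truth values. -/
noncomputable def trueGuess (ω : World ar n) (L : List (Quant ar)) : Fin n → Fin L.length → Bool :=
  fun a i => open Classical in decide ((L.get i).Holds ω a)

theorem trueGuess_iff (L : List (Quant ar)) (a : Fin n) (i : Fin L.length) :
    trueGuess ω L a i = true ↔ (L.get i).Holds ω a := by
  simp [trueGuess]

/-- Uniqueness makes the sum over confirmed guesses harmless: each world is counted exactly once. -/
theorem validGuess_iff {L : List (Quant ar)} (hL : ∀ Q ∈ L, Q.body.quants ⊆ L)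
    (g : Fin n → Fin L.length → Bool) : ValidGuess ω L g ↔ g = trueGuess ω L := by
  constructor
  · intro hg
    funext a i
    rw [Bool.eq_iff_iff, hg, trueGuess_iff, Quant.Holds]
    simp only [hg.guessEval_iff _ (hL _ (List.get_mem L i))]
  · rintro rfl a i
    have hi : ∀ e, guessEval ω L (trueGuess ω L) e (L.get i).body ↔ _ :=
      guessEval_iff_sat_of (L.get i).body (hL _ (List.get_mem L i)) (by
      intro Q hQ e
      simp only [trueGuess_iff]
      constructor
      · rintro ⟨i, rfl, h⟩
        exact h
      · intro h
        obtain ⟨j, hj⟩ := List.mem_iff_get.mp (hL _ (List.get_mem L i) hQ)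
        exact ⟨j, hj, hj ▸ h⟩)
    rw [trueGuess_iff, Quant.Holds]
    simp only [hi]

end guess

/-! ### Classification of the ground atoms by the number of elements that occur in them -/

section classification
variable {m : ℕ} (ar : Fin m → ℕ) (n : ℕ)

/-- Nullary predicate symbols. -/
abbrev NullSym : Type := {P : Fin m // ar P = 0}

/-- Predicate symbols that are not nullary; they make one atom from one element. -/
abbrev UnarySym : Type := {P : Fin m // ar P ≠ 0}

/-- The patterns of the atoms with exactly two elements. -/
abbrev PairSym : Type :=
  (P : Fin m) × {f : Fin (ar P) → Fin 2 // (∃ i, f i = 0) ∧ ∃ i, f i = 1}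

/-- The atoms with at least three elements. -/
abbrev WideAtom : Type := {l : GroundAtom ar n // 3 ≤ (Finset.univ.image l.2).card}

/-- Codes for the ground atoms. -/
abbrev AtomCode : Type :=
  NullSym ar ⊕ (Fin n × UnarySym ar) ⊕ ((b : Fin n) × Fin b) × PairSym ar ⊕ WideAtom ar n

variable {ar n}

/-- The smaller element of a pair. -/
def pairLow (p : (b : Fin n) × Fin b) : Fin n := ⟨p.2, p.2.2.trans p.1.2⟩

theorem pairLow_lt (p : (b : Fin n) × Fin b) : pairLow p < p.1 := p.2.2

/-- The ground atom with a given code. -/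
def atomOf : AtomCode ar n → GroundAtom ar n
  | .inl P => ⟨P.1, fun i => (Fin.cast P.2 i).elim0⟩
  | .inr (.inl x) => ⟨x.2.1, fun _ => x.1⟩
  | .inr (.inr (.inl x)) => ⟨x.2.1, fun i => if x.2.2.1 i = 0 then pairLow x.1 else x.1.1⟩
  | .inr (.inr (.inr l)) => l.1

theorem card_image_null (P : NullSym ar) :
    (Finset.univ.image (atomOf (n := n) (.inl P)).2).card = 0 := by
  have : IsEmpty (Fin (ar (atomOf (n := n) (.inl P)).1)) := by
    change IsEmpty (Fin (ar P.1))
    rw [P.2]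
    infer_instance
  rw [Finset.univ_eq_empty, Finset.image_empty, Finset.card_empty]

theorem card_image_unary (x : Fin n × UnarySym ar) :
    (Finset.univ.image (atomOf (.inr (.inl x))).2).card = 1 := by
  have : Nonempty (Fin (ar (atomOf (.inr (.inl x))).1)) := ⟨⟨0, Nat.pos_of_ne_zero x.2.2⟩⟩
  rw [Finset.card_eq_one]
  exact ⟨x.1, Finset.image_const Finset.univ_nonempty _⟩

theorem image_pair (x : ((b : Fin n) × Fin b) × PairSym ar) :
    Finset.univ.image (atomOf (.inr (.inr (.inl x)))).2 = {pairLow x.1, x.1.1} := by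
  obtain ⟨⟨i, hi⟩, j, hj⟩ := x.2.2.2
  ext a
  simp only [Finset.mem_image, Finset.mem_insert, Finset.mem_singleton, atomOf]
  constructor
  · rintro ⟨k, -, rfl⟩
    split_ifs <;> simp
  · rintro (rfl | rfl)
    · exact ⟨i, Finset.mem_univ _, if_pos hi⟩
    · exact ⟨j, Finset.mem_univ _, if_neg (by rw [hj]; decide)⟩

theorem card_image_pair (x : ((b : Fin n) × Fin b) × PairSym ar) :
    (Finset.univ.image (atomOf (.inr (.inr (.inl x)))).2).card = 2 := by
  rw [image_pair, Finset.card_pair (pairLow_lt x.1).ne]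

theorem card_image_wide (l : WideAtom ar n) :
    3 ≤ (Finset.univ.image (atomOf (.inr (.inr (.inr l)))).2).card := l.2

/-- The number of distinct arguments separates the four kinds of code. For two arguments, the set of
arguments together with the order of `Fin n` determines the pair, and then the pattern. -/
theorem atomOf_injective : Function.Injective (atomOf (ar := ar) (n := n)) := by
  intro d d' h
  have hc : (Finset.univ.image (atomOf d).2).card = (Finset.univ.image (atomOf d').2).card := by
    rw [h]
  rcases d with P | x | x | l <;> rcases d' with P' | x' | x' | l'
  · exact congrArg Sum.inl (Subtype.ext (congrArg Sigma.fst h))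
  · rw [card_image_null, card_image_unary] at hc; omega
  · rw [card_image_null, card_image_pair] at hc; omega
  · rw [card_image_null] at hc; have := card_image_wide l'; omega
  · rw [card_image_null, card_image_unary] at hc; omega
  · obtain ⟨a, P, hP⟩ := x
    obtain ⟨a', P', hP'⟩ := x'
    simp only [atomOf, Sigma.mk.injEq] at h
    obtain ⟨rfl, h⟩ := h
    have := congrFun (eq_of_heq h) ⟨0, Nat.pos_of_ne_zero hP⟩
    subst this
    rfl
  · rw [card_image_unary, card_image_pair] at hc; omega
  · rw [card_image_unary] at hc; have := card_image_wide l'; omega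
  · rw [card_image_null, card_image_pair] at hc; omega
  · rw [card_image_unary, card_image_pair] at hc; omega
  · have hi : ({pairLow x.1, x.1.1} : Finset (Fin n)) = {pairLow x'.1, x'.1.1} := by
      rw [← image_pair, ← image_pair, h]
    obtain ⟨p, P, f, hf⟩ := x
    obtain ⟨p', P', f', hf'⟩ := x'
    have hlt := pairLow_lt p
    have hlt' := pairLow_lt p'
    have hl : pairLow p = pairLow p' ∧ p.1 = p'.1 := by
      have h1 : pairLow p ∈ ({pairLow p', p'.1} : Finset (Fin n)) := by rw [← hi]; simp
      have h2 : p.1 ∈ ({pairLow p', p'.1} : Finset (Fin n)) := by rw [← hi]; simp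
      simp only [Finset.mem_insert, Finset.mem_singleton] at h1 h2
      rcases h1 with h1 | h1 <;> rcases h2 with h2 | h2
      · rw [h1, h2] at hlt; exact absurd hlt (lt_irrefl _)
      · exact ⟨h1, h2⟩
      · rw [h1, h2] at hlt; exact absurd (hlt.trans hlt') (lt_irrefl _)
      · rw [h1, h2] at hlt; exact absurd hlt (lt_irrefl _)
    have hp : p = p' := by
      obtain ⟨b, a⟩ := p
      obtain ⟨b', a'⟩ := p'
      obtain ⟨h1, h2⟩ := hl
      simp only at h2
      subst h2
      have : a = a' := Fin.ext (by simpa [pairLow] using h1)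
      rw [this]
    subst hp
    simp only [atomOf, Sigma.mk.injEq] at h
    obtain ⟨rfl, h⟩ := h
    have hff : f = f' := by
      funext i
      have h1 := congrFun (eq_of_heq h) i
      have hne := hlt.ne
      have two : ∀ u v : Fin 2, (u = 0 ↔ v = 0) → u = v := by decide
      refine two _ _ ⟨fun h0 => ?_, fun h0 => ?_⟩
      · by_contra h2
        rw [if_pos h0, if_neg h2] at h1
        exact hne h1
      · by_contra h2
        rw [if_pos h0, if_neg h2] at h1
        exact hne h1.symm
    subst hff
    rfl
  · rw [card_image_pair] at hc; have := card_image_wide l'; omega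
  · rw [card_image_null] at hc; have := card_image_wide l; omega
  · rw [card_image_unary] at hc; have := card_image_wide l; omega
  · rw [card_image_pair] at hc; have := card_image_wide l; omega
  · simp only [atomOf] at h
    rw [Subtype.ext h]

theorem atomOf_surjective : Function.Surjective (atomOf (ar := ar) (n := n)) := by
  rintro ⟨P, f⟩
  by_cases hP : ar P = 0
  · exact ⟨.inl ⟨P, hP⟩, congrArg (Sigma.mk P) (funext fun i => (Fin.cast hP i).elim0)⟩
  by_cases h3 : 3 ≤ (Finset.univ.image f).card
  · exact ⟨.inr (.inr (.inr ⟨⟨P, f⟩, h3⟩)), rfl⟩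
  have hmem : ∀ i, f i ∈ Finset.univ.image f := fun i => Finset.mem_image_of_mem f (Finset.mem_univ i)
  have hpos : 0 < (Finset.univ.image f).card :=
    Finset.card_pos.mpr ⟨_, hmem ⟨0, Nat.pos_of_ne_zero hP⟩⟩
  by_cases h1 : (Finset.univ.image f).card = 1
  · obtain ⟨a, ha⟩ := Finset.card_eq_one.mp h1
    refine ⟨.inr (.inl (a, ⟨P, hP⟩)), congrArg (Sigma.mk P) (funext fun i => ?_)⟩
    have := hmem i
    rw [ha, Finset.mem_singleton] at this
    exact this.symm
  · obtain ⟨x, y, hxy, he⟩ := Finset.card_eq_two.mp (show (Finset.univ.image f).card = 2 by omega)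
    obtain ⟨a, b, hab, he⟩ : ∃ a b : Fin n, a < b ∧ Finset.univ.image f = {a, b} := by
      rcases lt_or_gt_of_ne hxy with h | h
      · exact ⟨x, y, h, he⟩
      · exact ⟨y, x, h, by rw [he, Finset.pair_comm]⟩
    have hval : ∀ i, f i = a ∨ f i = b := fun i => by
      have := hmem i
      rwa [he, Finset.mem_insert, Finset.mem_singleton] at this
    have ha : a ∈ Finset.univ.image f := by rw [he]; simp
    have hb : b ∈ Finset.univ.image f := by rw [he]; simp
    obtain ⟨i, -, hi⟩ := Finset.mem_image.mp ha
    obtain ⟨j, -, hj⟩ := Finset.mem_image.mp hb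
    refine ⟨.inr (.inr (.inl (⟨b, ⟨a, hab⟩⟩, ⟨P, fun k => if f k = a then 0 else 1, ⟨i, ?_⟩, j, ?_⟩))),
      congrArg (Sigma.mk P) (funext fun k => ?_)⟩
    · exact if_pos hi
    · exact if_neg (by rw [hj]; exact hab.ne')
    · by_cases hk : f k = a
      · simp [hk, pairLow]
      · change (if (if f k = a then (0 : Fin 2) else 1) = 0 then _ else _) = f k
        rw [if_neg hk, if_neg (by decide), (hval k).resolve_left hk]

/-- The coding of the ground atoms. -/
noncomputable def atomEquiv (ar : Fin m → ℕ) (n : ℕ) : AtomCode ar n ≃ GroundAtom ar n :=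
  Equiv.ofBijective atomOf ⟨atomOf_injective, atomOf_surjective⟩

theorem prod_atoms {M : Type*} [CommMonoid M] (F : GroundAtom ar n → M) :
    ∏ l, F l = (∏ P : NullSym ar, F (atomOf (.inl P))) *
      ((∏ b : Fin n, ∏ P : UnarySym ar, F (atomOf (.inr (.inl (b, P))))) *
      ((∏ b : Fin n, ∏ a : Fin b, ∏ Q : PairSym ar, F (atomOf (.inr (.inr (.inl (⟨b, a⟩, Q)))))) *
      ∏ l : WideAtom ar n, F l.1)) := by
  rw [← Equiv.prod_comp (atomEquiv ar n), Fintype.prod_sum_type, Fintype.prod_sum_type,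
    Fintype.prod_sum_type, Fintype.prod_prod_type, Fintype.prod_prod_type, Fintype.prod_sigma]
  rfl

theorem sum_atoms {M : Type*} [AddCommMonoid M] (F : GroundAtom ar n → M) :
    ∑ l, F l = (∑ P : NullSym ar, F (atomOf (.inl P))) +
      ((∑ b : Fin n, ∑ P : UnarySym ar, F (atomOf (.inr (.inl (b, P))))) +
      ((∑ b : Fin n, ∑ a : Fin b, ∑ Q : PairSym ar, F (atomOf (.inr (.inr (.inl (⟨b, a⟩, Q)))))) +
      ∑ l : WideAtom ar n, F l.1)) :=
  prod_atoms (M := Multiplicative M) F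

/-- The number of atoms of a predicate with at least three elements. -/
def wideCount (ar : Fin m → ℕ) (P : Fin m) (n : ℕ) : ℕ :=
  ∑ l : WideAtom ar n, if l.1.1 = P then 1 else 0

theorem wideCount_add (P : Fin m) (n : ℕ) :
    (∑ Q : NullSym ar, if Q.1 = P then 1 else 0) + (n * (∑ Q : UnarySym ar, if Q.1 = P then 1 else 0) +
      ((∑ b ∈ Finset.range n, b) * (∑ Q : PairSym ar, if Q.1 = P then 1 else 0) +
        wideCount ar P n)) = n ^ ar P := by
  have h := sum_atoms (ar := ar) (n := n) fun l => if l.1 = P then 1 else 0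
  have h1 : (∑ _b : Fin n, ∑ Q : UnarySym ar, if Q.1 = P then 1 else 0) =
      n * ∑ Q : UnarySym ar, if Q.1 = P then 1 else 0 := by
    rw [Finset.sum_const, Finset.card_univ, Fintype.card_fin, smul_eq_mul]
  have h2 : (∑ b : Fin n, ∑ _a : Fin b, ∑ Q : PairSym ar, if Q.1 = P then 1 else 0) =
      (∑ b ∈ Finset.range n, b) * ∑ Q : PairSym ar, if Q.1 = P then 1 else 0 := by
    simp only [Finset.sum_const, Finset.card_univ, Fintype.card_fin, smul_eq_mul]
    rw [← Finset.sum_mul, Fin.sum_univ_eq_sum_range (fun b => b)]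
  have h3 : (∑ l : GroundAtom ar n, if l.1 = P then 1 else 0) = n ^ ar P := by
    rw [Fintype.sum_sigma, Finset.sum_eq_single P]
    · simp
    · intro Q _ hQ
      simp [hQ]
    · simp
  rw [← h1, ← h2, ← h3]
  exact h.symm

theorem wideCount_two (P : Fin m) : wideCount ar P 2 = 0 := by
  refine Finset.sum_eq_zero fun l _ => ?_
  have h1 := l.2
  have h2 := Finset.card_le_univ (Finset.univ.image l.1.2)
  rw [Fintype.card_fin] at h2
  omega

/-- Of the `n ^ ar P` atoms, those with fewer than three elements number `k₀ + n * k₁ + c * n * (n -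
1) / 2`. As `c` is even, the halving disappears, and the exponent is a difference of sums that loops
can realise. -/
theorem exists_wideCount_eq (P : Fin m) : ∃ k₀ k₁ k₂ : ℕ, ∀ n,
    wideCount ar P n + (k₀ + n * k₁ + n ^ 2 * k₂) = n ^ ar P + n * k₂ := by
  set k₀ := ∑ Q : NullSym ar, if Q.1 = P then 1 else 0 with hk₀
  set k₁ := ∑ Q : UnarySym ar, if Q.1 = P then 1 else 0 with hk₁
  set c := ∑ Q : PairSym ar, if Q.1 = P then 1 else 0 with hc
  have hodd : ∃ k₂, c = 2 * k₂ := by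
    -- A domain of two elements has no wide atoms and a single pair, so the identity reads `k₀ + 2 *
    -- k₁ + c = 2 ^ ar P`, which yields the parity of `c`.
    have h2 := wideCount_add (ar := ar) P 2
    rw [wideCount_two, ← hk₀, ← hk₁, ← hc, Finset.sum_range_succ, Finset.sum_range_one] at h2
    by_cases h : ar P = 0
    · have h1 : 1 ≤ k₀ := by
        have := Finset.single_le_sum (f := fun Q : NullSym ar => if Q.1 = P then 1 else 0)
          (fun _ _ => Nat.zero_le _) (Finset.mem_univ ⟨P, h⟩)
        rwa [if_pos rfl] at this
      rw [h, pow_zero] at h2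
      exact ⟨0, by omega⟩
    · have h1 : k₀ = 0 := Finset.sum_eq_zero fun Q _ => if_neg fun hQ => h (by rw [← hQ]; exact Q.2)
      obtain ⟨d, hd⟩ : ∃ d, ar P = d + 1 := ⟨ar P - 1, by omega⟩
      rw [hd, pow_succ] at h2
      exact ⟨2 ^ d - k₁, by omega⟩
  obtain ⟨k₂, hk₂⟩ := hodd
  refine ⟨k₀, k₁, k₂, fun n => ?_⟩
  have h := wideCount_add (ar := ar) P n
  rw [← hk₀, ← hk₁, ← hc, hk₂] at h
  have hs := Finset.sum_range_id_mul_two n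
  have hs' : (∑ b ∈ Finset.range n, b) * 2 + n = n ^ 2 := by
    rw [hs]
    cases n with
    | zero => rfl
    | succ n => rw [Nat.add_sub_cancel]; ring
  rw [← h, ← hs']
  ring

theorem prod_wideAtom (x : Fin m → ℝ) (n : ℕ) :
    ∏ l : WideAtom ar n, x l.1.1 = ∏ P, x P ^ wideCount ar P n := by
  simp only [wideCount, ← Finset.prod_pow_eq_pow_sum]
  rw [Finset.prod_comm]
  refine Finset.prod_congr rfl fun l _ => ?_
  rw [Finset.prod_eq_single l.1.1] <;> simp +contextual [eq_comm]

end classification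

/-! ### Worlds as configurations -/

theorem Fin.sum_univ_split {n : ℕ} (F : Fin n → ℕ) (a : Fin n) :
    ∑ b, F b = F a + ((∑ b, if a < b then F b else 0) +
      ∑ a' : Fin a, F ⟨a', a'.2.trans a.2⟩) := by
  have h1 : ∑ a' : Fin a, F ⟨a', a'.2.trans a.2⟩ = ∑ b, if b < a then F b else 0 := by
    rw [← Finset.sum_filter]
    refine Finset.sum_bij (fun a' _ => ⟨a', a'.2.trans a.2⟩) ?_ ?_ ?_ ?_
    · exact fun a' _ => Finset.mem_filter.mpr ⟨Finset.mem_univ _, a'.2⟩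
    · exact fun a' _ a'' _ h => Fin.ext (Fin.mk.inj_iff.mp h)
    · exact fun b hb => ⟨⟨b, (Finset.mem_filter.mp hb).2⟩, Finset.mem_univ _, rfl⟩
    · exact fun _ _ => rfl
  have h2 : F a = ∑ b, if b = a then F b else 0 := by simp
  rw [h1, h2, ← Finset.sum_add_distrib, ← Finset.sum_add_distrib]
  refine Finset.sum_congr rfl fun b _ => ?_
  rcases lt_trichotomy a b with h | rfl | h
  · simp [h, h.ne', h.not_gt]
  · simp
  · simp [h, h.ne, h.not_gt]

section configuration
variable {m : ℕ} {ar : Fin m → ℕ} {n : ℕ}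

/-- The type of an element: the truth values of its unary atoms and of the quantified formulas. -/
abbrev ElemType (L : List (Quant ar)) : Type := (UnarySym ar → Bool) × (Fin L.length → Bool)

/-- The truth values of the atoms with exactly two given elements. -/
abbrev EdgeType (ar : Fin m → ℕ) : Type := PairSym ar → Bool

variable {L : List (Quant ar)}

/-- The truth values of the coded atoms in a configuration. -/
def codeBits (ν : NullSym ar → Bool) (c : PairSystem.Config (ElemType L) (EdgeType ar) n)
    (ρ : WideAtom ar n → Bool) : AtomCode ar n → Bool
  | .inl P => ν P
  | .inr (.inl x) => (c x.1).1.1 x.2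
  | .inr (.inr (.inl x)) => (c x.1.1).2 x.1.2 x.2
  | .inr (.inr (.inr l)) => ρ l

/-- The world of a configuration. -/
noncomputable def configWorld (ν : NullSym ar → Bool)
    (c : PairSystem.Config (ElemType L) (EdgeType ar) n) (ρ : WideAtom ar n → Bool) : World ar n :=
  Finset.univ.filter fun l => codeBits ν c ρ ((atomEquiv ar n).symm l) = true

theorem atomOf_mem_configWorld {ν : NullSym ar → Bool}
    {c : PairSystem.Config (ElemType L) (EdgeType ar) n} {ρ : WideAtom ar n → Bool}
    (d : AtomCode ar n) : atomOf d ∈ configWorld ν c ρ ↔ codeBits ν c ρ d = true := by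
  have h : (atomEquiv ar n).symm (atomOf d) = d := (atomEquiv ar n).symm_apply_apply d
  rw [configWorld, Finset.mem_filter, h]
  exact and_iff_right (Finset.mem_univ _)

/-- Worlds with guessed truth values, as configurations. -/
noncomputable def configEquiv (L : List (Quant ar)) (n : ℕ) :
    ((NullSym ar → Bool) × PairSystem.Config (ElemType L) (EdgeType ar) n × (WideAtom ar n → Bool)) ≃
      World ar n × (Fin n → Fin L.length → Bool) where
  toFun x := (configWorld x.1 x.2.1 x.2.2, fun a => (x.2.1 a).1.2)
  invFun y := (fun P => decide (atomOf (.inl P) ∈ y.1),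
    fun b => ((fun P => decide (atomOf (.inr (.inl (b, P))) ∈ y.1), y.2 b),
      fun a Q => decide (atomOf (.inr (.inr (.inl (⟨b, a⟩, Q)))) ∈ y.1)),
    fun l => decide (atomOf (.inr (.inr (.inr l))) ∈ y.1))
  left_inv := by
    rintro ⟨ν, c, ρ⟩
    simp only [atomOf_mem_configWorld, Bool.decide_eq_true]
    rfl
  right_inv := by
    rintro ⟨ω, g⟩
    refine Prod.ext (Finset.ext fun l => ?_) rfl
    obtain ⟨d, rfl⟩ := atomOf_surjective l
    rw [atomOf_mem_configWorld]
    rcases d with P | x | x | l <;> exact decide_eq_true_iff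

/-- The truth value of an atom with at most two elements. -/
def look (ν : NullSym ar → Bool) (u u' : UnarySym ar → Bool) (t : EdgeType ar) (P : Fin m)
    (f : Fin (ar P) → Fin 2) : Bool :=
  if h : ar P = 0 then ν ⟨P, h⟩
  else if h0 : ∀ i, f i = 0 then u ⟨P, h⟩
  else if h1 : ∀ i, f i = 1 then u' ⟨P, h⟩
  else t ⟨P, f, by
    have two : ∀ v : Fin 2, v ≠ 0 → v = 1 := by decide
    have two' : ∀ v : Fin 2, v ≠ 1 → v = 0 := by decide
    exact ⟨(not_forall.mp h1).imp fun _ => two' _, (not_forall.mp h0).imp fun _ => two _⟩⟩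

variable {ν : NullSym ar → Bool} {c : PairSystem.Config (ElemType L) (EdgeType ar) n}
  {ρ : WideAtom ar n → Bool}

theorem pair_mem_configWorld {a b : Fin n} (hab : a < b) (P : Fin m) (f : Fin (ar P) → Fin 2) :
    (⟨P, fun i => if f i = 0 then a else b⟩ : GroundAtom ar n) ∈ configWorld ν c ρ ↔
      look ν (c a).1.1 (c b).1.1 ((c b).2 ⟨a, hab⟩) P f = true := by
  unfold look
  split_ifs with h h0 h1
  · rw [← show codeBits ν c ρ (.inl ⟨P, h⟩) = ν ⟨P, h⟩ from rfl, ← atomOf_mem_configWorld]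
    refine iff_of_eq (congrArg (· ∈ _) (congrArg (Sigma.mk P) (funext fun i => ?_)))
    exact (Fin.cast h i).elim0
  · rw [← show codeBits ν c ρ (.inr (.inl (a, ⟨P, h⟩))) = (c a).1.1 ⟨P, h⟩ from rfl,
      ← atomOf_mem_configWorld]
    simp only [h0, if_true]
    rfl
  · rw [← show codeBits ν c ρ (.inr (.inl (b, ⟨P, h⟩))) = (c b).1.1 ⟨P, h⟩ from rfl,
      ← atomOf_mem_configWorld]
    simp only [h1, one_ne_zero, if_false]
    rfl
  · exact atomOf_mem_configWorld (.inr (.inr (.inl (⟨b, ⟨a, hab⟩⟩, ⟨P, f, _⟩))))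

theorem diag_mem_configWorld (a : Fin n) (u' : UnarySym ar → Bool) (t : EdgeType ar) (P : Fin m) :
    (⟨P, fun _ => a⟩ : GroundAtom ar n) ∈ configWorld ν c ρ ↔
      look ν (c a).1.1 u' t P (fun _ => 0) = true := by
  unfold look
  split_ifs with h h0
  · rw [← show codeBits ν c ρ (.inl ⟨P, h⟩) = ν ⟨P, h⟩ from rfl, ← atomOf_mem_configWorld]
    refine iff_of_eq (congrArg (· ∈ _) (congrArg (Sigma.mk P) (funext fun i => ?_)))
    exact (Fin.cast h i).elim0
  · exact atomOf_mem_configWorld (.inr (.inl (a, ⟨P, h⟩)))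
  · exact absurd (fun _ => rfl) h0
  · exact absurd (fun _ => rfl) h0

/-- The truth value of a formula for two elements with given types, where `s` says which of them
is the value of which variable. -/
def pairEval (ν : NullSym ar → Bool) (τ τ' : ElemType L) (t : EdgeType ar) (s : Fin 2 → Fin 2)
    (φ : C2Formula ar) : Prop :=
  φ.evalWith (fun P q => look ν τ.1 τ'.1 t P (fun i => s (q i)) = true) (fun u v => s u = s v)
    fun Q => ∃ i, L.get i = Q ∧ (if s (1 - Q.var) = 0 then τ else τ').2 i = true

/-- Once the quantified parts are guessed, only atoms over `a` and `b` are consulted; the wide atoms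
`ρ` do not enter. -/
theorem guessEval_pair {a b : Fin n} (hab : a < b) (s : Fin 2 → Fin 2) (φ : C2Formula ar) :
    guessEval (configWorld ν c ρ) L (fun a => (c a).1.2) (fun w => if s w = 0 then a else b) φ ↔
      pairEval ν (c a).1 (c b).1 ((c b).2 ⟨a, hab⟩) s φ := by
  have two : ∀ u v : Fin 2, u ≠ 0 → v ≠ 0 → u = v := by decide
  have h2 : ∀ u v, ((if s u = 0 then a else b) = if s v = 0 then a else b) = (s u = s v) := by
    intro u v
    by_cases hu : s u = 0 <;> by_cases hv : s v = 0
    · simp [hu, hv]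
    · simp [hu, hv, hab.ne, eq_comm]
    · simp [hu, hv, hab.ne']
    · simp [two _ _ hu hv]
  have h3 : ∀ (i : Fin L.length) (x : Fin 2), (c (if x = 0 then a else b)).1.2 i =
      (if x = 0 then (c a).1 else (c b).1).2 i := by
    intro i x
    split_ifs with hx
    · exact congrArg (fun d => (c d).1.2 i) (if_pos hx)
    · exact congrArg (fun d => (c d).1.2 i) (if_neg hx)
  simp only [guessEval, pairEval, pair_mem_configWorld hab, h2, h3]

/-- When both variables denote `a`, the edge is never consulted, so a constant edge serves as a
placeholder. -/
theorem guessEval_diag (a : Fin n) (φ : C2Formula ar) :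
    guessEval (configWorld ν c ρ) L (fun a => (c a).1.2) (fun _ => a) φ ↔
      pairEval ν (c a).1 (c a).1 (fun _ => false) (fun _ => 0) φ := by
  simp only [guessEval, pairEval, diag_mem_configWorld a (c a).1.1 fun _ => false, if_true]

end configuration

/-! ### The model count as a sum over configurations -/

section system
variable {m : ℕ} {ar : Fin m → ℕ} {n : ℕ}

/-- The condition on the unary atoms imposed by the linear order. -/
def DiagOK (le pr : Fin m) (ν : NullSym ar → Bool) (u : UnarySym ar → Bool) : Prop :=
  look ν u u (fun _ => false) le (fun _ => 0) = true ∧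
    ¬ look ν u u (fun _ => false) pr (fun _ => 0) = true

/-- The condition on the atoms with two elements imposed by the linear order; `s` says whether
the elements are consecutive. -/
def PairOK (le pr : Fin m) (hle : ar le = 2) (hpr : ar pr = 2) (ν : NullSym ar → Bool)
    (u u' : UnarySym ar → Bool) (t : EdgeType ar) (s : Bool) : Prop :=
  look ν u u' t le (fun i => Fin.cast hle i) = true ∧
    ¬ look ν u u' t le (fun i => 1 - Fin.cast hle i) = true ∧
    (look ν u u' t pr (fun i => Fin.cast hpr i) = true ↔ s = true) ∧
    ¬ look ν u u' t pr (fun i => 1 - Fin.cast hpr i) = true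

section rel
variable {L : List (Quant ar)} {ν : NullSym ar → Bool}
  {c : PairSystem.Config (ElemType L) (EdgeType ar) n} {ρ : WideAtom ar n → Bool}

theorem rel_diag {Q : Fin m} (hQ : ar Q = 2) (a : Fin n) :
    (configWorld ν c ρ).rel Q hQ a a ↔
      look ν (c a).1.1 (c a).1.1 (fun _ => false) Q (fun _ => 0) = true := by
  rw [← diag_mem_configWorld (ρ := ρ), World.rel]
  have h : ∀ j : Fin 2, ![a, a] j = a := by
    intro j
    fin_cases j <;> rfl
  simp only [h]

theorem rel_lt {Q : Fin m} (hQ : ar Q = 2) {a b : Fin n} (hab : a < b) :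
    (configWorld ν c ρ).rel Q hQ a b ↔
      look ν (c a).1.1 (c b).1.1 ((c b).2 ⟨a, hab⟩) Q (fun i => Fin.cast hQ i) = true := by
  rw [← pair_mem_configWorld (ρ := ρ) hab, World.rel]
  have h : ∀ j : Fin 2, ![a, b] j = if j = 0 then a else b := by
    intro j
    fin_cases j <;> rfl
  simp only [h]

theorem rel_gt {Q : Fin m} (hQ : ar Q = 2) {a b : Fin n} (hab : a < b) :
    (configWorld ν c ρ).rel Q hQ b a ↔
      look ν (c a).1.1 (c b).1.1 ((c b).2 ⟨a, hab⟩) Q (fun i => 1 - Fin.cast hQ i) = true := by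
  rw [← pair_mem_configWorld (ρ := ρ) hab, World.rel]
  have h : ∀ j : Fin 2, ![b, a] j = if 1 - j = 0 then a else b := by
    intro j
    fin_cases j <;> rfl
  simp only [h]

/-- For the standard order the axioms become separate conditions on single elements and on pairs;
the only positional information needed is whether a pair is consecutive. -/
theorem forall_rel_iff (le pr : Fin m) (hle : ar le = 2) (hpr : ar pr = 2) :
    ((∀ a b, (configWorld ν c ρ).rel le hle a b ↔ a ≤ b) ∧
      ∀ a b : Fin n, (configWorld ν c ρ).rel pr hpr a b ↔ (a : ℕ) + 1 = b) ↔
    ∀ b : Fin n, DiagOK le pr ν (c b).1.1 ∧ ∀ a : Fin b, PairOK le pr hle hpr ν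
      (c ⟨a, a.2.trans b.2⟩).1.1 (c b).1.1 ((c b).2 a) (decide ((a : ℕ) + 1 = b)) := by
  constructor
  · rintro ⟨h1, h2⟩ b
    refine ⟨⟨?_, ?_⟩, fun a => ?_⟩
    · rw [← rel_diag (ρ := ρ) hle, h1]
    · rw [← rel_diag (ρ := ρ) hpr, h2]
      omega
    · have hab : (⟨a, a.2.trans b.2⟩ : Fin n) < b := a.2
      refine ⟨?_, ?_, ?_, ?_⟩
      · exact (rel_lt (ρ := ρ) hle hab).mp ((h1 _ _).mpr hab.le)
      · exact fun h => hab.not_ge ((h1 _ _).mp ((rel_gt (ρ := ρ) hle hab).mpr h))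
      · rw [decide_eq_true_iff]
        exact (rel_lt (ρ := ρ) hpr hab).symm.trans (h2 _ _)
      · intro h
        have h3 := (h2 _ _).mp ((rel_gt (ρ := ρ) hpr hab).mpr h)
        have h4 := a.2
        simp only at h3
        omega
  · intro h
    constructor
    · intro a b
      rcases lt_trichotomy a b with hab | rfl | hab
      · exact iff_of_true ((rel_lt hle hab).mpr ((h b).2 ⟨a, hab⟩).1) hab.le
      · exact iff_of_true ((rel_diag hle a).mpr (h a).1.1) le_rfl
      · exact iff_of_false (fun h' => ((h a).2 ⟨b, hab⟩).2.1 ((rel_gt hle hab).mp h')) hab.not_ge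
    · intro a b
      rcases lt_trichotomy a b with hab | rfl | hab
      · exact (rel_lt hpr hab).trans (((h b).2 ⟨a, hab⟩).2.2.1.trans decide_eq_true_iff)
      · exact iff_of_false (fun h' => (h a).1.2 ((rel_diag hpr a).mp h')) (by omega)
      · refine iff_of_false (fun h' => ((h a).2 ⟨b, hab⟩).2.2.2 ((rel_gt hpr hab).mp h')) ?_
        have : (b : ℕ) < a := hab
        omega

end rel

open Classical in
/-- The system of the types of elements and pairs for the quantified formulas in `L`. -/
noncomputable def typeSystem (L : List (Quant ar)) (le pr : Fin m) (hle : ar le = 2)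
    (hpr : ar pr = 2) (ν : NullSym ar → Bool) :
    PairSystem m (ElemType L) (Fin L.length) (EdgeType ar) where
  -- The cap exceeds every threshold, so truncated counts decide all comparisons.
  cap := ∑ i, (L.get i).bound + 1
  unary τ I := if DiagOK le pr ν τ.1 then
    ∏ P : UnarySym ar, if τ.1 P = true then I.pos P else I.neg P else 0
  pair τ τ' t s I := if PairOK le pr hle hpr ν τ.1 τ'.1 t s then
    ∏ Q : PairSym ar, if t Q = true then I.pos Q.1 else I.neg Q.1 else 0
  -- For the count at the lower element, the bound variable denotes the upper one (index `1`); for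
  -- `upper` the roles are exchanged.
  lower τ τ' t i := if pairEval ν τ τ' t (fun w => if w = (L.get i).var then 1 else 0)
    (L.get i).body then 1 else 0
  upper τ τ' t i := if pairEval ν τ τ' t (fun w => if w = (L.get i).var then 0 else 1)
    (L.get i).body then 1 else 0

variable {L : List (Quant ar)} {le pr : Fin m} {hle : ar le = 2} {hpr : ar pr = 2}
  {ν : NullSym ar → Bool}

open Classical in
/-- The guessed truth values at an element with the given state are correct, and `ψ` holds. -/
def GoodState (ψ : C2Formula ar) (s : (typeSystem L le pr hle hpr ν).St) : Prop :=
  (∀ i, s.1.2 i = true ↔ (L.get i).cmp.holds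
    ((if pairEval ν s.1 s.1 (fun _ => false) (fun _ => 0) (L.get i).body then 1 else 0) +
      s.2.1 i) (L.get i).bound) ∧
  pairEval ν s.1 s.1 (fun _ => false) (fun _ => 0) ψ

theorem CountCmp.holds_add_min {k K : ℕ} (h : k < K) (r : CountCmp) (d e : ℕ) :
    r.holds (d + min e K) k ↔ r.holds (d + e) k := by
  cases r <;> simp only [CountCmp.holds] <;> omega

variable {c : PairSystem.Config (ElemType L) (EdgeType ar) n} {ρ : WideAtom ar n → Bool}

-- The witnesses are split into `a` itself, those above `a` and those below. A pair system counts
-- only the last two kinds, hence the separate diagonal term.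
open Classical in
theorem ncard_guessEval (a : Fin n) (i : Fin L.length) :
    {b : Fin n | guessEval (configWorld ν c ρ) L (fun a => (c a).1.2)
      (assign (L.get i).var a b) (L.get i).body}.ncard =
    (if pairEval ν (c a).1 (c a).1 (fun _ => false) (fun _ => 0) (L.get i).body then 1 else 0) +
      (typeSystem L le pr hle hpr ν).count c a i := by
  have h1 : ∀ b (hab : a < b), guessEval (configWorld ν c ρ) L (fun a => (c a).1.2)
      (assign (L.get i).var a b) (L.get i).body ↔ pairEval ν (c a).1 (c b).1 ((c b).2 ⟨a, hab⟩)
        (fun w => if w = (L.get i).var then 1 else 0) (L.get i).body := by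
    intro b hab
    rw [← guessEval_pair (ρ := ρ) hab]
    refine iff_of_eq (congrArg (guessEval _ _ _ · _) (funext fun w => ?_))
    by_cases hw : w = (L.get i).var <;> simp [assign, hw]
  have h2 : ∀ b (hab : b < a), guessEval (configWorld ν c ρ) L (fun a => (c a).1.2)
      (assign (L.get i).var a b) (L.get i).body ↔ pairEval ν (c b).1 (c a).1 ((c a).2 ⟨b, hab⟩)
        (fun w => if w = (L.get i).var then 0 else 1) (L.get i).body := by
    intro b hab
    rw [← guessEval_pair (ρ := ρ) hab]
    refine iff_of_eq (congrArg (guessEval _ _ _ · _) (funext fun w => ?_))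
    by_cases hw : w = (L.get i).var <;> simp [assign, hw]
  have h3 : guessEval (configWorld ν c ρ) L (fun a => (c a).1.2)
      (assign (L.get i).var a a) (L.get i).body ↔
        pairEval ν (c a).1 (c a).1 (fun _ => false) (fun _ => 0) (L.get i).body := by
    rw [← guessEval_diag (ρ := ρ)]
    refine iff_of_eq (congrArg (guessEval _ _ _ · _) (funext fun w => ?_))
    simp [assign]
  rw [Set.ncard_eq_toFinset_card', Set.toFinset_ofPred, Finset.card_filter, Fin.sum_univ_split _ a,
    PairSystem.count]
  refine congrArg₂ _ (if_congr h3 rfl rfl) (congrArg₂ _ (Finset.sum_congr rfl fun b _ => ?_)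
    (Finset.sum_congr rfl fun a' _ => if_congr (h2 _ a'.2) rfl rfl))
  by_cases hab : a < b
  · rw [if_pos hab, dif_pos hab]
    exact if_congr (h1 b hab) rfl rfl
  · rw [if_neg hab, dif_neg hab]

theorem forall_goodState_iff (ψ : C2Formula ar) :
    (∀ a, GoodState ψ ((typeSystem L le pr hle hpr ν).state c a)) ↔
      ValidGuess (configWorld ν c ρ) L (fun a => (c a).1.2) ∧
      ∀ a, guessEval (configWorld ν c ρ) L (fun a => (c a).1.2) (fun _ => a) ψ := by
  rw [ValidGuess, ← forall_and]
  refine forall_congr' fun a => and_congr (forall_congr' fun i => iff_congr Iff.rfl ?_)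
    (guessEval_diag a ψ).symm
  rw [ncard_guessEval (le := le) (pr := pr) (hle := hle) (hpr := hpr)]
  refine CountCmp.holds_add_min (Nat.lt_succ_of_le ?_) _ _ _
  exact Finset.single_le_sum (f := fun i => (L.get i).bound) (fun _ _ => Nat.zero_le _)
    (Finset.mem_univ i)

/-- A sentence has the same value at every element, so its truth can be imposed element by element.
On the empty domain this condition would be vacuous; hence `0 < n`. -/
theorem models_iff_forall_guessEval {ψ : C2Formula ar} (hψ : ψ.IsSentence) (hL : ψ.quants ⊆ L)
    (hn : 0 < n) {ω : World ar n} {g : Fin n → Fin L.length → Bool} (hg : ValidGuess ω L g) :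
    ψ.Models ω ↔ ∀ a, guessEval ω L g (fun _ => a) ψ := by
  have h : ∀ a, guessEval ω L g (fun _ => a) ψ ↔ ψ.Models ω := fun a => by
    rw [hg.guessEval_iff ψ hL]
    refine C2Formula.Sat.congr ω ψ fun v hv => ?_
    rw [hψ] at hv
    simp at hv
  simp only [h]
  exact ⟨fun h' _ => h', fun h' => h' ⟨0, hn⟩⟩

open Classical in
theorem weight_typeSystem (I : CountingInput m) :
    (typeSystem L le pr hle hpr ν).weight I c =
      if (∀ a b, (configWorld ν c ρ).rel le hle a b ↔ a ≤ b) ∧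
        (∀ a b : Fin n, (configWorld ν c ρ).rel pr hpr a b ↔ (a : ℕ) + 1 = b) then
      ∏ b : Fin n, ((∏ P : UnarySym ar, if (c b).1.1 P = true then I.pos P else I.neg P) *
        ∏ a : Fin b, ∏ Q : PairSym ar, if (c b).2 a Q = true then I.pos Q.1 else I.neg Q.1)
      else 0 := by
  have h : ∀ b : Fin n, (typeSystem L le pr hle hpr ν).unary (c b).1 I * (∏ a : Fin b,
      (typeSystem L le pr hle hpr ν).pair (c ⟨a, a.2.trans b.2⟩).1 (c b).1 ((c b).2 a)
        (decide ((a : ℕ) + 1 = b)) I) =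
      if DiagOK le pr ν (c b).1.1 ∧ ∀ a : Fin b, PairOK le pr hle hpr ν
        (c ⟨a, a.2.trans b.2⟩).1.1 (c b).1.1 ((c b).2 a) (decide ((a : ℕ) + 1 = b)) then
      (∏ P : UnarySym ar, if (c b).1.1 P = true then I.pos P else I.neg P) *
        ∏ a : Fin b, ∏ Q : PairSym ar, if (c b).2 a Q = true then I.pos Q.1 else I.neg Q.1
      else 0 := by
    intro b
    simp only [typeSystem]
    rw [Finset.prod_ite_zero, ite_zero_mul_ite_zero]
    simp only [Finset.mem_univ, true_imp_iff]
  rw [PairSystem.weight, Finset.prod_congr rfl fun b _ => h b, Finset.prod_ite_zero]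
  simp only [Finset.mem_univ, true_imp_iff]
  exact if_congr (forall_rel_iff (ρ := ρ) le pr hle hpr).symm rfl rfl

/-- The weight of the nullary atoms. -/
noncomputable def nullWeight (ν : NullSym ar → Bool) (I : CountingInput m) : ℝ :=
  ∏ P : NullSym ar, if ν P = true then I.pos P else I.neg P

theorem worldWeight_configWorld (I : CountingInput m) :
    worldWeight I.pos I.neg (configWorld ν c ρ) = nullWeight ν I *
      ((∏ b : Fin n, ((∏ P : UnarySym ar, if (c b).1.1 P = true then I.pos P else I.neg P) *
        ∏ a : Fin b, ∏ Q : PairSym ar, if (c b).2 a Q = true then I.pos Q.1 else I.neg Q.1)) *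
      ∏ l : WideAtom ar n, if ρ l = true then I.pos l.1.1 else I.neg l.1.1) := by
  have h : ∀ l : WideAtom ar n, l.1 ∈ configWorld ν c ρ ↔ ρ l = true := fun l =>
    atomOf_mem_configWorld (.inr (.inr (.inr l)))
  rw [worldWeight, prod_atoms]
  simp only [atomOf_mem_configWorld, h]
  rw [Finset.prod_mul_distrib, mul_assoc]
  rfl

-- The conditions on a world and its guess involve only `ν` and `c`, so the factor of the wide atoms
-- splits off.
open Classical in
theorem term_configWorld {ψ : C2Formula ar} (hψ : ψ.IsSentence) (hL : ψ.quants ⊆ L)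
    (hn : 0 < n) (I : CountingInput m) :
    (if StdModel ψ le pr hle hpr (configWorld ν c ρ) ∧
        ValidGuess (configWorld ν c ρ) L (fun a => (c a).1.2) then
      worldWeight I.pos I.neg (configWorld ν c ρ) else 0) =
    nullWeight ν I * ((typeSystem L le pr hle hpr ν).weight I c *
      ∏ a, if GoodState ψ ((typeSystem L le pr hle hpr ν).state c a) then 1 else 0) *
      ∏ l : WideAtom ar n, if ρ l = true then I.pos l.1.1 else I.neg l.1.1 := by
  rw [Finset.prod_ite_zero, weight_typeSystem (ρ := ρ), ite_zero_mul_ite_zero,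
    worldWeight_configWorld]
  simp only [Finset.mem_univ, true_imp_iff, Finset.prod_const_one, mul_one]
  rw [mul_ite, ite_mul, mul_zero, zero_mul, mul_assoc]
  refine if_congr ?_ rfl rfl
  rw [forall_goodState_iff (ρ := ρ)]
  constructor
  · rintro ⟨⟨h1, h2, h3⟩, h4⟩
    exact ⟨⟨h2, h3⟩, h4, (models_iff_forall_guessEval hψ hL hn h4).mp h1⟩
  · rintro ⟨⟨h2, h3⟩, h4, h5⟩
    exact ⟨⟨(models_iff_forall_guessEval hψ hL hn h4).mpr h5, h2, h3⟩, h4⟩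

/-- Unconstrained atoms: each is chosen true or false independently, giving a factor `x + y`. -/
theorem sum_prod_wideAtom (x y : Fin m → ℝ) (n : ℕ) :
    ∑ ρ : WideAtom ar n → Bool, ∏ l, (if ρ l = true then x l.1.1 else y l.1.1) =
      ∏ P, (x P + y P) ^ wideCount ar P n := by
  rw [← prod_wideAtom (fun P => x P + y P)]
  have h := Finset.prod_univ_sum (fun _ : WideAtom ar n => (Finset.univ : Finset Bool))
    fun l b => if b = true then x l.1.1 else y l.1.1
  rw [Fintype.piFinset_univ] at h
  rw [← h]
  simp

-- A sum over guesses is inserted, of which exactly one is confirmed; worlds with guesses are then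
-- reindexed as configurations, and the wide atoms are summed out.
open Classical in
theorem sum_stdModel {ψ : C2Formula ar} (hψ : ψ.IsSentence) (I : CountingInput m)
    (hn : 0 < I.size) :
    ∑ ω : World ar I.size with StdModel ψ le pr hle hpr ω, worldWeight I.pos I.neg ω =
      (∑ ν, nullWeight ν I * ∑ c : PairSystem.Config (ElemType ψ.quants) (EdgeType ar) I.size,
        (typeSystem ψ.quants le pr hle hpr ν).weight I c *
          ∏ a, if GoodState ψ ((typeSystem ψ.quants le pr hle hpr ν).state c a) then 1 else 0) *
      ∏ P, (I.pos P + I.neg P) ^ wideCount ar P I.size := by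
  have h1 : ∀ ω : World ar I.size, (if StdModel ψ le pr hle hpr ω then
      worldWeight I.pos I.neg ω else 0) = ∑ g : Fin I.size → Fin ψ.quants.length → Bool,
        if StdModel ψ le pr hle hpr ω ∧ ValidGuess ω ψ.quants g then
          worldWeight I.pos I.neg ω else 0 := by
    intro ω
    simp only [validGuess_iff fun Q hQ => C2Formula.quants_body hQ, ite_and]
    split_ifs <;> simp
  let _ : Fintype (PairSystem.Config (ElemType ψ.quants) (EdgeType ar) I.size ×
    (WideAtom ar I.size → Bool)) := instFintypeProd _ _
  rw [Finset.sum_filter, Finset.sum_congr rfl fun ω _ => h1 ω, ← Fintype.sum_prod_type',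
    ← Equiv.sum_comp (configEquiv ψ.quants I.size), Fintype.sum_prod_type, Finset.sum_mul]
  refine Finset.sum_congr rfl fun ν _ => ?_
  rw [Fintype.sum_prod_type, Finset.mul_sum, Finset.sum_mul]
  refine Finset.sum_congr rfl fun c _ => ?_
  rw [← sum_prod_wideAtom, Finset.mul_sum]
  exact Finset.sum_congr rfl fun ρ _ => term_configWorld hψ (List.Subset.refl _) hn I

end system

/-! ### The main theorem -/

section main
variable {m : ℕ} {ar : Fin m → ℕ}

theorem IsRPoly.ite {p : Prop} [Decidable p] {x y : CountingInput m → ℝ}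
    (hx : IsRPoly fun I => C (x I)) (hy : IsRPoly fun I => C (y I)) :
    IsRPoly fun I => C (if p then x I else y I) := by
  split_ifs
  · exact hx
  · exact hy

theorem IsRPoly.C_prod {ι : Type*} (s : Finset ι) {x : ι → CountingInput m → ℝ}
    (h : ∀ i ∈ s, IsRPoly fun I => C (x i I)) : IsRPoly fun I => C (∏ i ∈ s, x i I) := by
  simp only [map_prod]
  exact IsRPoly.prod s h

theorem IsRPoly.C_zero : IsRPoly (m := m) fun _ => C 0 := by
  simpa using IsRPoly.zero

theorem IsRPoly.C_one : IsRPoly (m := m) fun _ => C 1 := by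
  simpa using IsRPoly.one

open Classical in
theorem isScalar_sum_config (L : List (Quant ar)) (ψ : C2Formula ar) (le pr : Fin m)
    (hle : ar le = 2) (hpr : ar pr = 2) (ν : NullSym ar → Bool) :
    IsScalar fun I => ∑ c : PairSystem.Config (ElemType L) (EdgeType ar) I.size,
      (typeSystem L le pr hle hpr ν).weight I c *
        ∏ a, if GoodState ψ ((typeSystem L le pr hle hpr ν).state c a) then 1 else 0 := by
  refine PairSystem.isScalar ?_ ?_ ?_ (g := fun s _ => if GoodState ψ s then 1 else 0) ?_
  · intro τ τ' t i
    simp only [typeSystem]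
    split_ifs <;> simp
  · exact fun τ => (IsRPoly.C_prod _ fun P _ => (IsRPoly.pos _).ite (IsRPoly.neg _)).ite
      IsRPoly.C_zero
  · exact fun τ τ' t b => (IsRPoly.C_prod _ fun P _ => (IsRPoly.pos _).ite (IsRPoly.neg _)).ite
      IsRPoly.C_zero
  · exact fun s => IsRPoly.C_one.ite IsRPoly.C_zero

-- The domain size is fixed at `0` here, so this is a sum with a fixed set of terms.
open Classical in
theorem isScalar_sum_emptyDomain (ψ : C2Formula ar) (le pr : Fin m) (hle : ar le = 2)
    (hpr : ar pr = 2) : IsScalar fun I =>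
      ∑ ω : World ar 0 with StdModel ψ le pr hle hpr ω, worldWeight I.pos I.neg ω :=
  IsScalar.sum _ fun _ _ => IsScalar.of_isRPoly (IsRPoly.C_prod _ fun _ _ =>
    (IsRPoly.pos _).ite (IsRPoly.neg _))

open Classical in
theorem isScalar_sum_stdModel {ψ : C2Formula ar} (hψ : ψ.IsSentence) (le pr : Fin m)
    (hle : ar le = 2) (hpr : ar pr = 2) : IsScalar fun I =>
      ∑ ω : World ar I.size with StdModel ψ le pr hle hpr ω, worldWeight I.pos I.neg ω := by
  have hpow : ∀ P, IsScalar fun I : CountingInput m =>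
      (I.pos P + I.neg P) ^ wideCount ar P I.size := by
    intro P
    obtain ⟨k₀, k₁, k₂, h⟩ := exists_wideCount_eq (ar := ar) P
    refine IsScalar.powOfAddEq ?_ (wideCount ar P) k₀ k₁ k₂ k₂ (ar P) h
    simpa only [C_add] using (IsRPoly.pos P).add (IsRPoly.neg P)
  have hmain := (IsScalar.sum Finset.univ fun (ν : NullSym ar → Bool) _ =>
    (IsScalar.of_isRPoly (f := nullWeight ν) (IsRPoly.C_prod _ fun P _ =>
      (IsRPoly.pos _).ite (IsRPoly.neg _))).mul
      (isScalar_sum_config ψ.quants ψ le pr hle hpr ν)).mul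
    (IsScalar.prod Finset.univ fun P _ => hpow P)
  -- The indicator of `n = 0` combines the separate value for the empty domain with the formula
  -- valid for `n > 0`, without a test on the result.
  have h := (IsScalar.sizeEqZero.mul (isScalar_sum_emptyDomain ψ le pr hle hpr)).add
    (((IsScalar.rat 1).add ((IsScalar.rat (-1)).mul IsScalar.sizeEqZero)).mul hmain)
  refine (congrArg IsScalar (funext fun I => ?_)).mp h
  obtain ⟨n, x, y⟩ := I
  rcases Nat.eq_zero_or_pos n with rfl | hn
  · simp
  · rw [sum_stdModel hψ _ hn]
    simp [hn.ne']

end main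

theorem mainTheorem6 {m : ℕ} (ar : Fin m → ℕ) (le pr : Fin m) (hne : le ≠ pr)
    (hle : ar le = 2) (hpr : ar pr = 2) (ψ : C2Formula ar) (hψ : ψ.IsSentence) :
    RealRAM.ComputableInPolyTime (fun n w wbar =>
      WFOMC n (fun ω : World ar n => ModelsLinearPred ψ le pr hle hpr ω) w wbar) := by
  simp only [wfomc_eq]
  exact (IsScalar.factorial.mul (isScalar_sum_stdModel hψ le pr hle hpr)).computable
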